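/- **Setting.** Let $\mathbb F_q$ be a finite field, $C$ a smooth projective geometrically irreducible curve over $\mathbb F_q$ with function field $K$, $\infty$ a closed point of $C$, and $A=H^0(C\setminus\{\infty\},\mathcal O_C)$. Let $\mathbb C_\infty$ be the completion of an algebraic closure of $K$ at a place above $\infty$, and $K\subseteq L\subseteq\mathbb C_\infty$ an intermediate field. Tensor products without index are over $\mathbb F_q$. Let $(E,\phi)$ be a (possibly non-abelian) Anderson $A$-module over $L$ of dimension $d$ and generic characteristic: $E\cong\mathbb G_{a,L}^d$ as $\mathbb F_q$-vector space schemes, with an $\mathbb F_q$-algebra homomorphism $\phi:A\to\operatorname{End}_{\mathbb F_q}(E)$, $a\mapsto\phi_a$, such that $d\phi_a-a$ is nilpotent on $\operatorname{Lie}E$ for all $a\in A$. It is *uniformizable* if its exponential map $\operatorname{Lie}E\to E(\mathbb C_\infty)$ is surjective. For an ideal $\mathfrak a$ of $A$, $E[\mathfrak a]=\{x\in E(\mathbb C_\infty)\mid \phi_a(x)=0\ \forall a\in\mathfrak a\}$. For an $\mathbb F_q$-basis $B$ of $A$ let $E(\mathbb T)$ be the space of series $\sum_{b\in B}b\otimes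 e_b$ with $e_b\in E(\mathbb C_\infty)$, $e_b\to0$; it does not depend on $B$. The $A$-module of *special functions* is $\mathfrak{sf}(E)=\{h\in E(\mathbb T)\mid \phi_a(h)=a\cdot h\ \forall a\in A\}$, where $\phi_a$ acts on the second and $a\cdot{}$ on the first tensor factor. Let $\mathfrak p$ be a non-zero prime ideal of $A$, $\mathbb F_{\mathfrak p}=A/\mathfrak p$, $A_{(\mathfrak p)}$ the localization and $A_{\mathfrak p}$ the completion of $A$ at $\mathfrak p$, and $\pi\in\mathfrak p\setminus\mathfrak p^2$ a uniformizer. Put $E_{\mathfrak p}=\varprojlim_n (A/\mathfrak p^{n+1})\otimes E(\mathbb C_\infty)$, an $A_{\mathfrak p}$-module via the first factor, and $\hat H_{\mathfrak p}=\{h\in E_{\mathfrak p}\mid\phi_a(h)=a\cdot h\ \forall a\in A\}$. The map $\sum_b b\otimes e_b\mapsto\big(\sum_b (b\bmod\mathfrak p^{n+1})\otimes e_b\big)_n$ sends $\mathfrak{sf}(E)$ into $\hat H_{\mathfrak p}$, and we regard special functions as elements of $\hat H_{\mathfrak p}$. For $h\in E_{\mathfrak p}$ let $h(\mathfrak p)\in\mathbb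 F_{\mathfrak p}\otimes E(\mathbb C_\infty)$ be its image modulo $\mathfrak p$. A hyperderivation on an $\mathbb F_q$-algebra $R$ is a family of $\mathbb F_q$-linear maps $\partial^{(n)}:R\to R$ ($n\ge0$) with $\partial^{(0)}=\mathrm{id}$ and $\partial^{(n)}(fg)=\sum_{i+j=n}\partial^{(i)}(f)\,\partial^{(j)}(g)$. For $t\in A\setminus\mathbb F_q$ the hyperderivation with respect to $t$ on $\mathbb F_q[t]$ is given by $\partial_t^{(n)}(t^i)=\binom in t^{i-n}$. A hyperderivation on $A_{\mathfrak p}$ is extended to $E_{\mathfrak p}$ by applying $\partial^{(n)}\otimes\mathrm{id}$ and passing to the limit. The hyperderivation with respect to $\pi$ extends uniquely from $\mathbb F_q[\pi]$ to a hyperderivation $(\partial_\pi^{(n)})_n$ on $A_{\mathfrak p}$. **Theorem.** Let $E$ be uniformizable, and let $h_1,\dots,h_r\in\mathfrak{sf}(E)$ be such that $1\otimes h_1,\dots,1\otimes h_r$ is an $A_{\mathfrak p}$-basis of $A_{\mathfrak p}\otimes_A\mathfrak{sf}(E)$ (for instance, an $A_{(\mathfrak p)}$-basis of $A_{(\mathfrak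 p)}\otimes_A\mathfrak{sf}(E)$). Let $t\in A\setminus\mathbb F_q$ be such that $\partial_\pi^{(1)}(t)\in A_{\mathfrak p}^\times$. Then: 1. The hyperderivation $(\partial_t^{(n)})_{n\ge0}$ on $\mathbb F_q[t]$ extends uniquely to a hyperderivation on $A_{(\mathfrak p)}$ and uniquely to one on $A_{\mathfrak p}$, and the latter restricts to the former on $A_{(\mathfrak p)}$. 2. For all $h\in\hat H_{\mathfrak p}$ and $n\ge0$, $\partial_t^{(n)}(h)(\mathfrak p)\in\mathbb F_{\mathfrak p}\otimes E[\mathfrak p^{n+1}]$ and $$\partial_t^{(n)}(h)(\mathfrak p)\equiv\Big(\big(\partial_\pi^{(1)}(t)\big)^{-n}\cdot\partial_\pi^{(n)}(h)\Big)(\mathfrak p)\pmod{\mathbb F_{\mathfrak p}\otimes E[\mathfrak p^{n}]}.$$ 3. Let $\mathrm{tr}:\mathbb F_{\mathfrak p}\to\mathbb F_q$ be the trace. For every $n\ge0$ the elements $(\mathrm{tr}\otimes\mathrm{id})\big(\partial_t^{(n)}(h_i)(\mathfrak p)\big)$, $i=1,\dots,r$, form an $A/\mathfrak p^{n+1}$-basis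 of $E[\mathfrak p^{n+1}]$. -/

import Mathlib

open scoped TensorProduct Topology

/-! ### The coefficient ring `A` -/

/-- `K` is a function field of one variable over `k` with exact field of constants `k`. For a finite
field `k` these are precisely the function fields of smooth projective geometrically irreducible
curves over `k`. -/
structure IsCurveFunctionField (k K : Type*) [Field k] [Field K] [Algebra k K] : Prop where
  exists_finite : ∃ x : K, Transcendental k x ∧
    FiniteDimensional (IntermediateField.adjoin k {x}) K
  exact_constants : ∀ x : K, IsAlgebraic k x → x ∈ (algebraMap k K).range

/-- The closed points of the curve with function field `K` are the valuation rings `O ≠ K` of `K`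
over `k` (the local rings of the curve). This is the ring of functions that are regular at every
closed point different from `P`. -/
def regularOutside (k : Type*) {K : Type*} [Field k] [Field K] [Algebra k K]
    (P : ValuationSubring K) : Subalgebra k K where
  carrier := {f | ∀ O : ValuationSubring K, O ≠ P → (∀ c : k, algebraMap k K c ∈ O) → f ∈ O}
  mul_mem' hf hg O h1 h2 := mul_mem (hf O h1 h2) (hg O h1 h2)
  add_mem' hf hg O h1 h2 := add_mem (hf O h1 h2) (hg O h1 h2)
  algebraMap_mem' c _ _ h2 := h2 c

/-! ### Hyperderivations -/

/-- A hyperderivation (higher derivation) on a `k`-algebra `R`. -/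
structure Hyperderivation (k R : Type*) [CommRing k] [CommRing R] [Algebra k R] where
  /-- The hyperdifferential operators. -/
  op : ℕ → R →ₗ[k] R
  op_zero : op 0 = LinearMap.id
  leibniz : ∀ n f g, op n (f * g) = ∑ ij ∈ Finset.HasAntidiagonal.antidiagonal n, op ij.1 f * op ij.2 g

namespace Hyperderivation

variable {k R : Type*} [CommRing k] [CommRing R] [Algebra k R]

/-- `D` extends the hyperderivation with respect to `t` on `k[t]`, which is given by
`∂⁽ⁿ⁾ (∑ cᵢ tⁱ) = ∑ (i choose n) cᵢ tⁱ⁻ⁿ`. -/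
def IsWithRespectTo (D : Hyperderivation k R) (t : R) : Prop :=
  ∀ (n : ℕ) (f : Polynomial k),
    D.op n (Polynomial.aeval t f) = Polynomial.aeval t (Polynomial.hasseDeriv n f)

theorem op_mem_pow (D : Hyperderivation k R) (J : Ideal R) (m : ℕ) :
    ∀ (n : ℕ) (x : R), x ∈ J ^ m → D.op n x ∈ J ^ (m - n) := by
  induction m with
  | zero => intro n x _; simp
  | succ m ih =>
    intro n x hx
    rw [pow_succ] at hx
    induction hx using Submodule.mul_induction_on' with
    | mem_mul_mem a ha b hb =>
      rw [D.leibniz]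
      refine Ideal.sum_mem _ ?_
      rintro ⟨i, j⟩ hij
      rw [Finset.HasAntidiagonal.mem_antidiagonal] at hij
      dsimp only at hij ⊢
      rcases Nat.eq_zero_or_pos j with rfl | hj
      · have h1 : D.op i a * b ∈ J ^ (m - i) * J := Ideal.mul_mem_mul (ih i a ha) hb
        rw [← pow_succ] at h1
        rw [D.op_zero]
        exact Ideal.pow_le_pow_right (by omega) h1
      · exact Ideal.mul_mem_right _ _ (Ideal.pow_le_pow_right (by omega) (ih i a ha))
    | add a _ b _ ha hb => rw [map_add]; exact add_mem ha hb

end Hyperderivation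

section Induced

variable {k A : Type*} [CommRing k] [CommRing A] [Algebra k A]

theorem evalA_op_eq_zero {𝔭 : Ideal A} (D : Hyperderivation k (AdicCompletion 𝔭 A)) (n m : ℕ)
    (x : A) (hx : x ∈ 𝔭 ^ (m + n + 1)) :
    AdicCompletion.evalₐ 𝔭 (m + 1) (D.op n (algebraMap A (AdicCompletion 𝔭 A) x)) = 0 := by
  have h1 : algebraMap A (AdicCompletion 𝔭 A) x ∈
      (𝔭.map (algebraMap A (AdicCompletion 𝔭 A))) ^ (m + 1 + n) := by
    rw [← Ideal.map_pow, Nat.add_right_comm]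
    exact Ideal.mem_map_of_mem _ hx
  have h2 := D.op_mem_pow _ _ n _ h1
  rw [Nat.add_sub_cancel] at h2
  have h3 := Ideal.mem_map_of_mem (AdicCompletion.evalₐ 𝔭 (m + 1)).toRingHom h2
  rw [Ideal.map_pow, Ideal.map_map] at h3
  have h4 : (AdicCompletion.evalₐ 𝔭 (m + 1)).toRingHom.comp
      (algebraMap A (AdicCompletion 𝔭 A)) = Ideal.Quotient.mk (𝔭 ^ (m + 1)) := by
    ext a
    exact (AdicCompletion.evalₐ 𝔭 (m + 1)).commutes a
  rw [h4, ← Ideal.map_pow, Ideal.map_quotient_self] at h3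
  exact h3

/-- The map `A/𝔭ᵐ⁺ⁿ⁺¹ → A/𝔭ᵐ⁺¹` induced by the hyperdifferential operator `∂⁽ⁿ⁾` of `A_𝔭`. -/
noncomputable def Hyperderivation.induced {𝔭 : Ideal A}
    (D : Hyperderivation k (AdicCompletion 𝔭 A)) (n m : ℕ) :
    (A ⧸ 𝔭 ^ (m + n + 1)) →ₗ[k] (A ⧸ 𝔭 ^ (m + 1)) :=
  Submodule.liftQ ((𝔭 ^ (m + n + 1)).restrictScalars k)
    (((AdicCompletion.evalₐ 𝔭 (m + 1)).restrictScalars k).toLinearMap ∘ₗ D.op n ∘ₗ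
      (IsScalarTower.toAlgHom k A (AdicCompletion 𝔭 A)).toLinearMap)
    (fun x hx => evalA_op_eq_zero D n m x hx)

/-- The projection `A/𝔭ᵐ → A/𝔭ˡ` for `l ≤ m`, as a `k`-linear map. -/
noncomputable def quotientPowProj (k : Type*) {A : Type*} [CommRing k] [CommRing A] [Algebra k A]
    (𝔭 : Ideal A) {l m : ℕ} (h : l ≤ m) : (A ⧸ 𝔭 ^ m) →ₗ[k] (A ⧸ 𝔭 ^ l) :=
  (Ideal.Quotient.factorₐ k (Ideal.pow_le_pow_right h)).toLinearMap

/-- The projection `A/𝔭ⁿ⁺¹ → A/𝔭`, as a `k`-linear map. -/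
noncomputable def residueProj (k : Type*) {A : Type*} [CommRing k] [CommRing A] [Algebra k A]
    (𝔭 : Ideal A) (n : ℕ) : (A ⧸ 𝔭 ^ (n + 1)) →ₗ[k] (A ⧸ 𝔭) :=
  (Ideal.Quotient.factorₐ k (Ideal.pow_le_self n.succ_ne_zero)).toLinearMap

end Induced

/-! ### Anderson `A`-modules -/

/-- An Anderson `A`-module of dimension `d` over `L`, in coordinates `E = 𝔾ₐᵈ`.
An `Fq`-linear endomorphism of `𝔾ₐᵈ` over `L` is a twisted polynomial `∑ Mᵢ τⁱ` with
`Mᵢ ∈ Mat_d(L)`, where `τ` is the `q`-power Frobenius. As the field `C ⊇ L` is infinite, it is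
determined by the map `x ↦ ∑ Mᵢ x^(qⁱ)` which it induces on `E(C) = Cᵈ`. Here `coeff a` is the
family of the coefficients of `φ_a`, and `φ a` is the induced map on `E(C)`. -/
structure AndersonModule (Fq A L C : Type*) [Field Fq] [CommRing A] [Algebra Fq A] [Field L]
    [Algebra A L] [NormedField C] [Algebra L C] [Algebra Fq C] (d : ℕ) where
  coeff : A → ℕ →₀ Matrix (Fin d) (Fin d) L
  φ : A →ₐ[Fq] Module.End Fq (Fin d → C)
  φ_apply : ∀ (a : A) (x : Fin d → C), φ a x = (coeff a).sum fun i M =>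
    (M.map (algebraMap L C)).mulVec fun j => x j ^ Nat.card Fq ^ i
  /-- `dφ_a - ℓ(a)` is nilpotent on `Lie E`. -/
  nilpotent : ∀ a : A, IsNilpotent (coeff a 0 - Matrix.scalar (Fin d) (algebraMap A L a))

namespace AndersonModule

section

variable {Fq A L C : Type*} [Field Fq] [CommRing A] [Algebra Fq A] [Field L]
    [Algebra A L] [NormedField C] [Algebra L C] [Algebra Fq C] {d : ℕ}

/-- The action `dφ_a` on `Lie E (C) = Cᵈ`. -/
def lieAction (E : AndersonModule Fq A L C d) (a : A) (x : Fin d → C) : Fin d → C :=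
  ((E.coeff a 0).map (algebraMap L C)).mulVec x

/-- `e : Lie E → E(C)` is the exponential map of `E`: it is given by an everywhere convergent
series `∑ cᵢ x^(qⁱ)` with `c₀ = 1`, and `φ_a(e(x)) = e(dφ_a(x))`. -/
def IsExponential (E : AndersonModule Fq A L C d) (e : (Fin d → C) → (Fin d → C)) : Prop :=
  (∃ c : ℕ → Matrix (Fin d) (Fin d) C, c 0 = 1 ∧
    ∀ x, HasSum (fun i => (c i).mulVec fun j => x j ^ Nat.card Fq ^ i) (e x)) ∧
  ∀ a x, E.φ a (e x) = e (E.lieAction a x)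

/-- `E` is uniformizable: its exponential map is surjective. -/
def IsUniformizable (E : AndersonModule Fq A L C d) : Prop :=
  ∃ e, E.IsExponential e ∧ Function.Surjective e

/-- The `A`-module `E(C)` of `C`-valued points, where `A` acts via `φ`. -/
def Points (_ : AndersonModule Fq A L C d) : Type _ := Fin d → C

variable (E : AndersonModule Fq A L C d)

noncomputable instance : AddCommGroup E.Points := inferInstanceAs (AddCommGroup (Fin d → C))
noncomputable instance : Module Fq E.Points := inferInstanceAs (Module Fq (Fin d → C))
noncomputable instance : TopologicalSpace E.Points :=
  inferInstanceAs (TopologicalSpace (Fin d → C))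
noncomputable instance : Module A E.Points :=
  Module.compHom (Fin d → C) (E.φ : A →+* Module.End Fq (Fin d → C))

theorem smul_points_def (a : A) (x : E.Points) : a • x = E.φ a x := rfl

instance : IsScalarTower Fq A E.Points where
  smul_assoc c a x := by
    rw [smul_points_def, map_smul]
    rfl

/-- The torsion `E[𝔞]`. -/
noncomputable abbrev torsion (𝔞 : Ideal A) : Submodule A E.Points := Submodule.torsionBySet A E.Points 𝔞

/-- `W ⊗ E[𝔞]` as a subspace of `W ⊗ E(C)`, for an `Fq`-vector space `W`. -/
noncomputable def tensorTorsion (W : Type*) [AddCommGroup W] [Module Fq W] (𝔞 : Ideal A) :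
    Submodule Fq (W ⊗[Fq] E.Points) :=
  LinearMap.range (LinearMap.lTensor W ((E.torsion 𝔞).subtype.restrictScalars Fq))

/-- Multiplication by `φ_a` on `E(C)`, as an `Fq`-linear map. -/
noncomputable def φLin (a : A) : E.Points →ₗ[Fq] E.Points := E.φ a

theorem continuous_φ (a : A) : Continuous fun x : E.Points => a • x := by
  have h : (fun x : Fin d → C => E.φ a x) = fun x => (E.coeff a).sum fun i M =>
      (M.map (algebraMap L C)).mulVec fun j => x j ^ Nat.card Fq ^ i :=
    funext (E.φ_apply a)
  change Continuous fun x : Fin d → C => E.φ a x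
  rw [h]
  unfold Finsupp.sum
  refine continuous_finsetSum _ fun i _ => ?_
  exact Continuous.matrix_mulVec continuous_const (by fun_prop)

/-- The space of special functions. With respect to an `Fq`-basis `B` of `A`, the elements of
`E(𝕋)` are the series `h = ∑_b b ⊗ e_b` with `e_b ∈ E(C)` tending to `0`, and are given here by the
family `(e_b)_b`. The `b'`-component of `x · h = ∑_b (x b) ⊗ e_b` is the sum over all `b` of
`e_b` times the `b'`-coordinate of `x b`; the condition is `x · h = φ_x(h)` for all `x ∈ A`.
The `A`-action on special functions is `x · h = φ_x(h)`. -/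
noncomputable def specialFunctions {ι : Type*} (B : Module.Basis ι Fq A) :
    Submodule A (ι → E.Points) where
  carrier := {e | Filter.Tendsto e Filter.cofinite (𝓝 0) ∧
    ∀ (x : A) (b' : ι), HasSum (fun b => B.repr (x * B b) b' • e b) (x • e b')}
  zero_mem' := by
    refine ⟨tendsto_const_nhds, fun x b' => ?_⟩
    simp only [Pi.zero_apply, smul_zero]
    exact hasSum_zero
  add_mem' {e f} he hf := by
    have : IsTopologicalAddGroup E.Points := inferInstanceAs (IsTopologicalAddGroup (Fin d → C))
    refine ⟨by
      have h := he.1.add hf.1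
      rw [add_zero] at h
      exact h, fun x b' => ?_⟩
    simp only [Pi.add_apply, smul_add]
    exact (he.2 x b').add (hf.2 x b')
  smul_mem' a e he := by
    refine ⟨?_, fun x b' => ?_⟩
    · have h := ((E.continuous_φ a).tendsto 0).comp he.1
      rw [smul_zero] at h
      exact h
    · have h := (he.2 x b').map (DistribSMul.toAddMonoidHom E.Points a) (E.continuous_φ a)
      have e1 : (DistribSMul.toAddMonoidHom E.Points a) (x • e b') = x • (a • e) b' := by
        simp only [DistribSMul.toAddMonoidHom_apply, Pi.smul_apply]
        exact smul_comm _ _ _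
      rw [e1] at h
      convert h using 2 with b
      change _ = a • (B.repr (x * B b) b' • e b)
      rw [smul_algebra_smul_comm]
      rfl

variable (𝔭 : Ideal A)

/-- Sequences in `∏ₙ (A/𝔭ⁿ⁺¹) ⊗ E(C)`. -/
abbrev PadicSeq : Type _ := ∀ n : ℕ, (A ⧸ 𝔭 ^ (n + 1)) ⊗[Fq] E.Points

/-- `E((A ⊗ C)_𝔭) = lim (A/𝔭ⁿ⁺¹) ⊗ E(C)`, as the space of compatible sequences. -/
noncomputable def padicPoints : Submodule Fq (E.PadicSeq 𝔭) where
  carrier := {z | ∀ n, LinearMap.rTensor E.Points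
    (quotientPowProj Fq 𝔭 (Nat.le_succ (n + 1))) (z (n + 1)) = z n}
  zero_mem' n := by simp
  add_mem' hx hy n := by simp only [Pi.add_apply, map_add]; rw [hx n, hy n]
  smul_mem' c x hx n := by simp only [Pi.smul_apply, map_smul]; rw [hx n]

/-- `Ĥ_𝔭`: the elements `h` of `E((A ⊗ C)_𝔭)` with `φ_a(h) = a · h` for all `a ∈ A`, where `φ_a`
acts on the second and `a ·` on the first tensor factor. -/
noncomputable def hatH : Submodule Fq (E.PadicSeq 𝔭) where
  carrier := {z | z ∈ E.padicPoints 𝔭 ∧ ∀ (a : A) (n : ℕ),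
    LinearMap.lTensor (A ⧸ 𝔭 ^ (n + 1)) (E.φLin a) (z n) = a • z n}
  zero_mem' := ⟨zero_mem _, fun a n => by simp⟩
  add_mem' hx hy := ⟨add_mem hx.1 hy.1, fun a n => by
    simp only [Pi.add_apply, map_add, smul_add]; rw [hx.2 a n, hy.2 a n]⟩
  smul_mem' c x hx := ⟨Submodule.smul_mem _ c hx.1, fun a n => by
    simp only [Pi.smul_apply, map_smul]; rw [hx.2 a n]; exact smul_comm c a (x n)⟩

/-- The topology on `W ⊗ E(C)` for which all the maps `λ ⊗ id : W ⊗ E(C) → E(C)` with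
`λ : W → Fq` linear are continuous; for finite-dimensional `W` this is the product topology of
`E(C)ᵐ` with respect to any basis of `W`. -/
noncomputable abbrev sliceTopology (W : Type*) [AddCommGroup W] [Module Fq W] :
    TopologicalSpace (W ⊗[Fq] E.Points) :=
  ⨅ l : Module.Dual Fq W, TopologicalSpace.induced
    (fun z => TensorProduct.lid Fq E.Points (LinearMap.rTensor E.Points l z)) inferInstance

/-- The embedding `E(𝕋) → E((A ⊗ C)_𝔭)`: it maps `∑_b b ⊗ e_b` to the sequence of the limits of the
convergent series `∑_b (b mod 𝔭ⁿ⁺¹) ⊗ e_b`. -/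
noncomputable def toPadic {ι : Type*} (B : Module.Basis ι Fq A) (e : ι → E.Points) :
    E.PadicSeq 𝔭 := fun n =>
  letI := E.sliceTopology (A ⧸ 𝔭 ^ (n + 1))
  ∑' b, (Ideal.Quotient.mk (𝔭 ^ (n + 1)) (B b)) ⊗ₜ[Fq] e b

/-- The operator `∂⁽ⁿ⁾` on `E((A ⊗ C)_𝔭)`: the extension of `∂⁽ⁿ⁾ ⊗ id` by continuity. -/
noncomputable def hyperOp {𝔭 : Ideal A} (D : Hyperderivation Fq (AdicCompletion 𝔭 A)) (n : ℕ)
    (z : E.PadicSeq 𝔭) : E.PadicSeq 𝔭 := fun m =>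
  LinearMap.rTensor E.Points (D.induced n m) (z (m + n))

/-- The action of `A_𝔭` on `E((A ⊗ C)_𝔭)` through the first tensor factor. -/
noncomputable def leftMul {𝔭 : Ideal A} (u : AdicCompletion 𝔭 A) (z : E.PadicSeq 𝔭) :
    E.PadicSeq 𝔭 := fun m =>
  LinearMap.rTensor E.Points
    (LinearMap.mulLeft Fq (AdicCompletion.evalₐ 𝔭 (m + 1) u)) (z m)

/-- The evaluation `h(𝔭) ∈ 𝔽_𝔭 ⊗ E(C)`. -/
noncomputable def evalAt {𝔭 : Ideal A} (z : E.PadicSeq 𝔭) : (A ⧸ 𝔭) ⊗[Fq] E.Points :=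
  LinearMap.rTensor E.Points (residueProj Fq 𝔭 0) (z 0)

/-- `tr ⊗ id : 𝔽_𝔭 ⊗ E(C) → E(C)`, with `tr` the trace of `𝔽_𝔭` over `Fq`. -/
noncomputable def traceMap : (A ⧸ 𝔭) ⊗[Fq] E.Points →ₗ[Fq] E.Points :=
  (TensorProduct.lid Fq E.Points).toLinearMap ∘ₗ
    LinearMap.rTensor E.Points (Algebra.trace Fq (A ⧸ 𝔭))

end

end AndersonModule

/-!
The theorem combines three facts: hyperderivations are rigid in characteristic `p`, special functions
are linear maps on the dual of `A`, and torsion points of a uniformizable module lift to null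
sequences of torsion points. Here `p` is the characteristic, and `*` denotes the dual over the
finite field `k`.

*Hyperderivations.* As `k` is perfect, the function field satisfies `K = K^p(s)` for every `s` that is
not a `p`-th power. For a uniformizer `s` at `𝔭` this descends to the local ring `R`, because the
orders of `aᵢᵖ sⁱ` for `i < p` are different modulo `p` (`FrobeniusSpans.localization`), and then
`R` consists of polynomials in `s`, or in `s + cᵖ`, over the `p^m`-th powers, for each `m`. The
operator `∂⁽ⁿ⁾` with `n < p^m` is linear over these powers, so it must differentiate such
polynomials (`Hyperderivation.IsWithRespectTo.unique`), and it can be defined in this way, as the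
relations are multiples of a polynomial `X^(p^e) - c` with `e ≥ m`
(`Hyperderivation.exists_isWithRespectTo`). If `∂_π(t)` is a unit, then `t = s + cᵖ` with a uniformizer
`s`, since the residue field is perfect. Continuity gives the extension to the completion
(`existsUnique_hyperderivation_adicCompletion`).

*Values at `𝔭`.* A special function `h` is determined by the map `λ ↦ (λ ⊗ id)(h)` from `A^*` to `E`,
which is `A`-linear (`IsSpecialFamily.dualPairing_comp`); elements of `Ĥ_𝔭` are `A`-linear maps on the
union of the `(A/𝔭ⁿ)^*`. The operator `∂⁽ⁿ⁾` reduces to a linear map `A/𝔭ⁿ⁺¹ → A/𝔭`, so that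
hyperderivatives at `𝔭` are `𝔭ⁿ⁺¹`-torsion. On `𝔭ⁿ` this linear map is `a πⁿ ↦ a ∂(π)ⁿ`
(`Hyperderivation.residueOp_mk_mul_pow`), which gives the comparison of `∂_t⁽ⁿ⁾` and `∂_π⁽ⁿ⁾`,
because `∂_t(π)` and `∂_π(t)` are inverse to each other modulo `𝔭`. It follows also that
`tr ∘ ∂_t⁽ⁿ⁾` generates the `A`-module `(A/𝔭ⁿ⁺¹)^*` (`exists_dual_eq_trace_residueOp`).

*Torsion.* Put `N = n + 1`. An `A`-linear map `(A/𝔭ᴺ)^* → E` amounts, by its value at that generator, to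
a `𝔭ᴺ`-torsion point, so the basis property (`exists_basis_torsion`) follows from two facts on the
restriction of special functions to `(A/𝔭ᴺ)^*`. The kernel is divisible by `π^N` locally at `𝔭`
(`IsSpecialFamily.exists_smul_eq_pow_smul`). The restriction is surjective
(`exists_isSpecialFamily_of_dual_quotient`): `A` is finite over `k[π]`, and special functions arise
from `A`-linear maps of `Hom_{k[π]}(A, k[π])` into the null sequences `(x_i)` with
`π x_{i+1} = x_i` and `π x_0 = 0`. As `Hom_{k[π]}(A, k[π])` is projective over `A`, these maps can
be lifted from a torsion quotient once every `π^N`-torsion point is a member of such a sequence. For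
the point `exp(v)` the sequence comes from the points `exp(dφ_π^{-i} v)`, which tend to `0` because `π`
has a pole at `∞` (`AndersonModule.IsUniformizable.exists_torsionTower`).
-/

/-! ### Hyperderivations in characteristic `p` -/

section FrobeniusGenerated

open Polynomial

variable {R : Type*} [CommRing R] (p : ℕ) [hp : Fact p.Prime] [CharP R p]

/-- `R = R^p[t]`: every element of `R` is a polynomial in `t` with `p`-th powers as coefficients. -/
def FrobeniusGenerates (t : R) : Prop :=
  ∀ f : R, ∃ P : R[X], P.eval₂ (frobenius R p) t = f

/-- `R = ∑_{i < p} R^p tⁱ`. -/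
def FrobeniusSpans (t : R) : Prop :=
  ∀ f : R, ∃ a : ℕ → R, f = ∑ i ∈ Finset.range p, a i ^ p * t ^ i

variable {p}

theorem FrobeniusSpans.generates {t : R} (h : FrobeniusSpans p t) : FrobeniusGenerates p t := by
  intro f
  obtain ⟨a, ha⟩ := h f
  refine ⟨∑ i ∈ Finset.range p, C (a i) * X ^ i, ?_⟩
  rw [eval₂_finsetSum, ha]
  simp [frobenius_def]

theorem FrobeniusGenerates.add_pow {t : R} (h : FrobeniusGenerates p t) (c : R) :
    FrobeniusGenerates p (t + c ^ p) := by
  intro f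
  obtain ⟨P, hP⟩ := h f
  refine ⟨P.comp (X - C c), ?_⟩
  rw [← hP, eval₂_comp]
  simp [frobenius_def]

/-- Substituting the expressions of the coefficients gives `R = R^(p^m)[t]` for all `m`. -/
theorem FrobeniusGenerates.iterate {t : R} (h : FrobeniusGenerates p t) (m : ℕ) (f : R) :
    ∃ P : R[X], P.eval₂ (iterateFrobenius R p m) t = f := by
  induction m generalizing f with
  | zero => exact ⟨C f, by simp⟩
  | succ m ih =>
    obtain ⟨P, rfl⟩ := h f
    let S := (eval₂RingHom (iterateFrobenius R p (m + 1)) t).range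
    change P.eval₂ (frobenius R p) t ∈ S
    rw [eval₂_eq_sum]
    refine Subring.sum_mem _ fun i _ => S.mul_mem ?_ (S.pow_mem ⟨X, by simp⟩ i)
    obtain ⟨Q, hQ⟩ := ih (P.coeff i)
    refine ⟨expand R p Q, ?_⟩
    rw [← hQ, hom_eval₂, coe_eval₂RingHom, expand_eq_comp_X_pow, eval₂_comp]
    congr 1
    · ext a
      simp [iterateFrobenius_def, frobenius_def, pow_succ, pow_mul]
    · simp [frobenius_def]

end FrobeniusGenerated

namespace Hyperderivation

open Polynomial

section

variable {k R : Type*} [CommRing k] [CommRing R] [Algebra k R]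

@[ext] theorem ext' {D D' : Hyperderivation k R} (h : ∀ n x, D.op n x = D'.op n x) : D = D' := by
  cases D; cases D'
  congr
  funext n
  ext x
  exact h n x

/-- The Taylor homomorphism `f ↦ ∑ₙ ∂⁽ⁿ⁾(f) Xⁿ` of a hyperderivation. -/
noncomputable def taylor (D : Hyperderivation k R) : R →+* PowerSeries R where
  toFun f := PowerSeries.mk fun n => D.op n f
  map_zero' := by ext; simp
  map_add' f g := by ext; simp
  map_mul' f g := by
    ext n
    simp only [PowerSeries.coeff_mk, PowerSeries.coeff_mul, D.leibniz]
  map_one' := by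
    set u := PowerSeries.mk fun n => D.op n (1 : R) with hu
    have h1 : u * u = u := by
      ext n
      simp only [hu, PowerSeries.coeff_mk, PowerSeries.coeff_mul]
      rw [← D.leibniz, mul_one]
    have h2 : IsUnit u := by
      rw [PowerSeries.isUnit_iff_constantCoeff, ← PowerSeries.coeff_zero_eq_constantCoeff_apply]
      simp [hu, D.op_zero]
    exact h2.mul_left_cancel (by rw [h1, mul_one])

@[simp] theorem coeff_taylor (D : Hyperderivation k R) (n : ℕ) (f : R) :
    PowerSeries.coeff n (D.taylor f) = D.op n f := by
  simp [taylor]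

/-- The Taylor expansion of `a^(p^m)` is a power series in `X^(p^m)`. -/
theorem op_pow_expChar_pow (D : Hyperderivation k R) {p : ℕ} [Fact p.Prime] [CharP R p] (m : ℕ)
    {n : ℕ} (h0 : 0 < n) (hn : n < p ^ m) (a : R) : D.op n (a ^ p ^ m) = 0 := by
  have : CharP (PowerSeries R) p :=
    charP_of_injective_ringHom PowerSeries.C_injective p
  have h1 : D.taylor a = PowerSeries.C a +
      PowerSeries.X * (PowerSeries.mk fun n => D.op (n + 1) a) := by
    ext i
    cases i <;> simp [D.op_zero, PowerSeries.coeff_succ_X_mul]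
  rw [← coeff_taylor, map_pow, h1, add_pow_char_pow, map_add, ← map_pow, mul_pow,
    PowerSeries.coeff_C, if_neg h0.ne', zero_add, PowerSeries.coeff_X_pow_mul', if_neg (by omega)]

/-- For `n < p^m` the operator `∂⁽ⁿ⁾` differentiates polynomials in `t` as if their `p^m`-th power
coefficients were constants. -/
theorem op_eval₂_iterateFrobenius {D : Hyperderivation k R} {t : R} (hD : D.IsWithRespectTo t)
    {p : ℕ} [Fact p.Prime] [CharP R p] {m n : ℕ} (hn : n < p ^ m) (P : R[X]) :
    D.op n (P.eval₂ (iterateFrobenius R p m) t) =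
      (hasseDeriv n (P.map (iterateFrobenius R p m))).eval t := by
  induction P using Polynomial.induction_on' with
  | add P Q hP hQ => simp [hP, hQ]
  | monomial i a =>
    have h1 : D.op n (t ^ i) = (i.choose n : R) * t ^ (i - n) := by
      have := hD n (X ^ i)
      simpa [← monomial_one_right_eq_X_pow, hasseDeriv_monomial, aeval_monomial] using this
    rw [eval₂_monomial, D.leibniz, map_monomial, hasseDeriv_monomial, eval_monomial,
      Finset.sum_eq_single (0, n)]
    · rw [D.op_zero, h1, LinearMap.id_apply]; ring
    · rintro ⟨i', j'⟩ hij hne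
      rw [Finset.HasAntidiagonal.mem_antidiagonal] at hij
      dsimp only at hij ⊢
      rw [iterateFrobenius_def, op_pow_expChar_pow D m _ (by omega), zero_mul]
      rcases Nat.eq_zero_or_pos i' with rfl | h
      · exact absurd (by ext <;> simp at hij ⊢; exact hij) hne
      · exact h
    · simp

/-- A hyperderivation with respect to a generator over `p`-th powers is unique. -/
theorem IsWithRespectTo.unique {p : ℕ} [Fact p.Prime] [CharP R p] {t : R}
    (ht : FrobeniusGenerates p t) {D D' : Hyperderivation k R} (hD : D.IsWithRespectTo t)
    (hD' : D'.IsWithRespectTo t) : D = D' := by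
  ext n f
  obtain ⟨P, rfl⟩ := ht.iterate n f
  rw [op_eval₂_iterateFrobenius hD (Nat.lt_pow_self (Fact.out : p.Prime).one_lt),
    op_eval₂_iterateFrobenius hD' (Nat.lt_pow_self (Fact.out : p.Prime).one_lt)]

end

section Existence

variable {k R : Type*} [Field k] [Finite k] [CommRing R] [Algebra k R] {p : ℕ} [Fact p.Prime]
  [CharP R p] {t : R}

/-- If relations of `t` over `p^m`-th powers are compatible with the divided derivatives of order
less than `p^m`, then `∂⁽ⁿ⁾` can be defined by differentiating, with respect to `t`, any expression
as a polynomial in `t` over `p^m`-th powers with `n < p^m`. -/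
theorem exists_isWithRespectTo (ht : FrobeniusGenerates p t)
    (hrel : ∀ (n : ℕ) (P : R[X]), P.eval₂ (iterateFrobenius R p n) t = 0 →
      (hasseDeriv n (P.map (iterateFrobenius R p n))).eval t = 0) :
    ∃ D : Hyperderivation k R, D.IsWithRespectTo t := by
  rcases subsingleton_or_nontrivial R with hR | hR
  · exact ⟨⟨fun _ => LinearMap.id, rfl, fun _ _ _ => Subsingleton.elim _ _⟩,
      fun _ _ => Subsingleton.elim _ _⟩
  have : CharP k p := (Algebra.charP_iff k R p).2 inferInstance
  choose P hP using fun (n : ℕ) f => ht.iterate n f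
  -- `∂⁽ⁿ⁾` is read off from any expression over `p^m`-th powers with `m ≥ n`, not only from `P n`
  have key : ∀ (m n : ℕ) (Q : R[X]), n ≤ m →
      (hasseDeriv n ((P n (Q.eval₂ (iterateFrobenius R p m) t)).map (iterateFrobenius R p n))).eval t
        = (hasseDeriv n (Q.map (iterateFrobenius R p m))).eval t := by
    intro m n Q hnm
    obtain ⟨l, rfl⟩ := Nat.exists_eq_add_of_le hnm
    have h1 : iterateFrobenius R p (n + l) =
        (iterateFrobenius R p n).comp (iterateFrobenius R p l) := by
      ext a; rw [iterateFrobenius_add_apply, RingHom.comp_apply]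
    have h2 := hrel n (P n (Q.eval₂ (iterateFrobenius R p (n + l)) t) -
      Q.map (iterateFrobenius R p l)) (by
        rw [eval₂_sub, hP, eval₂_map, ← h1, sub_self])
    rw [Polynomial.map_sub, map_sub, eval_sub, map_map, ← h1, sub_eq_zero] at h2
    exact h2
  have hsurj : ∀ n, Function.Surjective (iterateFrobenius k p n) := fun n =>
    Finite.injective_iff_surjective.1 (RingHom.injective _)
  refine ⟨⟨fun n => ⟨⟨fun f => (hasseDeriv n ((P n f).map (iterateFrobenius R p n))).eval t, ?_⟩, ?_⟩,
    ?_, ?_⟩, ?_⟩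
  · intro f g
    have := key n n (P n f + P n g) le_rfl
    rwa [eval₂_add, hP, hP, Polynomial.map_add, map_add, eval_add] at this
  · intro c f
    obtain ⟨c, rfl⟩ := hsurj n c
    have := key n n (C (algebraMap k R c) * P n f) le_rfl
    have h3 : iterateFrobenius R p n (algebraMap k R c) =
        algebraMap k R (iterateFrobenius k p n c) := (RingHom.map_iterateFrobenius _ _ _ _).symm
    rw [eval₂_mul, eval₂_C, hP, Polynomial.map_mul, map_C, h3, ← Algebra.smul_def, ← smul_eq_C_mul,
      map_smul, eval_smul, smul_eq_mul, ← Algebra.smul_def] at this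
    exact this
  · ext f
    have := hP 0 f
    simpa [eval₂_eq_eval_map] using this
  · intro n f g
    have := key n n (P n f * P n g) le_rfl
    rw [eval₂_mul, hP, hP] at this
    simp only [LinearMap.coe_mk, AddHom.coe_mk]
    rw [this, Polynomial.map_mul, hasseDeriv_mul, eval_finsetSum]
    refine Finset.sum_congr rfl fun ij hij => ?_
    have hij := Finset.HasAntidiagonal.mem_antidiagonal.1 hij
    have h1 := key n ij.1 (P n f) (by omega)
    have h2 := key n ij.2 (P n g) (by omega)
    rw [hP] at h1 h2
    rw [eval_mul, h1, h2]
  · intro n f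
    obtain ⟨g, rfl⟩ := map_surjective _ (hsurj n) f
    have := key n n (g.map (algebraMap k R)) le_rfl
    have h3 : (iterateFrobenius R p n).comp (algebraMap k R) =
        (algebraMap k R).comp (iterateFrobenius k p n) :=
      RingHom.ext fun c => (RingHom.map_iterateFrobenius _ _ _ _).symm
    rw [eval₂_map, map_map, h3, ← eval₂_map, ← map_map] at this
    rw [aeval_def, aeval_def, LinearMap.coe_mk, AddHom.coe_mk, this, ← eval_map]
    congr 1
    ext i
    simp [hasseDeriv_coeff]

end Existence

end Hyperderivation

section Field

open Polynomial

variable {F : Type*} [Field F] (p : ℕ) [hp : Fact p.Prime] [CharP F p]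

theorem fieldRange_purelyInseparable (m : ℕ) :
    IsPurelyInseparable (iterateFrobenius F p m).fieldRange F := by
  rw [isPurelyInseparable_iff_pow_mem _ p]
  exact fun x => ⟨m, ⟨_, x, rfl⟩, by simp [iterateFrobenius_def]; rfl⟩

variable {p}

/-- The minimal polynomial of `t` over the `p^m`-th powers is `X^(p^e) - c` with `e ≥ m`,
unless `t` is a `p`-th power. -/
theorem exists_minpoly_eq {t : F} (ht : ∀ y, y ^ p ≠ t) (m : ℕ) :
    ∃ e, m ≤ e ∧ ∃ c, minpoly (iterateFrobenius F p m).fieldRange t = X ^ p ^ e - C c := by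
  have := fieldRange_purelyInseparable (F := F) p m
  refine ⟨_, ?_, _, IsPurelyInseparable.minpoly_eq' _ p t⟩
  by_contra! hlt
  have hdef := IsPurelyInseparable.elemExponent_def' (iterateFrobenius F p m).fieldRange p t
  generalize IsPurelyInseparable.elemExponent (iterateFrobenius F p m).fieldRange t = e at hlt hdef
  obtain ⟨⟨_, z, rfl⟩, hz⟩ := hdef
  change iterateFrobenius F p m z = t ^ p ^ e at hz
  rw [iterateFrobenius_def] at hz
  obtain ⟨l, rfl⟩ := Nat.exists_eq_add_of_lt hlt
  rw [show e + l + 1 = (l + 1) + e by ring, pow_add p (l + 1), pow_mul] at hz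
  have h1 := iterateFrobenius_inj F p e (by simpa [iterateFrobenius_def] using hz)
  exact ht (z ^ p ^ l) (by rw [← h1, pow_succ, pow_mul])

/-- A relation of `t` over the `p^n`-th powers is a multiple of `X^(p^e) - c` with `n < p^e`, and the
divided derivatives of `X^(p^e) - c` of positive order less than `p^e` are zero. -/
theorem hasseDeriv_eval_eq_zero {t : F} (ht : ∀ y, y ^ p ≠ t) (n : ℕ) (P : F[X])
    (hP : P.eval₂ (iterateFrobenius F p n) t = 0) :
    (hasseDeriv n (P.map (iterateFrobenius F p n))).eval t = 0 := by
  obtain ⟨e, he, c, hc⟩ := exists_minpoly_eq ht n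
  have hne : n < p ^ e := lt_of_le_of_lt he (Nat.lt_pow_self hp.out.one_lt)
  let M := (iterateFrobenius F p n).fieldRange
  have h1 : aeval t (P.map (iterateFrobenius F p n).rangeRestrictField) = 0 := by
    rw [aeval_def, eval₂_map]; exact hP
  obtain ⟨Q, hQ⟩ := minpoly.dvd _ t h1
  have h2 : P.map (iterateFrobenius F p n) =
      (X ^ p ^ e - C (algebraMap M F c)) * Q.map (algebraMap M F) := by
    have := congrArg (Polynomial.map (algebraMap M F)) hQ
    rw [hc, map_map, Polynomial.map_mul] at this
    rw [show P.map (iterateFrobenius F p n) = P.map ((algebraMap M F).comp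
      (iterateFrobenius F p n).rangeRestrictField) from rfl, this]
    simp
  have h3 : (X ^ p ^ e - C (algebraMap M F c)).eval t = 0 := by
    have := minpoly.aeval M t
    rw [hc] at this
    simpa [sub_eq_zero] using this
  rw [h2, hasseDeriv_mul, eval_finsetSum]
  refine Finset.sum_eq_zero fun ij hij => ?_
  have hij := Finset.HasAntidiagonal.mem_antidiagonal.1 hij
  rw [eval_mul]
  refine mul_eq_zero_of_left ?_ _
  rcases Nat.eq_zero_or_pos ij.1 with h | h
  · rw [h, hasseDeriv_zero']; exact h3
  · rw [map_sub, hasseDeriv_C _ _ h, sub_zero, ← monomial_one_right_eq_X_pow, hasseDeriv_monomial,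
      (CharP.cast_eq_zero_iff F p _).2
        (hp.out.dvd_choose_pow h.ne' (by omega))]
    simp

end Field

/-! ### `p`-bases of function fields -/

section FieldSpan

open Polynomial
open scoped IntermediateField

variable {F : Type*} [Field F] {p : ℕ} [hp : Fact p.Prime] [CharP F p]

/-- If `F` is generated over its subfield of `p`-th powers by one element, then it is so by every
element which is not a `p`-th power. -/
theorem FrobeniusSpans.of_adjoin_eq_top {y : F}
    (hy : IntermediateField.adjoin (iterateFrobenius F p 1).fieldRange {y} = ⊤) {s : F}
    (hs : ∀ z, z ^ p ≠ s) : FrobeniusSpans p s := by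
  let M := (iterateFrobenius F p 1).fieldRange
  have hpow : ∀ x : F, ∃ c : M, algebraMap M F c = x ^ p := fun x =>
    ⟨⟨_, x, rfl⟩, (iterateFrobenius_def p 1 x).trans (by rw [pow_one])⟩
  have hint : ∀ x : F, IsIntegral M x := fun x => by
    obtain ⟨c, hc⟩ := hpow x
    exact ⟨X ^ p - C c, monic_X_pow_sub_C c hp.out.ne_zero, by simp [hc]⟩
  -- `F` and `M(s)` both have degree `p` over the field `M` of `p`-th powers
  have h1 : Module.finrank M F ≤ p := by
    have h2 : Module.finrank M (IntermediateField.adjoin M {y}) = _ :=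
      IntermediateField.adjoin.finrank (hint y)
    rw [hy, IntermediateField.finrank_top'] at h2
    rw [h2]
    obtain ⟨c, hc⟩ := hpow y
    refine (natDegree_le_of_dvd (minpoly.dvd M y (p := X ^ p - C c) (by simp [hc]))
      (monic_X_pow_sub_C c hp.out.ne_zero).ne_zero).trans ?_
    rw [natDegree_X_pow_sub_C]
  have hfd : FiniteDimensional M F := by
    have := IntermediateField.adjoin.finiteDimensional (hint y)
    rw [hy] at this
    exact Module.Finite.equiv (IntermediateField.topEquiv (F := M) (E := F)).toLinearEquiv
  have h3 : p ≤ Module.finrank M (IntermediateField.adjoin M {s}) := by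
    rw [IntermediateField.adjoin.finrank (hint s)]
    obtain ⟨e, he, c, hc⟩ := exists_minpoly_eq hs 1
    rw [hc, natDegree_X_pow_sub_C]
    exact Nat.le_self_pow (by omega) p
  have htop : IntermediateField.adjoin M {s} = ⊤ :=
    IntermediateField.eq_of_le_of_finrank_le le_top (by
      rw [IntermediateField.finrank_top']; exact h1.trans h3)
  intro f
  have hf : f ∈ Algebra.adjoin M {s} := by
    rw [← IntermediateField.adjoin_simple_toSubalgebra_of_isAlgebraic (hint s).isAlgebraic, htop]
    trivial
  obtain ⟨P, rfl⟩ := Algebra.adjoin_mem_exists_aeval M s hf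
  obtain ⟨c, hc⟩ := hpow s
  have hmon := monic_X_pow_sub_C c hp.out.ne_zero
  have hev : aeval s P = aeval s (P %ₘ (X ^ p - C c)) := by
    conv_lhs => rw [← modByMonic_add_div P (X ^ p - C c)]
    simp [hc]
  have hdeg : (P %ₘ (X ^ p - C c)).natDegree < p := by
    have := natDegree_modByMonic_lt P hmon (fun h => by
      have := congrArg natDegree h
      rw [natDegree_X_pow_sub_C, natDegree_one] at this
      exact hp.out.ne_zero this)
    rwa [natDegree_X_pow_sub_C] at this
  have hroot : ∀ c : M, ∃ a : F, a ^ p = algebraMap M F c := fun ⟨_, a, ha⟩ =>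
    ⟨a, by have := iterateFrobenius_def (R := F) p 1 a; rw [pow_one] at this; exact this ▸ ha⟩
  choose a ha using hroot
  refine ⟨fun i => a ((P %ₘ (X ^ p - C c)).coeff i), ?_⟩
  rw [hev, aeval_eq_sum_range' hdeg]
  exact Finset.sum_congr rfl fun i _ => by rw [ha, Algebra.smul_def]

end FieldSpan

section DVR

variable {R K : Type*} [CommRing R] [IsDomain R] [Field K] [Algebra R K] [IsFractionRing R K]
  {p : ℕ} {s : R}

/-- If `s` is a prime element, then `∑_{i < p} sⁱ aᵢᵖ` is divisible by `s^p` only if all `aᵢ` are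
divisible by `s`: the summands have different orders of vanishing modulo `p`. -/
theorem Prime.dvd_of_pow_dvd_sum (hs : Prime s) (a : ℕ → R)
    (h : s ^ p ∣ ∑ i ∈ Finset.range p, a i ^ p * s ^ i) : ∀ i < p, s ∣ a i := by
  intro i
  induction i using Nat.strong_induction_on with
  | _ i ih =>
    intro hi
    have h1 : s ^ (i + 1) ∣ a i ^ p * s ^ i := by
      have h2 : s ^ (i + 1) ∣ ∑ j ∈ Finset.range p, a j ^ p * s ^ j :=
        (pow_dvd_pow s (by omega)).trans h
      rw [← Finset.add_sum_erase _ _ (Finset.mem_range.2 hi)] at h2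
      refine (dvd_add_left (Finset.dvd_sum fun j hj => ?_)).1 h2
      rw [Finset.mem_erase, Finset.mem_range] at hj
      rcases lt_or_gt_of_ne hj.1 with hlt | hgt
      · have := pow_dvd_pow_of_dvd (ih j hlt hj.2) p
        exact ((pow_dvd_pow s (by omega)).trans this).mul_right _
      · exact (pow_dvd_pow s (by omega)).mul_left _
    rw [pow_succ', mul_dvd_mul_iff_right (pow_ne_zero _ hs.ne_zero)] at h1
    exact hs.dvd_of_dvd_pow h1

/-- If the local parameter `s` spans the fraction field over its `p`-th powers, then it spans the ring:
common denominators `s^N` of the coefficients can be removed one factor `s` at a time. -/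
theorem FrobeniusSpans.of_isFractionRing (hs : Prime s)
    (hK : FrobeniusSpans p (algebraMap R K s))
    (hden : ∀ x : K, ∃ (N : ℕ) (r : R), x * algebraMap R K s ^ N = algebraMap R K r) :
    FrobeniusSpans p s := by
  have hinj := IsFractionRing.injective R K
  have hs0 : algebraMap R K s ≠ 0 := by
    rw [Ne, map_eq_zero_iff _ hinj]; exact hs.ne_zero
  intro f
  obtain ⟨g, hg⟩ := hK (algebraMap R K f)
  have hden' : ∃ N : ℕ, ∀ i < p, ∃ r : R, g i * algebraMap R K s ^ N = algebraMap R K r := by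
    choose N r hr using fun i => hden (g i)
    refine ⟨∑ i ∈ Finset.range p, N i, fun i hi => ?_⟩
    have := Finset.single_le_sum (f := N) (fun i _ => Nat.zero_le _) (Finset.mem_range.2 hi)
    obtain ⟨l, hl⟩ := Nat.exists_eq_add_of_le this
    exact ⟨r i * s ^ l, by rw [hl, pow_add, ← mul_assoc, hr, map_mul, map_pow]⟩
  obtain ⟨N, hN⟩ := hden'
  induction N with
  | zero =>
    choose! r hr using hN
    refine ⟨r, hinj ?_⟩
    rw [hg, map_sum]
    refine Finset.sum_congr rfl fun i hi => ?_
    rw [map_mul, map_pow, map_pow, ← hr i (Finset.mem_range.1 hi), pow_zero, mul_one]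
  | succ N ih =>
    refine ih fun i hi => ?_
    choose! r hr using hN
    have hsum : f * s ^ ((N + 1) * p) = ∑ i ∈ Finset.range p, r i ^ p * s ^ i := by
      apply hinj
      rw [map_mul, hg, map_sum, Finset.sum_mul]
      refine Finset.sum_congr rfl fun i hi => ?_
      rw [map_mul, map_pow, map_pow, map_pow, ← hr i (Finset.mem_range.1 hi)]
      ring
    obtain ⟨q, hq⟩ := hs.dvd_of_pow_dvd_sum r
      (hsum ▸ (pow_dvd_pow s (Nat.le_mul_of_pos_left p N.succ_pos)).mul_left f) i hi
    refine ⟨q, mul_right_cancel₀ hs0 ?_⟩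
    rw [mul_assoc, ← pow_succ, hr i hi, hq, map_mul, mul_comm]

end DVR

section FunctionField

section

variable {k K : Type*} [Field k] [Field K] [Algebra k K]

theorem IsCurveFunctionField.essFiniteType (hK : IsCurveFunctionField k K) :
    Algebra.EssFiniteType k K := by
  obtain ⟨x, hx, hfin⟩ := hK.exists_finite
  have := IntermediateField.essFiniteType_iff.2
    (IntermediateField.fg_adjoin_of_finite (F := k) (Set.finite_singleton x))
  exact Algebra.EssFiniteType.comp k (IntermediateField.adjoin k {x}) K

theorem IsCurveFunctionField.isTranscendenceBasis (hK : IsCurveFunctionField k K) {x : K}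
    (hx : Transcendental k x) : IsTranscendenceBasis k (fun _ : Unit => x) := by
  have h1 : ∀ {x : K}, Transcendental k x → AlgebraicIndependent k (fun _ : Unit => x) :=
    fun hx => algebraicIndependent_unique_type_iff.2 hx
  obtain ⟨y, hy, hfin⟩ := hK.exists_finite
  have hyb : IsTranscendenceBasis k (fun _ : Unit => y) := by
    rw [isTranscendenceBasis_iff_algebraicIndependent_isAlgebraic]
    refine ⟨h1 hy, ?_⟩
    have : Algebra.IsAlgebraic (IntermediateField.adjoin k {y}) K := inferInstance
    rw [Set.range_const]
    exact IntermediateField.isAlgebraic_adjoin_iff_top.1 this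
  have h2 := hyb.lift_cardinalMk_eq_trdeg
  refine AlgebraicIndependent.isTranscendenceBasis_of_lift_trdeg_le (h1 hx) ?_ ?_
  · rw [← Cardinal.lift_lt_aleph0, ← h2]; simp
  · rw [← h2]

end

variable {k K : Type*} [Field k] [Finite k] [Field K] [Algebra k K] {p : ℕ} [hp : Fact p.Prime]
  [CharP K p]

/-- A separating element `y` generates the function field over its `p`-th powers: `K` is separable
over `k(y)`, hence generated over it by `p`-th powers, and `k(y) ⊆ K^p(y)`. -/
theorem IsCurveFunctionField.exists_adjoin_eq_top (hK : IsCurveFunctionField k K) :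
    ∃ y : K, IntermediateField.adjoin (iterateFrobenius K p 1).fieldRange {y} = ⊤ := by
  obtain ⟨x, hx, -⟩ := hK.exists_finite
  have := hK.essFiniteType
  obtain ⟨S, hS, hsep⟩ := exists_isTranscendenceBasis_and_isSeparable_of_perfectField k K
  have hxb := hK.isTranscendenceBasis hx
  have hcard : S.card = 1 := by
    have := hS.lift_cardinalMk_eq hxb
    simpa using this
  obtain ⟨y, rfl⟩ := Finset.card_eq_one.1 hcard
  refine ⟨y, ?_⟩
  set N := IntermediateField.adjoin (iterateFrobenius K p 1).fieldRange {y}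
  have hpow : ∀ x : K, x ^ p ∈ N := fun x => by
    have h := iterateFrobenius_def (R := K) p 1 x
    rw [pow_one] at h
    exact h ▸ N.algebraMap_mem ⟨_, x, rfl⟩
  have : CharP k p := (Algebra.charP_iff k K p).2 inferInstance
  have hk : ∀ c : k, algebraMap k K c ∈ N := fun c => by
    obtain ⟨b, rfl⟩ := (Finite.injective_iff_surjective.1 (frobenius k p).injective) c
    rw [RingHom.map_frobenius]
    exact hpow _
  have hky : ∀ z ∈ IntermediateField.adjoin k (({y} : Finset K) : Set K), z ∈ N := fun z hz => by
    induction hz using IntermediateField.adjoin_induction with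
    | mem x hx =>
      rw [Finset.coe_singleton, Set.mem_singleton_iff] at hx
      subst hx
      exact IntermediateField.mem_adjoin_simple_self _ _
    | algebraMap c => exact hk c
    | add _ _ _ _ h1 h2 => exact add_mem h1 h2
    | inv _ _ h => exact inv_mem h
    | mul _ _ _ _ h1 h2 => exact mul_mem h1 h2
  rw [eq_top_iff]
  intro z _
  have hz : z ∈ IntermediateField.adjoin (IntermediateField.adjoin k (({y} : Finset K) : Set K))
      ((· ^ p) '' (Set.univ : Set K)) := by
    have : CharP (IntermediateField.adjoin k (({y} : Finset K) : Set K)) p :=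
      (Algebra.charP_iff _ K p).2 inferInstance
    rw [← IntermediateField.adjoin_eq_adjoin_pow_expChar_of_isSeparable' _ _ Set.univ p,
      IntermediateField.adjoin_univ]
    trivial
  induction hz using IntermediateField.adjoin_induction with
  | mem x hx =>
    obtain ⟨x, -, rfl⟩ := hx
    exact hpow x
  | algebraMap c => exact hky c c.2
  | add _ _ _ _ h1 h2 => exact add_mem (h1 trivial) (h2 trivial)
  | inv _ _ h => exact inv_mem (h trivial)
  | mul _ _ _ _ h1 h2 => exact mul_mem (h1 trivial) (h2 trivial)

end FunctionField

/-! ### The ring of functions regular outside a place -/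

section Separable

open Polynomial

variable {k K : Type*} [Field k] [Field K] [Algebra k K]

variable (F₀ : Type*) [Algebra k[X] K] [Field F₀] [Algebra k[X] F₀] [Algebra F₀ K]
  [IsScalarTower k[X] F₀ K]

/-- The function field is algebraic over every rational subfield `k(x)`. -/
theorem IsCurveFunctionField.isAlgebraic [IsScalarTower k k[X] K] [IsFractionRing k[X] F₀]
    (hK : IsCurveFunctionField k K) :
    Algebra.IsAlgebraic F₀ K := by
  have hinj : Function.Injective (algebraMap k[X] K) := by
    rw [IsScalarTower.algebraMap_eq k[X] F₀ K]
    exact (algebraMap F₀ K).injective.comp (IsFractionRing.injective _ _)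
  have hae : ∀ f : k[X], aeval (algebraMap k[X] K X) f = algebraMap k[X] K f := fun f => by
    rw [aeval_algebraMap_apply, aeval_X_left_apply]
  have hx : Transcendental k (algebraMap k[X] K X) := by
    rw [transcendental_iff_injective]
    intro f g h
    rw [hae, hae] at h
    exact hinj h
  have hb := (hK.isTranscendenceBasis hx).isAlgebraic
  rw [Set.range_const] at hb
  have : ∀ a ∈ Algebra.adjoin k {algebraMap k[X] K X}, ∃ b : F₀, algebraMap F₀ K b = a := by
    intro a ha
    obtain ⟨f, rfl⟩ := Algebra.adjoin_mem_exists_aeval k _ ha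
    exact ⟨algebraMap _ _ f, by rw [hae, IsScalarTower.algebraMap_apply k[X] F₀ K]⟩
  choose g hg using this
  refine ⟨fun z => ?_⟩
  obtain ⟨f, hf0, hf⟩ := hb.isAlgebraic z
  let G : Algebra.adjoin k {algebraMap k[X] K X} →+* F₀ :=
    { toFun := fun a => g a a.2
      map_one' := (algebraMap F₀ K).injective (by rw [hg]; simp)
      map_zero' := (algebraMap F₀ K).injective (by rw [hg]; simp)
      map_add' := fun a b => (algebraMap F₀ K).injective (by rw [map_add, hg, hg, hg]; rfl)
      map_mul' := fun a b => (algebraMap F₀ K).injective (by rw [map_mul, hg, hg, hg]; rfl) }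
  have hG : (algebraMap F₀ K).comp G = algebraMap (Algebra.adjoin k {algebraMap k[X] K X}) K :=
    RingHom.ext fun a => hg a a.2
  refine ⟨f.map G, ?_, ?_⟩
  · intro h
    have h2 := congrArg (Polynomial.map (algebraMap F₀ K)) h
    rw [map_map, hG, Polynomial.map_zero] at h2
    exact hf0 (Polynomial.map_injective _ Subtype.val_injective
      (h2.trans (Polynomial.map_zero _).symm))
  · rw [aeval_def, eval₂_map, hG]; exact hf

theorem IsCurveFunctionField.finiteDimensional [IsScalarTower k k[X] K] [IsFractionRing k[X] F₀]
    [Algebra k F₀] [IsScalarTower k F₀ K]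
    (hK : IsCurveFunctionField k K) : FiniteDimensional F₀ K := by
  have := hK.isAlgebraic F₀
  have := hK.essFiniteType
  have := Algebra.EssFiniteType.of_comp k F₀ K
  exact Algebra.finite_of_essFiniteType_of_isAlgebraic

/-- The function field is separable over `k(x)` as soon as it is generated by `x` over its `p`-th
powers: all `p^e`-th powers with `e` large lie in the separable closure of `k(x)`. -/
theorem FrobeniusGenerates.isSeparable {k K F₀ : Type*} [Field k] [Field K] [Algebra k[X] K]
    [Field F₀] [Algebra k[X] F₀] [Algebra F₀ K] [IsScalarTower k[X] F₀ K] {p : ℕ}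
    [hp : Fact p.Prime] [CharP K p] [FiniteDimensional F₀ K]
    (hx : FrobeniusGenerates p (algebraMap k[X] K X)) : Algebra.IsSeparable F₀ K := by
  rw [← separableClosure.eq_top_iff, eq_top_iff]
  have : CharP F₀ p := (Algebra.charP_iff F₀ K p).2 inferInstance
  have : CharP (separableClosure F₀ K) p := (Algebra.charP_iff _ K p).2 inferInstance
  intro f _
  have hpi : IsPurelyInseparable (separableClosure F₀ K) K := inferInstance
  obtain ⟨P, rfl⟩ := hx.iterate (IsPurelyInseparable.exponent (separableClosure F₀ K) K) f
  rw [eval₂_eq_sum]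
  refine sum_mem fun i _ => mul_mem ?_ (pow_mem ?_ i)
  · obtain ⟨c, hc⟩ := IsPurelyInseparable.exponent_def' (separableClosure F₀ K) p (P.coeff i)
    rw [iterateFrobenius_def, ← hc]
    exact c.2
  · rw [IsScalarTower.algebraMap_apply k[X] F₀ K]
    exact IntermediateField.algebraMap_mem _ _

end Separable

theorem isIntegral_range_iff {R S : Type*} [CommRing R] [CommRing S] [Algebra R S] (x : S) :
    IsIntegral (algebraMap R S).range x ↔ IsIntegral R x := by
  let : Algebra R (algebraMap R S).range := (algebraMap R S).rangeRestrict.toAlgebra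
  have : Algebra.IsIntegral R (algebraMap R S).range :=
    Algebra.isIntegral_of_surjective (algebraMap R S).rangeRestrict_surjective
  have : IsScalarTower R (algebraMap R S).range S := IsScalarTower.of_algebraMap_eq fun c => rfl
  exact ⟨fun h => isIntegral_trans x h, fun h => h.tower_top⟩

section RegularOutside

open Polynomial

variable {k K : Type*} [Field k] [Field K] [Algebra k K]

/-- A non-constant function without poles outside `P` has a pole at `P`: a function that lies in all
valuation rings over `k` is algebraic over `k`. -/
theorem IsCurveFunctionField.notMem_of_mem_regularOutside (hK : IsCurveFunctionField k K)
    {P : ValuationSubring K} {x : K} (hx : x ∈ regularOutside k P)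
    (hxk : x ∉ (algebraMap k K).range) : x ∉ P := by
  intro hxP
  refine hxk (hK.exact_constants x ?_)
  have h1 : x ∈ (⨅ V : {V : ValuationSubring K // ((algebraMap k K).range : Set K) ⊆ V.toSubring},
      V.1.toSubring) := by
    rw [Subring.mem_iInf]
    rintro ⟨V, hV⟩
    by_cases h : V = P
    · subst h; exact hxP
    · exact hx V h fun c => hV ⟨c, rfl⟩
  rw [iInf_valuationSubring_superset, Subring.closure_eq] at h1
  exact ((isIntegral_range_iff x).1 h1).isAlgebraic

/-- If `x` is regular outside `P` and not constant, then the valuation rings which contain `k[x]`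
are those different from `P`. So the functions regular outside `P` form the integral closure of
`k[x]`. -/
theorem IsCurveFunctionField.mem_regularOutside_iff [Algebra k[X] K] [IsScalarTower k k[X] K]
    (hK : IsCurveFunctionField k K) {P : ValuationSubring K}
    (hx : algebraMap k[X] K X ∈ regularOutside k P)
    (hxk : algebraMap k[X] K X ∉ (algebraMap k K).range) (f : K) :
    f ∈ regularOutside k P ↔ IsIntegral k[X] f := by
  have hxP := hK.notMem_of_mem_regularOutside hx hxk
  have h1 : IsIntegral (algebraMap k[X] K).range f ↔ f ∈ (⨅ V : {V : ValuationSubring K //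
      ((algebraMap k[X] K).range : Set K) ⊆ V.toSubring}, V.1.toSubring) := by
    rw [iInf_valuationSubring_superset, Subring.closure_eq]; rfl
  have hmem : ∀ V : ValuationSubring K, ((algebraMap k[X] K).range : Set K) ⊆ V.toSubring ↔
      (∀ c : k, algebraMap k K c ∈ V) ∧ algebraMap k[X] K X ∈ V := by
    intro V
    refine ⟨fun h => ⟨fun c => h ⟨C c, ?_⟩, h ⟨X, rfl⟩⟩, ?_⟩
    · rw [IsScalarTower.algebraMap_apply k k[X] K]; rfl
    · rintro ⟨h1, h2⟩ _ ⟨g, rfl⟩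
      rw [← aeval_X_left_apply g, ← aeval_algebraMap_apply, aeval_eq_sum_range]
      refine sum_mem fun i _ => ?_
      rw [Algebra.smul_def]
      exact mul_mem (h1 _) (pow_mem h2 i)
  rw [← isIntegral_range_iff, h1, Subring.mem_iInf]
  constructor
  · rintro hf ⟨V, hV⟩
    have := (hmem V).1 hV
    exact hf V (fun h => hxP (h ▸ this.2)) this.1
  · intro hf O hO hk
    exact hf ⟨O, (hmem O).2 ⟨hk, hx O hO hk⟩⟩

end RegularOutside

section Structure

open Polynomial

variable {k K : Type*} [Field k] [Finite k] [Field K] [Algebra k K] {p : ℕ} [hp : Fact p.Prime]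
  [CharP K p]

/-- The ring of functions regular outside `P` is a Dedekind domain which is finite over `k[x]`,
if it contains an element `x` without `p`-th root. -/
theorem IsCurveFunctionField.regularOutside_structure (hK : IsCurveFunctionField k K)
    (P : ValuationSubring K) (x : regularOutside k P)
    (hxp : ∀ y : regularOutside k P, y ^ p ≠ x) :
    IsDedekindDomain (regularOutside k P) ∧ IsFractionRing (regularOutside k P) K ∧
    (aeval x : k[X] →ₐ[k] regularOutside k P).toRingHom.Finite ∧
    Function.Injective (aeval x : k[X] →ₐ[k] regularOutside k P) ∧
    (x : K) ∉ P ∧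
    ∀ s : K, (∀ z, z ^ p ≠ s) → FrobeniusSpans p s := by
  obtain ⟨y, hy⟩ := hK.exists_adjoin_eq_top (p := p)
  have hspan : ∀ s : K, (∀ z, z ^ p ≠ s) → FrobeniusSpans p s := fun s hs =>
    FrobeniusSpans.of_adjoin_eq_top hy hs
  have : CharP k p := (Algebra.charP_iff k K p).2 inferInstance
  -- all constants are `p`-th powers, since `k` is finite
  have hxk : (x : K) ∉ (algebraMap k K).range := by
    rintro ⟨c, hc⟩
    obtain ⟨b, rfl⟩ := (Finite.injective_iff_surjective.1 (frobenius k p).injective) c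
    refine hxp (algebraMap k _ b) (Subtype.ext ?_)
    rw [← hc]
    simp [frobenius_def]
  have htr : Transcendental k (x : K) := fun h => hxk (hK.exact_constants _ h)
  let : Algebra k[X] (regularOutside k P) := (aeval x).toRingHom.toAlgebra
  let : Algebra k[X] K := ((algebraMap (regularOutside k P) K).comp
    (algebraMap k[X] (regularOutside k P))).toAlgebra
  have : IsScalarTower k[X] (regularOutside k P) K := IsScalarTower.of_algebraMap_eq fun _ => rfl
  have hX : algebraMap k[X] K X = x := by
    rw [IsScalarTower.algebraMap_apply k[X] (regularOutside k P) K]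
    exact congrArg Subtype.val (aeval_X x)
  have : IsScalarTower k k[X] K := IsScalarTower.of_algebraMap_eq fun c => by
    rw [IsScalarTower.algebraMap_apply k[X] (regularOutside k P) K]
    exact (congrArg Subtype.val (aeval_C x c)).symm
  have hinj : Function.Injective (algebraMap k[X] K) := by
    have h := transcendental_iff_injective.1 htr
    intro f g hfg
    apply h
    rw [← hX, aeval_algebraMap_apply, aeval_algebraMap_apply, aeval_X_left_apply,
      aeval_X_left_apply]
    exact hfg
  have : FaithfulSMul k[X] K := (faithfulSMul_iff_algebraMap_injective _ _).2 hinj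
  let : Algebra (FractionRing k[X]) K := FractionRing.liftAlgebra k[X] K
  have hmem : ∀ f : K, f ∈ regularOutside k P ↔ IsIntegral k[X] f :=
    hK.mem_regularOutside_iff (by rw [hX]; exact x.2) (by rw [hX]; exact hxk)
  -- a `p`-th root in `K` is integral over `k[x]`, hence regular outside `P`
  have hxp' : ∀ z : K, z ^ p ≠ x := by
    intro z hz
    refine hxp ⟨z, (hmem z).2 ?_⟩ (Subtype.ext hz)
    exact IsIntegral.of_pow hp.out.pos (by rw [hz]; exact (hmem _).1 x.2)
  have : IsIntegralClosure (regularOutside k P) k[X] K :=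
    ⟨Subtype.val_injective, fun {f} => ⟨fun h => ⟨⟨f, (hmem f).2 h⟩, rfl⟩, by
      rintro ⟨g, rfl⟩; exact (hmem _).1 g.2⟩⟩
  have : IsScalarTower k (FractionRing k[X]) K := IsScalarTower.of_algebraMap_eq fun c => by
    rw [IsScalarTower.algebraMap_apply k k[X] (FractionRing k[X]),
      IsScalarTower.algebraMap_apply k k[X] K,
      IsScalarTower.algebraMap_apply k[X] (FractionRing k[X]) K]
  have hfd : FiniteDimensional (FractionRing k[X]) K := hK.finiteDimensional _
  have hsep : Algebra.IsSeparable (FractionRing k[X]) K :=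
    FrobeniusGenerates.isSeparable (p := p) (hX ▸ (hspan _ hxp').generates)
  refine ⟨IsIntegralClosure.isDedekindDomain k[X] (FractionRing k[X]) K _,
    IsIntegralClosure.isFractionRing_of_finite_extension k[X] (FractionRing k[X]) K _,
    IsIntegralClosure.finite k[X] (FractionRing k[X]) K _, ?_,
    hK.notMem_of_mem_regularOutside x.2 hxk, hspan⟩
  exact Function.Injective.of_comp (f := algebraMap (regularOutside k P) K) hinj

end Structure

/-! ### Hyperderivations of adic completions -/

section AdicExtension

variable {k A : Type*} [CommRing k] [CommRing A] [Algebra k A] {I : Ideal A}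

theorem AdicCompletion.evalₐ_algebraMap (m : ℕ) (x : A) :
    AdicCompletion.evalₐ I m (algebraMap A (AdicCompletion I A) x) = Ideal.Quotient.mk (I ^ m) x :=
  (AdicCompletion.evalₐ I m).commutes x

theorem AdicCompletion.evalₐ_of_mem {m : ℕ} {x : AdicCompletion I A}
    (hx : x ∈ (I.map (algebraMap A (AdicCompletion I A))) ^ m) :
    AdicCompletion.evalₐ I m x = 0 := by
  have h3 := Ideal.mem_map_of_mem (AdicCompletion.evalₐ I m).toRingHom hx
  rw [Ideal.map_pow, Ideal.map_map] at h3
  have h4 : (AdicCompletion.evalₐ I m).toRingHom.comp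
      (algebraMap A (AdicCompletion I A)) = Ideal.Quotient.mk (I ^ m) := by
    ext a
    exact (AdicCompletion.evalₐ I m).commutes a
  rw [h4, ← Ideal.map_pow, Ideal.map_quotient_self] at h3
  exact h3

theorem AdicCompletion.mem_of_evalₐ_eq_zero (hI : I.FG) {m : ℕ} {x : AdicCompletion I A}
    (hx : AdicCompletion.evalₐ I m x = 0) :
    x ∈ (I.map (algebraMap A (AdicCompletion I A))) ^ m := by
  have h1 : x ∈ (AdicCompletion.eval I A m).ker := by
    rw [LinearMap.mem_ker, ← AdicCompletion.factor_evalₐ_eq_eval I x (by simp), hx, _root_.map_zero]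
  rw [← AdicCompletion.pow_smul_top_eq_ker_eval hI] at h1
  refine Submodule.smul_induction_on h1 (fun a ha z _ => ?_) fun _ _ => add_mem
  rw [Algebra.smul_def, ← Ideal.map_pow]
  exact Ideal.mul_mem_right _ _ (Ideal.mem_map_of_mem _ ha)

theorem AdicCompletion.factor_evalₐ {m n : ℕ} (h : m ≤ n) (x : AdicCompletion I A) :
    Ideal.Quotient.factor (Ideal.pow_le_pow_right h) (AdicCompletion.evalₐ I n x) =
      AdicCompletion.evalₐ I m x := by
  obtain ⟨a, rfl⟩ := AdicCompletion.mk_surjective I A x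
  rw [AdicCompletion.evalₐ_mk, AdicCompletion.evalₐ_mk, Ideal.Quotient.factor_mk,
    Ideal.Quotient.eq]
  have := a.2 h
  rw [SModEq.sub_mem, smul_eq_mul, Ideal.mul_top] at this
  rw [← neg_sub]
  exact neg_mem this

theorem AdicCompletion.evalₐ_eq_mk_of_le {m n : ℕ} (h : m ≤ n) {x : AdicCompletion I A} {a : A}
    (hx : AdicCompletion.evalₐ I n x = Ideal.Quotient.mk (I ^ n) a) :
    AdicCompletion.evalₐ I m x = Ideal.Quotient.mk (I ^ m) a := by
  rw [← AdicCompletion.factor_evalₐ h, hx, Ideal.Quotient.factor_mk]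

/-- Compatible elements of the quotients `A/Iᵐ` define an element of the completion. -/
theorem AdicCompletion.exists_evalₐ_eq (x : ∀ m, A ⧸ I ^ m)
    (hx : ∀ m, Ideal.Quotient.factor (Ideal.pow_le_pow_right m.le_succ) (x (m + 1)) = x m) :
    ∃ z : AdicCompletion I A, ∀ m, AdicCompletion.evalₐ I m z = x m := by
  choose a ha using fun m => Ideal.Quotient.mk_surjective (x m)
  refine ⟨AdicCompletion.mk I A (AdicCompletion.AdicCauchySequence.mk I A a fun m => ?_), fun m => ?_⟩
  · rw [SModEq.sub_mem, smul_eq_mul, Ideal.mul_top, ← Ideal.Quotient.eq, ha, ← hx m, ← ha (m + 1),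
      Ideal.Quotient.factor_mk]
  · rw [AdicCompletion.evalₐ_mk]; exact ha m

/-- A family of maps `A → Â` that satisfies the axioms of a hyperderivation and is continuous
extends to a hyperderivation of `Â`. -/
theorem Hyperderivation.exists_extension (Θ : ℕ → A →ₗ[k] AdicCompletion I A)
    (hcont : ∀ n m x, x ∈ I ^ (m + n) → AdicCompletion.evalₐ I m (Θ n x) = 0)
    (h0 : ∀ x, Θ 0 x = algebraMap A _ x)
    (hleib : ∀ n x y, Θ n (x * y) =
      ∑ ij ∈ Finset.HasAntidiagonal.antidiagonal n, Θ ij.1 x * Θ ij.2 y) :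
    ∃ D : Hyperderivation k (AdicCompletion I A), ∀ n x, D.op n (algebraMap A _ x) = Θ n x := by
  have hcong : ∀ n m x y, Ideal.Quotient.mk (I ^ (m + n)) x = Ideal.Quotient.mk (I ^ (m + n)) y →
      AdicCompletion.evalₐ I m (Θ n x) = AdicCompletion.evalₐ I m (Θ n y) := by
    intro n m x y h
    rw [← sub_eq_zero, ← map_sub, ← map_sub]
    exact hcont n m _ (Ideal.Quotient.eq.1 h)
  have hlift : ∀ (z : AdicCompletion I A) m, ∃ a : A,
      AdicCompletion.evalₐ I m z = Ideal.Quotient.mk (I ^ m) a := fun z m =>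
    ⟨_, (Ideal.Quotient.mk_surjective _).choose_spec.symm⟩
  have hex : ∀ n (z : AdicCompletion I A), ∃ w : AdicCompletion I A, ∀ m a,
      AdicCompletion.evalₐ I (m + n) z = Ideal.Quotient.mk (I ^ (m + n)) a →
      AdicCompletion.evalₐ I m w = AdicCompletion.evalₐ I m (Θ n a) := by
    intro n z
    choose a ha using fun m => hlift z (m + n)
    obtain ⟨w, hw⟩ := AdicCompletion.exists_evalₐ_eq
      (fun m => AdicCompletion.evalₐ I m (Θ n (a m))) (fun m => by
        rw [AdicCompletion.factor_evalₐ m.le_succ]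
        refine hcong n m _ _ ?_
        rw [← ha m]
        exact (AdicCompletion.evalₐ_eq_mk_of_le (Nat.add_le_add_right m.le_succ n) (ha (m + 1))).symm)
    refine ⟨w, fun m b hb => ?_⟩
    rw [hw]
    exact hcong n m _ _ ((ha m).symm.trans hb)
  choose op hop using hex
  have hmk : ∀ m (c : k) (a : A), c • Ideal.Quotient.mk (I ^ m) a = Ideal.Quotient.mk (I ^ m) (c • a) :=
    fun _ _ _ => rfl
  refine ⟨⟨fun n => ⟨⟨op n, ?_⟩, ?_⟩, ?_, ?_⟩, ?_⟩
  · intro x y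
    refine AdicCompletion.ext_evalₐ fun m => ?_
    obtain ⟨a, ha⟩ := hlift x (m + n)
    obtain ⟨b, hb⟩ := hlift y (m + n)
    rw [map_add, hop n x m a ha, hop n y m b hb, hop n (x + y) m (a + b) (by
      rw [map_add, ha, hb, map_add]), map_add, map_add]
  · intro c x
    refine AdicCompletion.ext_evalₐ fun m => ?_
    obtain ⟨a, ha⟩ := hlift x (m + n)
    have hs : ∀ m (z : AdicCompletion I A), AdicCompletion.evalₐ I m (c • z) =
        c • AdicCompletion.evalₐ I m z := fun m z =>
      map_smul ((AdicCompletion.evalₐ I m).restrictScalars k) c z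
    change AdicCompletion.evalₐ I m (op n (c • x)) = AdicCompletion.evalₐ I m (c • op n x)
    rw [hs, hop n x m a ha, hop n (c • x) m (c • a) (by rw [hs, ha, hmk]), map_smul, hs]
  · refine LinearMap.ext fun x => AdicCompletion.ext_evalₐ fun m => ?_
    obtain ⟨a, ha⟩ := hlift x m
    change AdicCompletion.evalₐ I m (op 0 x) = _
    rw [hop 0 x m a ha, h0, AdicCompletion.evalₐ_algebraMap, ← ha]
    rfl
  · intro n x y
    refine AdicCompletion.ext_evalₐ fun m => ?_
    obtain ⟨a, ha⟩ := hlift x (m + n)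
    obtain ⟨b, hb⟩ := hlift y (m + n)
    change AdicCompletion.evalₐ I m (op n (x * y)) = _
    rw [hop n (x * y) m (a * b) (by rw [map_mul, ha, hb, map_mul]), hleib, map_sum, map_sum]
    refine Finset.sum_congr rfl fun ij hij => ?_
    have hij := Finset.HasAntidiagonal.mem_antidiagonal.1 hij
    change _ = AdicCompletion.evalₐ I m (op ij.1 x * op ij.2 y)
    rw [map_mul, map_mul,
      hop ij.1 x m a (AdicCompletion.evalₐ_eq_mk_of_le (by omega) ha),
      hop ij.2 y m b (AdicCompletion.evalₐ_eq_mk_of_le (by omega) hb)]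
  · intro n x
    refine AdicCompletion.ext_evalₐ fun m => ?_
    exact hop n _ m x (AdicCompletion.evalₐ_algebraMap _ _)

/-- A hyperderivation of the completion is determined by its values on `A`, by continuity. -/
theorem Hyperderivation.ext_algebraMap (hI : I.FG) {D D' : Hyperderivation k (AdicCompletion I A)}
    (h : ∀ n x, D.op n (algebraMap A _ x) = D'.op n (algebraMap A _ x)) : D = D' := by
  have hz : ∀ (D : Hyperderivation k (AdicCompletion I A)) n m z,
      AdicCompletion.evalₐ I (m + n) z = 0 → AdicCompletion.evalₐ I m (D.op n z) = 0 := by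
    intro D n m z hz
    have := D.op_mem_pow _ _ n z (AdicCompletion.mem_of_evalₐ_eq_zero hI hz)
    rw [Nat.add_sub_cancel] at this
    exact AdicCompletion.evalₐ_of_mem this
  refine Hyperderivation.ext' fun n z => AdicCompletion.ext_evalₐ fun m => ?_
  obtain ⟨a, ha⟩ := Ideal.Quotient.mk_surjective (AdicCompletion.evalₐ I (m + n) z)
  have h1 : AdicCompletion.evalₐ I (m + n) (z - algebraMap A _ a) = 0 := by
    rw [map_sub, AdicCompletion.evalₐ_algebraMap, ha, sub_self]
  have h2 := hz D n m _ h1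
  have h3 := hz D' n m _ h1
  rw [map_sub, map_sub, sub_eq_zero] at h2 h3
  rw [h2, h3, h]

end AdicExtension

/-! ### Local rings of Dedekind domains and their hyperderivations -/

section DedekindLocal

variable {A : Type*} [CommRing A] {𝔭 : Ideal A} {s : A}

theorem ne_bot_of_notMem_sq (hs : s ∈ 𝔭) (hs' : s ∉ 𝔭 ^ 2) : 𝔭 ≠ ⊥ := by
  rintro rfl
  exact hs' (by rw [Submodule.mem_bot] at hs; rw [hs]; exact zero_mem _)

theorem isUnit_mk_pow_of_notMem [𝔭.IsMaximal] {c : A} (hc : c ∉ 𝔭) (n : ℕ) :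
    IsUnit (Ideal.Quotient.mk (𝔭 ^ n) c) := by
  obtain ⟨d, hd⟩ := Ideal.Quotient.exists_inv (I := 𝔭) (a := Ideal.Quotient.mk 𝔭 c) (by
    rwa [Ne, Ideal.Quotient.eq_zero_iff_mem])
  obtain ⟨d, rfl⟩ := Ideal.Quotient.mk_surjective d
  rw [← map_mul, ← map_one (Ideal.Quotient.mk 𝔭), Ideal.Quotient.eq] at hd
  have h1 : IsNilpotent (Ideal.Quotient.mk (𝔭 ^ n) (c * d - 1)) :=
    ⟨n, by rw [← map_pow, Ideal.Quotient.eq_zero_iff_mem]; exact Ideal.pow_mem_pow hd n⟩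
  have h2 := h1.isUnit_add_one
  rw [← map_one (Ideal.Quotient.mk (𝔭 ^ n)), ← map_add, sub_add_cancel, map_mul] at h2
  exact isUnit_of_mul_isUnit_left h2

theorem isUnit_algebraMap_adicCompletion [𝔭.IsMaximal] {c : A} (hc : c ∉ 𝔭) :
    IsUnit (algebraMap A (AdicCompletion 𝔭 A) c) := by
  choose d hd using fun n => (isUnit_mk_pow_of_notMem hc n).exists_right_inv
  obtain ⟨z, hz⟩ := AdicCompletion.exists_evalₐ_eq d fun n => by
    have h1 := hd (n + 1)
    apply_fun Ideal.Quotient.factor (Ideal.pow_le_pow_right (I := 𝔭) n.le_succ) at h1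
    rw [map_mul, map_one, Ideal.Quotient.factor_mk] at h1
    exact (isUnit_mk_pow_of_notMem hc n).mul_left_cancel (h1.trans (hd n).symm)
  refine IsUnit.of_mul_eq_one z (AdicCompletion.ext_evalₐ fun n => ?_)
  rw [map_mul, hz, AdicCompletion.evalₐ_algebraMap, hd, map_one]

variable [IsDedekindDomain A]

/-- An element of `𝔭` outside `𝔭²` generates `𝔭` locally at `𝔭`. -/
theorem exists_notMem_forall_dvd_mul (hs : s ∈ 𝔭) (hs' : s ∉ 𝔭 ^ 2) :
    ∃ c ∉ 𝔭, ∀ x ∈ 𝔭, s ∣ c * x := by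
  obtain ⟨J, hJ⟩ := Ideal.dvd_span_singleton.2 hs
  have hJ' : ¬ J ≤ 𝔭 := by
    intro h
    refine hs' ?_
    have : s ∈ 𝔭 * J := hJ ▸ Ideal.mem_span_singleton_self s
    rw [sq]
    exact Ideal.mul_mono_right h this
  obtain ⟨c, hcJ, hc⟩ := Set.not_subset.1 hJ'
  refine ⟨c, hc, fun x hx => ?_⟩
  rw [← Ideal.mem_span_singleton, hJ, mul_comm c x]
  exact Ideal.mul_mem_mul hx hcJ

variable [h𝔭 : 𝔭.IsPrime]

theorem exists_notMem_forall_pow_dvd_mul (hs : s ∈ 𝔭) (hs' : s ∉ 𝔭 ^ 2) (n : ℕ) :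
    ∃ c ∉ 𝔭, ∀ x ∈ 𝔭 ^ n, s ^ n ∣ c * x := by
  obtain ⟨c, hc, h⟩ := exists_notMem_forall_dvd_mul hs hs'
  refine ⟨c ^ n, fun h => hc (h𝔭.mem_of_pow_mem _ h), ?_⟩
  induction n with
  | zero => simp
  | succ n ih =>
    intro x hx
    rw [pow_succ] at hx
    refine Submodule.mul_induction_on hx (fun a ha b hb => ?_) fun a b h1 h2 => ?_
    · rw [pow_succ, pow_succ, mul_mul_mul_comm]
      exact mul_dvd_mul (ih a ha) (h b hb)
    · rw [mul_add]; exact dvd_add h1 h2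

theorem irreducible_algebraMap_localization (hs : s ∈ 𝔭) (hs' : s ∉ 𝔭 ^ 2) :
    Irreducible (algebraMap A (Localization.AtPrime 𝔭) s) := by
  have := IsLocalization.AtPrime.isDiscreteValuationRing_of_dedekind_domain A
    (ne_bot_of_notMem_sq hs hs') (Localization.AtPrime 𝔭)
  rw [IsDiscreteValuationRing.irreducible_iff_uniformizer, ← Localization.AtPrime.map_eq_maximalIdeal]
  refine le_antisymm ?_ ?_
  · rw [Ideal.map_le_iff_le_comap]
    intro x hx
    obtain ⟨c, hc, h⟩ := exists_notMem_forall_dvd_mul hs hs'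
    obtain ⟨y, hy⟩ := h x hx
    have hu : IsUnit (algebraMap A (Localization.AtPrime 𝔭) c) :=
      IsLocalization.map_units _ (⟨c, hc⟩ : 𝔭.primeCompl)
    rw [Ideal.mem_comap, Ideal.mem_span_singleton, ← hu.dvd_mul_left, ← map_mul, hy, map_mul]
    exact dvd_mul_right _ _
  · rw [Ideal.span_le, Set.singleton_subset_iff]
    exact Ideal.mem_map_of_mem _ hs

variable {K : Type*} [Field K] [Algebra A K] [IsFractionRing A K] {p : ℕ} [hp : Fact p.Prime]

/-- An irreducible element of an integrally closed domain is not a `p`-th power in the fraction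
field. -/
theorem Irreducible.pow_ne_algebraMap {R K : Type*} [CommRing R] [IsDomain R]
    [IsIntegrallyClosed R] [Field K] [Algebra R K] [IsFractionRing R K] {s : R}
    (hs : Irreducible s) {n : ℕ} (hn : 1 < n) (z : K) : z ^ n ≠ algebraMap R K s := by
  intro h
  obtain ⟨r, rfl⟩ := IsIntegrallyClosed.exists_algebraMap_eq_of_isIntegral_pow (R := R)
    (x := z) (n := n) (by omega) (by rw [h]; exact isIntegral_algebraMap)
  rw [← map_pow] at h
  have h1 := IsFractionRing.injective R K h
  obtain ⟨m, rfl⟩ := Nat.exists_eq_add_of_lt hn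
  rw [← h1] at hs
  refine hs.not_isUnit ?_
  have := hs.isUnit_or_isUnit (a := r) (b := r ^ (1 + m)) (by rw [← pow_succ'])
  rcases this with h | h
  · exact h.pow _
  · exact ((isUnit_pow_iff (by omega)).1 h).pow _

/-- The uniformizers `s` of the local ring at `𝔭` satisfy `R = ∑_{i < p} R^p sⁱ`, if this holds for
all elements of the function field that are not `p`-th powers. -/
theorem FrobeniusSpans.localization [CharP K p]
    (hspan : ∀ x : K, (∀ z, z ^ p ≠ x) → FrobeniusSpans p x)
    (hs : s ∈ 𝔭) (hs' : s ∉ 𝔭 ^ 2) :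
    FrobeniusSpans p (algebraMap A (Localization.AtPrime 𝔭) s) := by
  have := IsLocalization.AtPrime.isDiscreteValuationRing_of_dedekind_domain A
    (ne_bot_of_notMem_sq hs hs') (Localization.AtPrime 𝔭)
  have hirr := irreducible_algebraMap_localization hs hs'
  have hle : 𝔭.primeCompl ≤ nonZeroDivisors A := 𝔭.primeCompl_le_nonZeroDivisors
  let : Algebra (Localization.AtPrime 𝔭) K :=
    (IsLocalization.lift (M := 𝔭.primeCompl) (g := algebraMap A K)
      fun y => IsLocalization.map_units K (⟨y, hle y.2⟩ : nonZeroDivisors A)).toAlgebra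
  have : IsScalarTower A (Localization.AtPrime 𝔭) K :=
    IsScalarTower.of_algebraMap_eq fun x => (IsLocalization.lift_eq _ x).symm
  have : IsFractionRing (Localization.AtPrime 𝔭) K :=
    IsFractionRing.isFractionRing_of_isDomain_of_isLocalization 𝔭.primeCompl _ _
  refine FrobeniusSpans.of_isFractionRing (K := K) hirr.prime
    (hspan _ (hirr.pow_ne_algebraMap hp.out.one_lt)) fun x => ?_
  obtain ⟨a, b, hb, rfl⟩ := IsFractionRing.div_surjective (A := Localization.AtPrime 𝔭) x
  have hb0 := nonZeroDivisors.ne_zero hb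
  obtain ⟨n, u, hu⟩ := IsDiscreteValuationRing.eq_unit_mul_pow_irreducible hb0 hirr
  refine ⟨n, a * ↑u⁻¹, ?_⟩
  have hb1 : algebraMap (Localization.AtPrime 𝔭) K b ≠ 0 := by
    rw [Ne, map_eq_zero_iff _ (IsFractionRing.injective _ K)]; exact hb0
  rw [div_mul_eq_mul_div, div_eq_iff hb1, hu, ← map_pow, ← map_mul, ← map_mul]
  congr 1
  rw [mul_assoc, ← mul_assoc _ (u : Localization.AtPrime 𝔭), Units.inv_mul, one_mul]

/-- An element which is not a `p`-th power in the fraction field satisfies only such relations over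
the `p^n`-th powers that are compatible with divided derivatives. -/
theorem hasseDeriv_eval_eq_zero_of_isFractionRing {R F : Type*} [CommRing R] [IsDomain R] [Field F]
    [Algebra R F] [IsFractionRing R F] [CharP R p] {t : R} (ht : ∀ y : F, y ^ p ≠ algebraMap R F t)
    (n : ℕ) (P : Polynomial R) (hP : P.eval₂ (iterateFrobenius R p n) t = 0) :
    (Polynomial.hasseDeriv n (P.map (iterateFrobenius R p n))).eval t = 0 := by
  have hinj := IsFractionRing.injective R F
  have : CharP F p := charP_of_injective_algebraMap hinj p
  have hcomp : (algebraMap R F).comp (iterateFrobenius R p n) =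
      (iterateFrobenius F p n).comp (algebraMap R F) :=
    RingHom.ext fun x => RingHom.map_iterateFrobenius (algebraMap R F) p x n
  have h1 := hasseDeriv_eval_eq_zero ht n (P.map (algebraMap R F)) (by
    rw [Polynomial.eval₂_map, ← hcomp, ← Polynomial.hom_eval₂, hP, map_zero])
  apply hinj
  rw [map_zero, ← h1, Polynomial.map_map, ← hcomp, ← Polynomial.map_map, ← Polynomial.eval₂_hom,
    Polynomial.eval₂_eq_eval_map]
  congr 1
  ext i
  simp [Polynomial.hasseDeriv_coeff]

theorem Irreducible.hasseDeriv_eval_eq_zero {R : Type*} [CommRing R] [IsDomain R]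
    [IsIntegrallyClosed R] [CharP R p] {s : R} (hs : Irreducible s) (c : R) (n : ℕ)
    (P : Polynomial R) (hP : P.eval₂ (iterateFrobenius R p n) (s + c ^ p) = 0) :
    (Polynomial.hasseDeriv n (P.map (iterateFrobenius R p n))).eval (s + c ^ p) = 0 := by
  have : CharP (FractionRing R) p := charP_of_injective_algebraMap (IsFractionRing.injective R _) p
  refine hasseDeriv_eval_eq_zero_of_isFractionRing (F := FractionRing R) (fun y hy => ?_) n P hP
  refine hs.pow_ne_algebraMap (K := FractionRing R) hp.out.one_lt (y - algebraMap R _ c) ?_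
  rw [sub_pow_char, hy, ← map_pow, ← map_sub, add_sub_cancel_right]

theorem isMaximal_of_notMem_sq (hs : s ∈ 𝔭) (hs' : s ∉ 𝔭 ^ 2) : 𝔭.IsMaximal :=
  h𝔭.isMaximal (ne_bot_of_notMem_sq hs hs')

end DedekindLocal

section Finiteness

open Polynomial

variable {k A : Type*} [Field k] [CommRing A] [Algebra k A] {x : A}

theorem finite_quotient_of_pow_mem (hx : (aeval x : k[X] →ₐ[k] A).toRingHom.Finite) {I : Ideal A}
    {n : ℕ} (hn : x ^ n ∈ I) : Module.Finite k (A ⧸ I) := by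
  let f : k[X] →ₐ[k] A ⧸ I := (Ideal.Quotient.mkₐ k I).comp (aeval x)
  have hf : f.toRingHom.Finite :=
    (RingHom.Finite.of_surjective _ Ideal.Quotient.mk_surjective).comp hx
  have h0 : ∀ a ∈ Ideal.span {(X ^ n : k[X])}, f a = 0 := by
    intro a ha
    obtain ⟨b, rfl⟩ := Ideal.mem_span_singleton.1 ha
    have h1 : f X ^ n = 0 := by
      rw [← map_pow]
      change Ideal.Quotient.mk I (aeval x (X ^ n : k[X])) = 0
      rw [map_pow, aeval_X]
      exact Ideal.Quotient.eq_zero_iff_mem.2 hn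
    rw [map_mul, map_pow, h1, zero_mul]
  let g := Ideal.Quotient.liftₐ (Ideal.span {(X ^ n : k[X])}) f h0
  have hg : g.toRingHom.Finite := RingHom.Finite.of_comp_finite (f := Ideal.Quotient.mk _) hf
  have h1 := (monic_X_pow (R := k) n).finite_quotient
  have h2 : (algebraMap k (k[X] ⧸ Ideal.span {(X ^ n : k[X])})).Finite := RingHom.finite_algebraMap.2 h1
  have h3 := hg.comp h2
  have h4 : g.toRingHom.comp (algebraMap k (k[X] ⧸ Ideal.span {(X ^ n : k[X])})) =
      algebraMap k (A ⧸ I) := RingHom.ext fun c => g.commutes c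
  rw [h4] at h3
  exact RingHom.finite_algebraMap.1 h3

theorem exists_pow_sub_mem [Finite k] {p : ℕ} [hp : Fact p.Prime] [CharP A p] {I : Ideal A}
    [I.IsMaximal] [Module.Finite k (A ⧸ I)] (t : A) : ∃ c : A, t - c ^ p ∈ I := by
  let : Field (A ⧸ I) := Ideal.Quotient.field I
  have : Finite (A ⧸ I) := Module.finite_of_finite k
  have hchar : CharP (A ⧸ I) p := by
    have : Nontrivial A := (Ideal.Quotient.mk_surjective (I := I)).nontrivial
    exact (Algebra.charP_iff k (A ⧸ I) p).1
      (((algebraMap k A).charP_iff (algebraMap k A).injective p).2 inferInstance)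
  obtain ⟨c, hc⟩ := (Finite.injective_iff_surjective.1 (frobenius (A ⧸ I) p).injective)
    (Ideal.Quotient.mk I t)
  obtain ⟨c, rfl⟩ := Ideal.Quotient.mk_surjective c
  refine ⟨c, ?_⟩
  rw [← Ideal.Quotient.eq, ← hc, map_pow, frobenius_def]

end Finiteness

section LocalHyperderivations

theorem charP_localization {A : Type*} (K : Type*) [CommRing A] [IsDomain A] [Field K] [Algebra A K]
    [IsFractionRing A K] (p : ℕ) [CharP K p] (𝔭 : Ideal A) [𝔭.IsPrime] :
    CharP (Localization.AtPrime 𝔭) p :=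
  have : CharP A p := (algebraMap A K).charP (IsFractionRing.injective A K) p
  charP_of_injective_algebraMap (IsLocalization.injective (Localization.AtPrime 𝔭)
    𝔭.primeCompl_le_nonZeroDivisors) p

theorem exists_localization_to_adicCompletion {A : Type*} [CommRing A] (𝔭 : Ideal A) [𝔭.IsMaximal] :
    Nonempty (Localization.AtPrime 𝔭 →ₐ[A] AdicCompletion 𝔭 A) :=
  ⟨IsLocalization.liftAlgHom (M := 𝔭.primeCompl) (f := Algebra.ofId A (AdicCompletion 𝔭 A))
    fun y => isUnit_algebraMap_adicCompletion y.2⟩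

/-- Hyperderivations of the local ring at `𝔭` extend to its completion. -/
theorem exists_hyperderivation_adicCompletion {k A R : Type*} [Field k] [CommRing A]
    [Algebra k A] {𝔭 : Ideal A} {t : A} [CommRing R] [Algebra k R]
    [Algebra A R] [IsScalarTower k A R] (j : R →ₐ[A] AdicCompletion 𝔭 A)
    {D : Hyperderivation k R} (hD : D.IsWithRespectTo (algebraMap A _ t)) :
    ∃ D' : Hyperderivation k (AdicCompletion 𝔭 A), D'.IsWithRespectTo (algebraMap A _ t) := by
  have hj : ∀ x, j (algebraMap A R x) = algebraMap A _ x := j.commutes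
  have hae : ∀ f : Polynomial k, Polynomial.aeval (algebraMap A (AdicCompletion 𝔭 A) t) f =
      algebraMap A _ (Polynomial.aeval t f) := fun f => Polynomial.aeval_algebraMap_apply _ _ _
  have hae' : ∀ f : Polynomial k, Polynomial.aeval (algebraMap A R t) f =
      algebraMap A _ (Polynomial.aeval t f) := fun f => Polynomial.aeval_algebraMap_apply _ _ _
  suffices ∃ D' : Hyperderivation k (AdicCompletion 𝔭 A), ∀ n x, D'.op n (algebraMap A _ x) =
      ((j.restrictScalars k).toLinearMap ∘ₗ D.op n ∘ₗ
        (IsScalarTower.toAlgHom k A R).toLinearMap) x by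
    obtain ⟨D', hD'⟩ := this
    refine ⟨D', fun n f => ?_⟩
    rw [hae, hD', hae]
    change j (D.op n (algebraMap A R (Polynomial.aeval t f))) = _
    rw [← hae', hD, hae', hj]
  refine Hyperderivation.exists_extension (fun n => (j.restrictScalars k).toLinearMap ∘ₗ D.op n ∘ₗ
    (IsScalarTower.toAlgHom k A R).toLinearMap) (fun n m x hx => ?_) (fun x => ?_) (fun n x y => ?_)
  · have h1 : algebraMap A R x ∈ (𝔭.map (algebraMap A R)) ^ (m + n) := by
      rw [← Ideal.map_pow]; exact Ideal.mem_map_of_mem _ hx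
    have h2 := D.op_mem_pow _ _ n _ h1
    rw [Nat.add_sub_cancel] at h2
    have h3 := Ideal.mem_map_of_mem j.toRingHom h2
    have h4 : j.toRingHom.comp (algebraMap A R) = algebraMap A (AdicCompletion 𝔭 A) :=
      RingHom.ext hj
    rw [Ideal.map_pow, Ideal.map_map, h4] at h3
    exact AdicCompletion.evalₐ_of_mem h3
  · change j (D.op 0 (algebraMap A R x)) = _
    rw [D.op_zero]; exact hj x
  · change j (D.op n (algebraMap A R (x * y))) = _
    rw [map_mul, D.leibniz, map_sum]
    exact Finset.sum_congr rfl fun ij _ => map_mul _ _ _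

/-- A hyperderivation with respect to `t` on `Â` commutes with one on `R`, as both are given by the
same formula on polynomials in `t` over `p^n`-th powers. -/
theorem Hyperderivation.IsWithRespectTo.map_op {k R S : Type*} [CommRing k] [CommRing R]
    [Algebra k R] [CommRing S] [Algebra k S] {p : ℕ} [hp : Fact p.Prime] [CharP R p] [CharP S p] {t : R}
    (ht : FrobeniusGenerates p t) {D : Hyperderivation k R} (hD : D.IsWithRespectTo t)
    (j : R →+* S) {D' : Hyperderivation k S} (hD' : D'.IsWithRespectTo (j t)) (n : ℕ) (x : R) :
    j (D.op n x) = D'.op n (j x) := by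
  have hn : n < p ^ n := Nat.lt_pow_self hp.out.one_lt
  obtain ⟨P, rfl⟩ := ht.iterate n x
  have hcomp : j.comp (iterateFrobenius R p n) = (iterateFrobenius S p n).comp j :=
    RingHom.ext fun x => RingHom.map_iterateFrobenius j p x n
  rw [op_eval₂_iterateFrobenius hD hn, Polynomial.hom_eval₂, hcomp, ← Polynomial.eval₂_map,
    op_eval₂_iterateFrobenius hD' hn, Polynomial.map_map, ← hcomp, ← Polynomial.map_map,
    ← Polynomial.eval₂_hom, Polynomial.eval₂_eq_eval_map]
  congr 1
  ext i
  simp [Polynomial.hasseDeriv_coeff]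

variable {k A K : Type*} [Field k] [Finite k] [CommRing A] [IsDedekindDomain A] [Algebra k A]
  [Field K] [Algebra A K] [IsFractionRing A K] {p : ℕ} [hp : Fact p.Prime] [CharP K p]
  {𝔭 : Ideal A} [h𝔭 : 𝔭.IsPrime] {s : A}

theorem FrobeniusGenerates.localization
    (hspan : ∀ x : K, (∀ z, z ^ p ≠ x) → FrobeniusSpans p x)
    (hs : s ∈ 𝔭) (hs' : s ∉ 𝔭 ^ 2) (c : A) [CharP (Localization.AtPrime 𝔭) p] :
    FrobeniusGenerates p (algebraMap A (Localization.AtPrime 𝔭) (s + c ^ p)) := by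
  rw [map_add, map_pow]
  exact (FrobeniusSpans.localization hspan hs hs').generates.add_pow _

variable (k) in
/-- For `t` congruent to a `p`-th power modulo `𝔭` up to a uniformizer, there is a unique
hyperderivation with respect to `t` on the local ring at `𝔭`. -/
theorem existsUnique_hyperderivation_localization
    (hspan : ∀ x : K, (∀ z, z ^ p ≠ x) → FrobeniusSpans p x)
    (hs : s ∈ 𝔭) (hs' : s ∉ 𝔭 ^ 2) (c : A) :
    ∃! D : Hyperderivation k (Localization.AtPrime 𝔭),
      D.IsWithRespectTo (algebraMap A _ (s + c ^ p)) := by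
  have := charP_localization K p 𝔭
  have := IsLocalization.AtPrime.isDiscreteValuationRing_of_dedekind_domain A
    (ne_bot_of_notMem_sq hs hs') (Localization.AtPrime 𝔭)
  have hgen := FrobeniusGenerates.localization hspan hs hs' c
  obtain ⟨D, hD⟩ := Hyperderivation.exists_isWithRespectTo (k := k) hgen fun n P hP => by
    rw [map_add, map_pow] at hP ⊢
    exact (irreducible_algebraMap_localization hs hs').hasseDeriv_eval_eq_zero _ n P hP
  exact ⟨D, hD, fun D' hD' => Hyperderivation.IsWithRespectTo.unique hgen hD' hD⟩

variable (k) in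
/-- The hyperderivation with respect to `t` on the completion exists, is unique, and extends the one
on the local ring. -/
theorem existsUnique_hyperderivation_adicCompletion
    (hspan : ∀ x : K, (∀ z, z ^ p ≠ x) → FrobeniusSpans p x)
    (hs : s ∈ 𝔭) (hs' : s ∉ 𝔭 ^ 2) (c : A) :
    (∃! D : Hyperderivation k (AdicCompletion 𝔭 A), D.IsWithRespectTo (algebraMap A _ (s + c ^ p)))
    ∧ ∀ D' : Hyperderivation k (AdicCompletion 𝔭 A),
      D'.IsWithRespectTo (algebraMap A _ (s + c ^ p)) →
      ∀ D : Hyperderivation k (Localization.AtPrime 𝔭),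
      D.IsWithRespectTo (algebraMap A _ (s + c ^ p)) →
      ∃ j : Localization.AtPrime 𝔭 →ₐ[A] AdicCompletion 𝔭 A,
        ∀ n x, j (D.op n x) = D'.op n (j x) := by
  have := isMaximal_of_notMem_sq hs hs'
  have hR := charP_localization K p 𝔭
  have hgen := FrobeniusGenerates.localization hspan hs hs' c
  obtain ⟨j⟩ := exists_localization_to_adicCompletion 𝔭
  have : Nontrivial (AdicCompletion 𝔭 A) := by
    have h1 : Nontrivial (A ⧸ 𝔭 ^ 1) := Ideal.Quotient.nontrivial_iff.2 (by
      rw [pow_one]; exact h𝔭.ne_top)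
    exact (AdicCompletion.surjective_evalₐ 𝔭 1).nontrivial
  have : CharP k p := by
    have : CharP A p := (algebraMap A K).charP (IsFractionRing.injective A K) p
    exact (algebraMap k A).charP (algebraMap k A).injective p
  have : CharP (AdicCompletion 𝔭 A) p :=
    charP_of_injective_algebraMap (algebraMap k (AdicCompletion 𝔭 A)).injective p
  have hcomm : ∀ D' : Hyperderivation k (AdicCompletion 𝔭 A),
      D'.IsWithRespectTo (algebraMap A _ (s + c ^ p)) →
      ∀ D : Hyperderivation k (Localization.AtPrime 𝔭),
      D.IsWithRespectTo (algebraMap A _ (s + c ^ p)) → ∀ n x, j (D.op n x) = D'.op n (j x) :=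
    fun D' hD' D hD n x => hD.map_op hgen j.toRingHom
      (D' := D') (by rw [show j.toRingHom (algebraMap A _ (s + c ^ p)) = _ from j.commutes _]; exact hD') n x
  refine ⟨?_, fun D' hD' D hD => ⟨j, hcomm D' hD' D hD⟩⟩
  obtain ⟨D, hD, -⟩ := existsUnique_hyperderivation_localization k hspan hs hs' c
  obtain ⟨D₁, hD₁⟩ := exists_hyperderivation_adicCompletion (𝔭 := 𝔭) j hD
  refine ⟨D₁, hD₁, fun D₂ hD₂ => ?_⟩
  refine Hyperderivation.ext_algebraMap (IsNoetherian.noetherian 𝔭) fun n x => ?_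
  rw [← j.commutes, ← hcomm D₁ hD₁ D hD, ← hcomm D₂ hD₂ D hD]

end LocalHyperderivations

/-! ### Hyperdifferential operators modulo `𝔭` -/

section ResidueOperators

namespace Hyperderivation

/-- On `Jⁿ` the operator `∂⁽ⁿ⁾` is `R`-linear modulo `J`, as `∂⁽ʲ⁾` maps `Jⁿ` into `J` for `j < n`. -/
theorem op_mul_sub_mem {k R : Type*} [CommRing k] [CommRing R] [Algebra k R]
    (D : Hyperderivation k R) {J : Ideal R} {n : ℕ} {x : R} (hx : x ∈ J ^ n) (a : R) :
    D.op n (a * x) - a * D.op n x ∈ J := by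
  rw [D.leibniz]
  have h0 : ((0, n) : ℕ × ℕ) ∈ Finset.HasAntidiagonal.antidiagonal n := by
    rw [Finset.HasAntidiagonal.mem_antidiagonal, zero_add]
  rw [← Finset.add_sum_erase _ _ h0, D.op_zero, LinearMap.id_apply, add_sub_cancel_left]
  refine Ideal.sum_mem _ fun ij hij => ?_
  obtain ⟨hne, hij⟩ := Finset.mem_erase.1 hij
  rw [Finset.HasAntidiagonal.mem_antidiagonal] at hij
  obtain ⟨i, j⟩ := ij
  dsimp only at hij ⊢
  have hi : i ≠ 0 := by rintro rfl; rw [zero_add] at hij; exact hne (by rw [hij])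
  exact J.mul_mem_left _ (Ideal.pow_le_self (by omega) (D.op_mem_pow J n j x hx))

/-- Modulo `J`, the only contribution to `∂⁽ⁿ⁾(xⁿ)` comes from differentiating each factor once. -/
theorem op_pow_sub_mem {k R : Type*} [CommRing k] [CommRing R] [Algebra k R]
    (D : Hyperderivation k R) {J : Ideal R} {x : R} (hx : x ∈ J) (n : ℕ) :
    D.op n (x ^ n) - D.op 1 x ^ n ∈ J := by
  induction n with
  | zero => rw [D.op_zero]; simp
  | succ n ih =>
    have h1 : ((n, 1) : ℕ × ℕ) ∈ Finset.HasAntidiagonal.antidiagonal (n + 1) := by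
      rw [Finset.HasAntidiagonal.mem_antidiagonal]
    rw [pow_succ, D.leibniz, ← Finset.add_sum_erase _ _ h1, pow_succ, add_sub_right_comm, ← sub_mul]
    refine add_mem (J.mul_mem_right _ ih) (Ideal.sum_mem _ fun ij hij => ?_)
    obtain ⟨hne, hij⟩ := Finset.mem_erase.1 hij
    rw [Finset.HasAntidiagonal.mem_antidiagonal] at hij
    obtain ⟨i, j⟩ := ij
    dsimp only at hij ⊢
    have hj : j ≠ 1 := by rintro rfl; exact hne (by rw [show i = n by omega])
    rcases Nat.eq_zero_or_pos j with rfl | hj0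
    · rw [D.op_zero]; exact J.mul_mem_left _ hx
    · exact J.mul_mem_right _ (Ideal.pow_le_self (by omega)
        (D.op_mem_pow J n i _ (Ideal.pow_mem_pow hx n)))

end Hyperderivation

variable {k A : Type*} [Field k] [CommRing A] [Algebra k A] {𝔭 : Ideal A}

variable (𝔭) in
/-- The reduction `Â → A/𝔭`. -/
noncomputable def adicResidue : AdicCompletion 𝔭 A →+* A ⧸ 𝔭 :=
  (Ideal.Quotient.factor (Ideal.pow_le_self one_ne_zero)).comp (AdicCompletion.evalₐ 𝔭 1).toRingHom

theorem adicResidue_algebraMap (x : A) :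
    adicResidue 𝔭 (algebraMap A _ x) = Ideal.Quotient.mk 𝔭 x := by
  change Ideal.Quotient.factor (Ideal.pow_le_self one_ne_zero)
    (AdicCompletion.evalₐ 𝔭 1 (algebraMap A _ x)) = _
  rw [AdicCompletion.evalₐ_algebraMap, Ideal.Quotient.factor_mk]

theorem adicResidue_eq_of_sub_mem {x y : AdicCompletion 𝔭 A}
    (h : x - y ∈ 𝔭.map (algebraMap A (AdicCompletion 𝔭 A))) : adicResidue 𝔭 x = adicResidue 𝔭 y := by
  rw [← sub_eq_zero, ← map_sub]
  change _ ∈ RingHom.ker (adicResidue 𝔭)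
  refine (Ideal.map_le_iff_le_comap.2 fun a ha => ?_) h
  rw [Ideal.mem_comap, RingHom.mem_ker, adicResidue_algebraMap]
  exact Ideal.Quotient.eq_zero_iff_mem.2 ha

namespace Hyperderivation

variable (D : Hyperderivation k (AdicCompletion 𝔭 A)) (n : ℕ)

/-- The map `A/𝔭ⁿ⁺¹ → A/𝔭` that is induced by `∂⁽ⁿ⁾`. -/
noncomputable def residueOp : (A ⧸ 𝔭 ^ (0 + n + 1)) →ₗ[k] (A ⧸ 𝔭) :=
  residueProj k 𝔭 0 ∘ₗ D.induced n 0

theorem residueOp_mk (x : A) : D.residueOp n (Ideal.Quotient.mk _ x) =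
    adicResidue 𝔭 (D.op n (algebraMap A _ x)) := rfl

theorem residueOp_mk_mul {x : A} (hx : x ∈ 𝔭 ^ n) (a : A) :
    D.residueOp n (Ideal.Quotient.mk _ (a * x)) =
      Ideal.Quotient.mk 𝔭 a * D.residueOp n (Ideal.Quotient.mk _ x) := by
  rw [residueOp_mk, residueOp_mk, map_mul (algebraMap A _), ← adicResidue_algebraMap,
    ← map_mul (adicResidue 𝔭)]
  refine adicResidue_eq_of_sub_mem (D.op_mul_sub_mem ?_ _)
  rw [← Ideal.map_pow]
  exact Ideal.mem_map_of_mem _ hx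

theorem residueOp_mk_mul_pow {x : A} (hx : x ∈ 𝔭) (a : A) :
    D.residueOp n (Ideal.Quotient.mk _ (a * x ^ n)) =
      Ideal.Quotient.mk 𝔭 a * adicResidue 𝔭 (D.op 1 (algebraMap A _ x)) ^ n := by
  rw [residueOp_mk_mul D n (Ideal.pow_mem_pow hx n), residueOp_mk, map_pow (algebraMap A _),
    ← map_pow (adicResidue 𝔭)]
  congr 1
  exact adicResidue_eq_of_sub_mem (D.op_pow_sub_mem (Ideal.mem_map_of_mem _ hx) n)

theorem IsWithRespectTo.op_one_self {k R : Type*} [CommRing k] [CommRing R] [Algebra k R]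
    {D : Hyperderivation k R} {t : R} (hD : D.IsWithRespectTo t) : D.op 1 t = 1 := by
  have := hD 1 Polynomial.X
  rw [Polynomial.aeval_X, Polynomial.hasseDeriv_one, Polynomial.derivative_X, map_one] at this
  exact this

end Hyperderivation

variable [𝔭.IsMaximal] {π t s c : A} {Dπ Dt : Hyperderivation k (AdicCompletion 𝔭 A)}

/-- On `𝔭ⁿ` the operators `∂_t⁽ⁿ⁾` and `∂_π⁽ⁿ⁾` have proportional reductions, as both are linear over
`A` modulo `𝔭` and `𝔭ⁿ` is locally generated by `πⁿ`. -/
theorem residueOp_eq_of_mem_pow [IsDedekindDomain A] (hπ : π ∈ 𝔭) (hπ' : π ∉ 𝔭 ^ 2)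
    (hDπ : Dπ.IsWithRespectTo (algebraMap A _ π)) (n : ℕ) {y : A} (hy : y ∈ 𝔭 ^ n) :
    Dt.residueOp n (Ideal.Quotient.mk _ y) =
      adicResidue 𝔭 (Dt.op 1 (algebraMap A _ π)) ^ n * Dπ.residueOp n (Ideal.Quotient.mk _ y) := by
  obtain ⟨c, hc, h⟩ := exists_notMem_forall_pow_dvd_mul hπ hπ' n
  obtain ⟨b, hb⟩ := h y hy
  rw [mul_comm] at hb
  have h1 := Dt.residueOp_mk_mul n hy c
  have h2 := Dπ.residueOp_mk_mul n hy c
  rw [mul_comm c, hb, mul_comm, Hyperderivation.residueOp_mk_mul_pow _ n hπ] at h1 h2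
  rw [hDπ.op_one_self, map_one, one_pow, mul_one] at h2
  have hc' : Ideal.Quotient.mk 𝔭 c ≠ 0 := by rwa [Ne, Ideal.Quotient.eq_zero_iff_mem]
  refine mul_left_cancel₀ hc' ?_
  rw [← h1, h2]
  ring

theorem Hyperderivation.op_one_add_pow {p : ℕ} [hp : Fact p.Prime] [CharP k p]
    (D : Hyperderivation k (AdicCompletion 𝔭 A)) :
    D.op 1 (algebraMap A _ (s + c ^ p)) = D.op 1 (algebraMap A _ s) := by
  have : Nontrivial (AdicCompletion 𝔭 A) := (adicResidue 𝔭).domain_nontrivial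
  have : CharP (AdicCompletion 𝔭 A) p :=
    charP_of_injective_algebraMap (algebraMap k (AdicCompletion 𝔭 A)).injective p
  have h1 := D.op_pow_expChar_pow (p := p) 1 one_pos (by rw [pow_one]; exact hp.out.one_lt)
    (algebraMap A _ c)
  rw [pow_one] at h1
  rw [map_add, map_pow, map_add, h1, add_zero]

/-- If `t` is a local parameter up to a `p`-th power, then `∂_π(t)` and `∂_t(π)` are inverse to each
other modulo `𝔭`. -/
theorem adicResidue_mul_eq_one [IsDedekindDomain A] {p : ℕ} [hp : Fact p.Prime] [CharP k p]
    (hπ : π ∈ 𝔭) (hπ' : π ∉ 𝔭 ^ 2)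
    (hDπ : Dπ.IsWithRespectTo (algebraMap A _ π)) (hs : s ∈ 𝔭)
    (hDt : Dt.IsWithRespectTo (algebraMap A _ (s + c ^ p))) :
    adicResidue 𝔭 (Dπ.op 1 (algebraMap A _ (s + c ^ p))) *
      adicResidue 𝔭 (Dt.op 1 (algebraMap A _ π)) = 1 := by
  have h1 := hDt.op_one_self
  obtain ⟨a, ha, h⟩ := exists_notMem_forall_dvd_mul hπ hπ'
  obtain ⟨b, hb⟩ := h s hs
  rw [mul_comm π] at hb
  have ha' : Ideal.Quotient.mk 𝔭 a ≠ 0 := by rwa [Ne, Ideal.Quotient.eq_zero_iff_mem]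
  have hs1 : s ∈ 𝔭 ^ 1 := by rwa [pow_one]
  have hπ1 : π ∈ 𝔭 ^ 1 := by rwa [pow_one]
  have key : ∀ D : Hyperderivation k (AdicCompletion 𝔭 A),
      Ideal.Quotient.mk 𝔭 a * adicResidue 𝔭 (D.op 1 (algebraMap A _ s)) =
      Ideal.Quotient.mk 𝔭 b * adicResidue 𝔭 (D.op 1 (algebraMap A _ π)) := fun D => by
    rw [← D.residueOp_mk, ← D.residueOp_mk, ← D.residueOp_mk_mul 1 hs1, hb,
      D.residueOp_mk_mul 1 hπ1]
  have k1 := key Dt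
  have k2 := key Dπ
  rw [← Dt.op_one_add_pow (c := c) (p := p), h1, map_one, mul_one] at k1
  rw [hDπ.op_one_self, map_one, mul_one] at k2
  rw [Dπ.op_one_add_pow]
  refine mul_left_cancel₀ ha' ?_
  rw [← mul_assoc, k2, ← k1, mul_one]

end ResidueOperators

section DualGenerator

variable {k A : Type*} [Field k] [Finite k] [CommRing A] [IsDedekindDomain A] [Algebra k A]
  {𝔭 : Ideal A} [𝔭.IsMaximal] [Module.Finite k (A ⧸ 𝔭)] {π : A}
  (D : Hyperderivation k (AdicCompletion 𝔭 A))

/-- The linear form `tr ∘ ∂⁽ⁿ⁾ mod 𝔭` on `A/𝔭ⁿ⁺¹` does not vanish on any non-zero ideal: if it vanishes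
on the ideal of `a ∈ 𝔭ᵐ`, where `a` is locally `b πᵐ`, then multiplication of `a` by `π^(n-m)` shows
that the trace form of `A/𝔭` vanishes on `b mod 𝔭`. -/
theorem mem_pow_of_trace_residueOp_eq_zero (hπ : π ∈ 𝔭) (hπ' : π ∉ 𝔭 ^ 2)
    (hD : adicResidue 𝔭 (D.op 1 (algebraMap A _ π)) ≠ 0) {n : ℕ} {a : A}
    (ha : ∀ x, Algebra.trace k (A ⧸ 𝔭) (D.residueOp n (Ideal.Quotient.mk _ (x * a))) = 0) :
    ∀ m ≤ n + 1, a ∈ 𝔭 ^ m := by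
  intro m
  induction m with
  | zero => simp
  | succ m ih =>
    intro hm
    obtain ⟨c, hc, h⟩ := exists_notMem_forall_pow_dvd_mul hπ hπ' m
    obtain ⟨b, hb⟩ := h a (ih (by omega))
    have h1 : b ∈ 𝔭 := by
      let : Field (A ⧸ 𝔭) := Ideal.Quotient.field 𝔭
      have : Finite (A ⧸ 𝔭) := Module.finite_of_finite k
      rw [← Ideal.Quotient.eq_zero_iff_mem]
      have h2 : Ideal.Quotient.mk 𝔭 b * adicResidue 𝔭 (D.op 1 (algebraMap A _ π)) ^ n = 0 := by
        refine (traceForm_nondegenerate k (A ⧸ 𝔭)).1 _ fun y => ?_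
        obtain ⟨y, rfl⟩ := Ideal.Quotient.mk_surjective y
        have h3 := ha (y * π ^ (n - m) * c)
        rw [mul_assoc _ c, hb, mul_assoc, ← mul_assoc (π ^ (n - m)), ← pow_add,
          Nat.sub_add_cancel (by omega), mul_comm (π ^ n), ← mul_assoc,
          D.residueOp_mk_mul_pow n hπ] at h3
        rw [Algebra.traceForm_apply, mul_comm, ← mul_assoc, ← map_mul]
        exact h3
      exact (mul_eq_zero.1 h2).resolve_right (pow_ne_zero n hD)
    have h2 : c * a ∈ 𝔭 ^ (m + 1) := by
      rw [hb, pow_succ]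
      exact Ideal.mul_mem_mul (Ideal.pow_mem_pow hπ m) h1
    obtain ⟨e, he⟩ := (isUnit_mk_pow_of_notMem hc (m + 1)).exists_left_inv
    rw [← Ideal.Quotient.eq_zero_iff_mem, map_mul] at h2
    rw [← Ideal.Quotient.eq_zero_iff_mem, ← one_mul (Ideal.Quotient.mk _ a), ← he, mul_assoc, h2,
      mul_zero]

/-- The linear form `tr ∘ ∂⁽ⁿ⁾ mod 𝔭` generates the dual of `A/𝔭ⁿ⁺¹`. -/
theorem exists_dual_eq_trace_residueOp (hπ : π ∈ 𝔭) (hπ' : π ∉ 𝔭 ^ 2)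
    (hD : adicResidue 𝔭 (D.op 1 (algebraMap A _ π)) ≠ 0) (n : ℕ)
    [Module.Finite k (A ⧸ 𝔭 ^ (0 + n + 1))] (l : Module.Dual k (A ⧸ 𝔭 ^ (0 + n + 1))) :
    ∃ a : A, l = (Algebra.trace k (A ⧸ 𝔭) ∘ₗ D.residueOp n) ∘ₗ
      LinearMap.mulLeft k (Ideal.Quotient.mk _ a) := by
  let Λ : (A ⧸ 𝔭 ^ (0 + n + 1)) →ₗ[k] Module.Dual k (A ⧸ 𝔭 ^ (0 + n + 1)) :=
    (LinearMap.mul k _).compr₂ (Algebra.trace k (A ⧸ 𝔭) ∘ₗ D.residueOp n)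
  have hinj : Function.Injective Λ := by
    rw [injective_iff_map_eq_zero]
    intro a ha
    obtain ⟨a, rfl⟩ := Ideal.Quotient.mk_surjective a
    rw [Ideal.Quotient.eq_zero_iff_mem, zero_add]
    refine mem_pow_of_trace_residueOp_eq_zero D hπ hπ' hD (n := n) (fun x => ?_) _ le_rfl
    rw [mul_comm, map_mul]
    exact LinearMap.congr_fun ha (Ideal.Quotient.mk _ x)
  have hsurj := (LinearMap.injective_iff_surjective_of_finrank_eq_finrank
    Subspace.dual_finrank_eq.symm).1 hinj
  obtain ⟨a, ha⟩ := hsurj l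
  obtain ⟨a, rfl⟩ := Ideal.Quotient.mk_surjective a
  exact ⟨a, ha.symm⟩

end DualGenerator

/-! ### Series over a basis of `A` and linear forms -/

section DualPairing

open Filter

variable {k A M ι I : Type*} [Field k] [CommRing A] [Algebra k A] [AddCommGroup M] [Module k M]

section

variable [TopologicalSpace M] (B : Module.Basis ι k A)

/-- The sum `∑_b λ(b) e_b`, i.e. the image of the series `∑_b b ⊗ e_b` under `λ ⊗ id`. -/
noncomputable def dualPairing (e : ι → M) (l : Module.Dual k A) : M :=
  ∑' b, l (B b) • e b

theorem dualPairing_coord (e : ι → M) (b : ι) : dualPairing B e (B.coord b) = e b := by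
  classical
  rw [dualPairing, tsum_eq_single b fun b' hb' => ?_]
  · simp
  · rw [B.coord_apply, B.repr_self, Finsupp.single_eq_of_ne hb'.symm, zero_smul]

theorem dualPairing_zero (e : ι → M) : dualPairing B e 0 = 0 := by
  simp [dualPairing]

theorem tendsto_smul_zero_of_finite [Finite k] [ContinuousConstSMul k M] {e : I → M}
    (he : Tendsto e cofinite (𝓝 0)) (c : I → k) : Tendsto (fun i => c i • e i) cofinite (𝓝 0) := by
  intro U hU
  have h1 : ∀ a : k, ∀ᶠ i in cofinite, a • e i ∈ U := fun a => by
    have := he.const_smul a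
    rw [smul_zero] at this
    exact this hU
  have h2 := eventually_all.2 h1
  exact h2.mono fun i hi => hi (c i)

end

variable [Finite k] [UniformSpace M] [IsUniformAddGroup M] [CompleteSpace M]
  [NonarchimedeanAddGroup M] [ContinuousConstSMul k M] (B : Module.Basis ι k A)

theorem summable_smul_of_tendsto {e : I → M} (he : Tendsto e cofinite (𝓝 0)) (c : I → k) :
    Summable fun i => c i • e i :=
  NonarchimedeanAddGroup.summable_of_tendsto_cofinite_zero (tendsto_smul_zero_of_finite he c)

theorem hasSum_dualPairing {e : ι → M} (he : Tendsto e cofinite (𝓝 0)) (l : Module.Dual k A) :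
    HasSum (fun b => l (B b) • e b) (dualPairing B e l) :=
  (summable_smul_of_tendsto he _).hasSum

variable [T2Space M]

theorem dualPairing_add {e : ι → M} (he : Tendsto e cofinite (𝓝 0)) (l l' : Module.Dual k A) :
    dualPairing B e (l + l') = dualPairing B e l + dualPairing B e l' := by
  rw [dualPairing, dualPairing, dualPairing, ← Summable.tsum_add]
  · simp only [LinearMap.add_apply, add_smul]
  · exact summable_smul_of_tendsto he _
  · exact summable_smul_of_tendsto he _

theorem dualPairing_smul {e : ι → M} (he : Tendsto e cofinite (𝓝 0)) (c : k) (l : Module.Dual k A) :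
    dualPairing B e (c • l) = c • dualPairing B e l := by
  rw [dualPairing, dualPairing, ← (summable_smul_of_tendsto he _).tsum_const_smul]
  simp only [LinearMap.smul_apply, smul_assoc]

theorem dualPairing_sub {e : ι → M} (he : Tendsto e cofinite (𝓝 0)) (l l' : Module.Dual k A) :
    dualPairing B e (l - l') = dualPairing B e l - dualPairing B e l' := by
  rw [eq_sub_iff_add_eq, ← dualPairing_add B he, sub_add_cancel]

/-- A series `∑_i x_i ⊗ e_i` with arbitrary `x_i ∈ A` and `e_i → 0` can be expanded along a basis of
`A`, and this does not change its image under `λ ⊗ id`. -/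
theorem exists_tendsto_and_hasSum (x : I → A) {e : I → M} (he : Tendsto e cofinite (𝓝 0)) :
    ∃ y : ι → M, Tendsto y cofinite (𝓝 0) ∧
      (∀ b, HasSum (fun i => B.repr (x i) b • e i) (y b)) ∧
      ∀ l : Module.Dual k A, dualPairing B y l = ∑' i, l (x i) • e i := by
  have hf : Tendsto (fun q : I × ι => B.repr (x q.1) q.2 • e q.1) cofinite (𝓝 0) := by
    intro U hU
    have h1 := eventually_all.2 fun a : k => (by
      have := he.const_smul a
      rw [smul_zero] at this
      exact this hU : ∀ᶠ i in cofinite, a • e i ∈ U)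
    rw [mem_map, mem_cofinite]
    refine Set.Finite.subset (h1.biUnion fun i _ =>
      ((B.repr (x i)).support.finite_toSet.image fun b => (i, b))) ?_
    rintro ⟨i, b⟩ hq
    rw [Set.mem_compl_iff, Set.mem_preimage] at hq
    rw [Set.mem_iUnion₂]
    refine ⟨i, fun h => hq (h _), b, ?_, rfl⟩
    rw [Finset.mem_coe, Finsupp.mem_support_iff]
    intro h
    dsimp only at hq
    rw [h, zero_smul] at hq
    exact hq (mem_of_mem_nhds hU)
  have hy : ∀ b, HasSum (fun i => B.repr (x i) b • e i) (∑' i, B.repr (x i) b • e i) :=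
    fun b => (summable_smul_of_tendsto he _).hasSum
  have hnull : Tendsto (fun b => ∑' i, B.repr (x i) b • e i) cofinite (𝓝 0) := by
    intro U hU
    obtain ⟨V, hV⟩ := NonarchimedeanAddGroup.is_nonarchimedean U hU
    have h1 : ∀ᶠ q : I × ι in cofinite, B.repr (x q.1) q.2 • e q.1 ∈ (V : Set M) :=
      hf (V.mem_nhds_zero)
    rw [mem_map, mem_cofinite]
    refine Set.Finite.subset (Set.Finite.image Prod.snd h1) fun b hb => ?_
    by_contra hcon
    refine hb (hV ?_)
    refine V.isClosed.mem_of_tendsto (hy b) (Eventually.of_forall fun s => ?_)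
    refine sum_mem fun i _ => ?_
    by_contra hi
    exact hcon ⟨(i, b), hi, rfl⟩
  refine ⟨_, hnull, hy, fun l => ?_⟩
  have hs : Summable fun q : I × ι => l (B q.2) • B.repr (x q.1) q.2 • e q.1 :=
    summable_smul_of_tendsto hf fun q => l (B q.2)
  have e1 : ∀ i, HasSum (fun b => l (B b) • B.repr (x i) b • e i) (l (x i) • e i) := by
    intro i
    have h1 : ∀ b ∉ (B.repr (x i)).support, l (B b) • B.repr (x i) b • e i = 0 := by
      intro b hb
      rw [Finsupp.notMem_support_iff.1 hb, zero_smul, smul_zero]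
    have h2 : HasSum (fun b => l (B b) • B.repr (x i) b • e i) _ :=
      hasSum_sum_of_ne_finset_zero h1
    convert h2 using 1
    conv_lhs => rw [← B.linearCombination_repr (x i), Finsupp.linearCombination_apply, Finsupp.sum,
      map_sum, Finset.sum_smul]
    refine Finset.sum_congr rfl fun b _ => ?_
    rw [map_smul, smul_eq_mul, mul_comm, mul_smul]
  have e2 : ∀ b, HasSum (fun i => l (B b) • B.repr (x i) b • e i)
      (l (B b) • ∑' i, B.repr (x i) b • e i) := fun b => (hy b).const_smul _
  have s1 := hs.hasSum.prod_fiberwise e1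
  have s2 := ((Equiv.prodComm ι I).hasSum_iff.2 hs.hasSum).prod_fiberwise e2
  rw [s1.tsum_eq]
  exact s2.tsum_eq

end DualPairing

/-! ### Special functions as linear maps on the dual of `A` -/

section SpecialFamilies

open Filter

variable {k A M ι I : Type*} [Field k] [CommRing A] [Algebra k A] [AddCommGroup M] [Module k M]
  [Module A M]

/-- The families `(e_b)_b` for which the series `∑_b b ⊗ e_b` is a special function, i.e. `e_b → 0` and
multiplication by `x ∈ A` on the left factor agrees with that on the right factor. -/
def IsSpecialFamily [TopologicalSpace M] (B : Module.Basis ι k A) (e : ι → M) : Prop :=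
  Tendsto e cofinite (𝓝 0) ∧
    ∀ (x : A) (b' : ι), HasSum (fun b => B.repr (x * B b) b' • e b) (x • e b')

variable [Finite k] [UniformSpace M] [IsUniformAddGroup M] [CompleteSpace M]
  [NonarchimedeanAddGroup M] [T2Space M] [ContinuousConstSMul k M] {B : Module.Basis ι k A}

/-- A series `∑_i x_i ⊗ e_i` whose functional `λ ↦ ∑_i λ(x_i) e_i` is `A`-linear is a special
function. -/
theorem exists_isSpecialFamily (B : Module.Basis ι k A) (x : I → A)
    {e : I → M} (he : Tendsto e cofinite (𝓝 0))
    (hlin : ∀ (a : A) (l : Module.Dual k A), ∑' i, l (a * x i) • e i = a • ∑' i, l (x i) • e i) :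
    ∃ y : ι → M, IsSpecialFamily B y ∧ ∀ l : Module.Dual k A,
      dualPairing B y l = ∑' i, l (x i) • e i := by
  obtain ⟨y, hy, hsum, hl⟩ := exists_tendsto_and_hasSum B x he
  refine ⟨y, ⟨hy, fun a b' => ?_⟩, hl⟩
  have h1 := hasSum_dualPairing B hy (B.coord b' ∘ₗ LinearMap.mulLeft k a)
  have h2 : dualPairing B y (B.coord b' ∘ₗ LinearMap.mulLeft k a) = a • y b' := by
    rw [hl, ← dualPairing_coord B y b', hl, ← hlin]
    rfl
  rwa [h2] at h1

variable [IsScalarTower k A M] [ContinuousConstSMul A M]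

/-- The functional `λ ↦ (λ ⊗ id)(h)` of a special function `h` is `A`-linear. -/
theorem IsSpecialFamily.dualPairing_comp {e : ι → M}
    (he : IsSpecialFamily B e) (x : A) (l : Module.Dual k A) :
    dualPairing B e (l ∘ₗ LinearMap.mulLeft k x) = x • dualPairing B e l := by
  obtain ⟨y, hy, hsum, hl⟩ := exists_tendsto_and_hasSum B (fun b => x * B b) he.1
  have hyx : y = fun b => x • e b := funext fun b => (hsum b).unique (he.2 x b)
  have h1 : dualPairing B y l = x • dualPairing B e l := by
    rw [dualPairing, dualPairing, ← (summable_smul_of_tendsto he.1 _).tsum_const_smul, hyx]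
    refine tsum_congr fun b => ?_
    exact (smul_algebra_smul_comm _ _ _).symm
  rw [← h1, hl]
  rfl

/-- If the functional of a special function `h` vanishes on the forms `λ` that are zero on `𝔭ᴺ`, then
`h` is locally at `𝔭` divisible by `πᴺ`. The quotient is the functional `λ ↦ h(λ ∘ σ ∘ s)`, where `σ`
is a linear left inverse of the multiplication by `πᴺ` and `s 𝔭ᴺ ⊆ πᴺ A`. -/
theorem IsSpecialFamily.exists_smul_eq_pow_smul [IsDedekindDomain A]
    {𝔭 : Ideal A} [𝔭.IsPrime] {π : A} (hπ : π ∈ 𝔭) (hπ' : π ∉ 𝔭 ^ 2) (N : ℕ) {e : ι → M}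
    (he : IsSpecialFamily B e)
    (h0 : ∀ l : Module.Dual k A, (∀ x ∈ 𝔭 ^ N, l x = 0) → dualPairing B e l = 0) :
    ∃ s ∉ 𝔭, ∃ e' : ι → M, IsSpecialFamily B e' ∧ s • e = π ^ N • e' := by
  have hπ0 : π ^ N ≠ 0 := pow_ne_zero _ (by rintro rfl; exact hπ' (zero_mem _))
  obtain ⟨s, hs, hdvd⟩ := exists_notMem_forall_pow_dvd_mul hπ hπ' N
  obtain ⟨σ, hσ⟩ := (LinearMap.mulLeft k (π ^ N)).exists_leftInverse_of_injective
    (LinearMap.ker_eq_bot.2 fun x y hxy => mul_left_cancel₀ hπ0 hxy)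
  have hσ' : ∀ x, σ (π ^ N * x) = x := fun x => LinearMap.congr_fun hσ x
  have heq : ∀ l l' : Module.Dual k A, (∀ x ∈ 𝔭 ^ N, l x = l' x) →
      dualPairing B e l = dualPairing B e l' := by
    intro l l' h
    rw [← sub_eq_zero, ← dualPairing_sub B he.1]
    exact h0 _ fun x hx => by rw [LinearMap.sub_apply, h x hx, sub_self]
  have hsum : ∀ l : Module.Dual k A, ∑' b, l (σ (s * B b)) • e b =
      dualPairing B e (l ∘ₗ σ ∘ₗ LinearMap.mulLeft k s) := fun l => rfl
  obtain ⟨e', he', hl⟩ := exists_isSpecialFamily B (fun b => σ (s * B b)) he.1 fun a l => by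
    rw [hsum, ← he.dualPairing_comp]
    have h1 := hsum (l ∘ₗ LinearMap.mulLeft k a)
    refine h1.trans (heq _ _ fun x hx => ?_)
    obtain ⟨c, hc⟩ := hdvd x hx
    change l (a * σ (s * x)) = l (σ (s * (a * x)))
    rw [mul_left_comm s, hc, mul_left_comm a, hσ', hσ']
  refine ⟨s, hs, e', he', funext fun b => ?_⟩
  rw [Pi.smul_apply, Pi.smul_apply, ← dualPairing_coord B e b, ← dualPairing_coord B e' b,
    ← he.dualPairing_comp, ← he'.dualPairing_comp, hl, hsum]
  refine heq _ _ fun x hx => ?_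
  obtain ⟨c, hc⟩ := hdvd x hx
  change B.coord b (s * x) = B.coord b (π ^ N * σ (s * x))
  rw [hc, hσ']

end SpecialFamilies

section PolynomialDual

open Polynomial

/-- The dual `Hom_R(S, R)` as an `S`-module. -/
def DualOver (R S : Type*) [CommRing R] [CommRing S] [Algebra R S] : Type _ := S →ₗ[R] R

namespace DualOver

variable {R S : Type*} [CommRing R] [CommRing S] [Algebra R S]

noncomputable instance : AddCommGroup (DualOver R S) := inferInstanceAs (AddCommGroup (S →ₗ[R] R))
noncomputable instance : Module R (DualOver R S) := inferInstanceAs (Module R (S →ₗ[R] R))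
instance : FunLike (DualOver R S) S R := inferInstanceAs (FunLike (S →ₗ[R] R) S R)
instance : LinearMapClass (DualOver R S) R S R :=
  inferInstanceAs (LinearMapClass (S →ₗ[R] R) R S R)

theorem ext {f g : DualOver R S} (h : ∀ x, f x = g x) : f = g := LinearMap.ext h

noncomputable instance : Module S (DualOver R S) where
  smul a f := (f : S →ₗ[R] R) ∘ₗ LinearMap.mulLeft R a
  one_smul f := ext fun x => congrArg f (one_mul x)
  mul_smul a b f := ext fun x => congrArg f (by
    change a * b * x = b * (a * x)
    rw [mul_comm a b, mul_assoc])
  smul_zero a := rfl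
  smul_add a f g := rfl
  add_smul a b f := ext fun x => (congrArg f (add_mul a b x)).trans (map_add f _ _)
  zero_smul f := ext fun x => (congrArg f (zero_mul x)).trans (map_zero f)

theorem smul_apply (a : S) (f : DualOver R S) (x : S) : (a • f) x = f (a * x) := rfl

instance : IsScalarTower R S (DualOver R S) where
  smul_assoc c a f := ext fun x => by
    change f (c • a * x) = c • f (a * x)
    rw [smul_mul_assoc, map_smul]

/-- For a finite extension of a principal ideal domain by a Dedekind domain the dual is projective. -/
theorem projective [IsDomain R] [IsPrincipalIdealRing R] [IsDedekindDomain S] [Module.Finite R S]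
    [Module.IsTorsionFree R S] : Module.Projective S (DualOver R S) := by
  have hfree : Module.Free R S := Module.free_of_finite_type_torsion_free'
  have hfin : Module.Finite R (DualOver R S) := inferInstanceAs (Module.Finite R (S →ₗ[R] R))
  have : Module.Finite S (DualOver R S) := Module.Finite.of_restrictScalars_finite R S _
  have : Module.IsTorsionFree S (DualOver R S) := by
    refine Module.IsTorsionFree.of_smul_eq_zero fun a f h => ?_
    by_contra! hcon
    obtain ⟨ha, hf⟩ := hcon
    refine hf (ext fun x => ?_)
    obtain ⟨b, r, hr, hb⟩ := Algebra.IsAlgebraic.exists_smul_eq_mul R (1 : S) ha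
    have h1 : r • f x = 0 := by
      rw [← map_smul, ← one_mul x, ← smul_mul_assoc, hb, mul_assoc, ← smul_apply, h]
      rfl
    exact (smul_eq_zero.1 h1).resolve_left hr
  have := Module.finitePresentation_of_finite S (DualOver R S)
  exact Module.Flat.projective_of_finitePresentation

end DualOver

end PolynomialDual

/-! ### Extension of linear maps to special functions -/

section TorsionTowers

open Polynomial Filter

variable {k A M : Type*} [Field k] [CommRing A] [Algebra k A] [AddCommGroup M] [Module k M]
  [Module A M] [IsScalarTower k A M] [TopologicalSpace M]

section

variable (M) [IsTopologicalAddGroup M] [ContinuousConstSMul A M] (π : A)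

/-- The null sequences `(x_i)` with `π x₀ = 0` and `π x_{i+1} = x_i`. -/
def torsionTowers : Submodule A (ℕ → M) where
  carrier := {x | Tendsto x atTop (𝓝 0) ∧ π • x 0 = 0 ∧ ∀ i, π • x (i + 1) = x i}
  zero_mem' := ⟨tendsto_const_nhds, smul_zero _, fun _ => smul_zero _⟩
  add_mem' {x y} hx hy := by
    refine ⟨?_, ?_, fun i => ?_⟩
    · have h := hx.1.add hy.1
      rw [add_zero] at h
      exact h
    · rw [Pi.add_apply, smul_add, hx.2.1, hy.2.1, add_zero]
    · rw [Pi.add_apply, smul_add, hx.2.2, hy.2.2, Pi.add_apply]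
  smul_mem' a x hx := by
    refine ⟨?_, ?_, fun i => ?_⟩
    · have h := hx.1.const_smul a
      rw [smul_zero] at h
      exact h
    · rw [Pi.smul_apply, smul_comm, hx.2.1, smul_zero]
    · rw [Pi.smul_apply, smul_comm, hx.2.2, Pi.smul_apply]

variable {M π}

/-- Multiplication by `π` shifts a tower, with `x_i = 0` for `i < 0`. -/
theorem torsionTowers_pow_smul (x : torsionTowers M π) (m n : ℕ) :
    π ^ m • x.1 n = if m ≤ n then x.1 (n - m) else 0 := by
  induction m with
  | zero => simp
  | succ m ih =>
    rw [pow_succ', mul_smul, ih]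
    split_ifs with h1 h2 h2
    · obtain ⟨j, rfl⟩ := Nat.exists_eq_add_of_le h2
      rw [show m + 1 + j - m = j + 1 by omega, show m + 1 + j - (m + 1) = j by omega]
      exact x.2.2.2 j
    · rw [show n - m = 0 by omega]; exact x.2.2.1
    · omega
    · exact smul_zero _

theorem torsionTowers_aeval_smul (x : torsionTowers M π) (f : k[X]) (n : ℕ) :
    aeval π f • x.1 n = ∑ i ∈ Finset.range (n + 1), f.coeff (n - i) • x.1 i := by
  induction f using Polynomial.induction_on' with
  | add f g hf hg => simp only [map_add, add_smul, hf, hg, coeff_add, Finset.sum_add_distrib]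
  | monomial m a =>
    rw [aeval_monomial, mul_smul, algebraMap_smul, torsionTowers_pow_smul]
    simp only [coeff_monomial]
    split_ifs with h
    · rw [Finset.sum_eq_single_of_mem (n - m) (Finset.mem_range.2 (by omega)), if_pos (by omega)]
      intro i hi hne
      rw [Finset.mem_range] at hi
      rw [if_neg (by omega), zero_smul]
    · rw [smul_zero, Finset.sum_eq_zero]
      intro i hi
      rw [if_neg (by omega), zero_smul]

end

end TorsionTowers

section ExtensionOfForms

open Polynomial Filter

variable {k A M ι J : Type*} [Field k] [CommRing A] [Algebra k A] [AddCommGroup M] [Module k M]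
  [Module A M] [IsScalarTower k A M]  [Algebra k[X] A] [IsScalarTower k k[X] A]

theorem aeval_algebraMap_X (f : k[X]) : aeval (algebraMap k[X] A X) f = algebraMap k[X] A f := by
  rw [aeval_algebraMap_apply, aeval_X_left_apply]

theorem smulTower_basisMonomials (v : Module.Basis J k[X] A) (b : ℕ × J) :
    (basisMonomials k).smulTower v b = (X ^ b.1 : k[X]) • v b.2 := by
  rw [Module.Basis.smulTower_apply, coe_basisMonomials]
  exact congrArg (· • v b.2) (monomial_one_right_eq_X_pow b.1)

/-- A linear form on `A` that vanishes on `X ^ N • A` is a coefficient of a `k[X]`-linear map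
`A → k[X]`. -/
theorem exists_coeff_eq [Module.Free k[X] A] {N : ℕ} (hN : 0 < N) (l : Module.Dual k A)
    (hl : ∀ x, l ((X ^ N : k[X]) • x) = 0) :
    ∃ g : A →ₗ[k[X]] k[X], ∀ x, (g x).coeff (N - 1) = l x := by
  let v := Module.Free.chooseBasis k[X] A
  let g : A →ₗ[k[X]] k[X] := v.constr k[X] fun j =>
    ∑ i ∈ Finset.range N, C (l ((X ^ i : k[X]) • v j)) * X ^ (N - 1 - i)
  refine ⟨g, fun x => ?_⟩
  have h : lcoeff k (N - 1) ∘ₗ g.restrictScalars k = l := by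
    refine ((basisMonomials k).smulTower v).ext fun ⟨m, j⟩ => ?_
    rw [smulTower_basisMonomials]
    change (g ((X ^ m : k[X]) • v j)).coeff (N - 1) = _
    rw [map_smul, smul_eq_mul, coeff_X_pow_mul', v.constr_basis]
    split_ifs with h
    · simp only [finsetSum_coeff, coeff_C_mul, coeff_X_pow]
      rw [Finset.sum_eq_single_of_mem m (Finset.mem_range.2 (by omega)), if_pos rfl, mul_one]
      intro i hi hne
      rw [Finset.mem_range] at hi
      rw [if_neg (by omega), mul_zero]
    · obtain ⟨q, rfl⟩ := Nat.exists_eq_add_of_le (show N ≤ m by omega)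
      rw [pow_add, mul_smul, hl]
  exact LinearMap.congr_fun h x

/-- A linear form on `A/I` from one on `A` that vanishes on `I`. -/
def dualQuotientLift {I : Ideal A} (f : Module.Dual k A) (hf : ∀ x ∈ I, f x = 0) :
    Module.Dual k (A ⧸ I) :=
  Submodule.liftQ (I.restrictScalars k) f hf

namespace DualOver

variable {R S : Type*} [CommRing R] [CommRing S] [Algebra R S]

/-- The elements of the dual basis. -/
noncomputable def coord (v : Module.Basis J R S) (j : J) : DualOver R S := v.coord j

theorem coord_apply (v : Module.Basis J R S) (j : J) (x : S) : coord v j x = v.repr x j := rfl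

theorem sum_smul_coord [Fintype J] (v : Module.Basis J R S) (g : DualOver R S) :
    g = ∑ j, algebraMap R S (g (v j)) • coord v j := by
  have h : ∀ f : J → DualOver R S, ∀ x, (∑ j, f j) x = ∑ j, f j x :=
    fun f x => LinearMap.sum_apply (M := S) (M₂ := R) Finset.univ f x
  refine ext fun x => ?_
  rw [h]
  conv_lhs => rw [← v.sum_repr x, map_sum]
  refine Finset.sum_congr rfl fun j _ => ?_
  rw [smul_apply, ← Algebra.smul_def, map_smul, map_smul, coord_apply, smul_eq_mul, smul_eq_mul,
    mul_comm]

end DualOver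

/-- A map from `Hom_{k[X]}(A, k[X])` to towers is given on all elements by a convergent series of its
values on a dual basis. -/
theorem hasSum_coeff_smul [TopologicalSpace M] [IsTopologicalAddGroup M] [ContinuousConstSMul A M]
    [Fintype J] (v : Module.Basis J k[X] A)
    (G : DualOver k[X] A →ₗ[A] torsionTowers M (algebraMap k[X] A X)) (g : DualOver k[X] A) (n : ℕ) :
    HasSum (fun b : ℕ × J => (g (((basisMonomials k).smulTower v) b)).coeff n •
      (G (DualOver.coord v b.2)).1 b.1) ((G g).1 n) := by
  have h1 : (G g).1 n = ∑ b ∈ Finset.range (n + 1) ×ˢ (Finset.univ : Finset J),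
      (g (((basisMonomials k).smulTower v) b)).coeff n • (G (DualOver.coord v b.2)).1 b.1 := by
    conv_lhs => rw [DualOver.sum_smul_coord v g, map_sum, Submodule.coe_sum, Finset.sum_apply]
    rw [Finset.sum_product_right]
    refine Finset.sum_congr rfl fun j _ => ?_
    rw [map_smul, Submodule.coe_smul, Pi.smul_apply, ← aeval_algebraMap_X, torsionTowers_aeval_smul]
    refine Finset.sum_congr rfl fun i hi => ?_
    rw [Finset.mem_range] at hi
    rw [smulTower_basisMonomials, map_smul, smul_eq_mul, coeff_X_pow_mul', if_pos (by dsimp; omega)]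
  rw [h1]
  refine hasSum_sum_of_ne_finset_zero fun b hb => ?_
  have hb' : ¬ b.1 ≤ n := fun h => hb (by simp; omega)
  rw [smulTower_basisMonomials, map_smul, smul_eq_mul, coeff_X_pow_mul', if_neg hb', zero_smul]

variable [Finite k] [UniformSpace M] [IsUniformAddGroup M] [CompleteSpace M]
  [NonarchimedeanAddGroup M] [T2Space M] [ContinuousConstSMul k M] [ContinuousConstSMul A M]

/-- A map from `Hom_{k[X]}(A, k[X])` to towers yields a special function. -/
theorem exists_isSpecialFamily_of_dualOver [Finite J] (B : Module.Basis ι k A)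
    (v : Module.Basis J k[X] A)
    (G : DualOver k[X] A →ₗ[A] torsionTowers M (algebraMap k[X] A X)) :
    ∃ e, IsSpecialFamily B e ∧ ∀ (g : DualOver k[X] A) (n : ℕ) (l : Module.Dual k A),
      (∀ x, (g x).coeff n = l x) → dualPairing B e l = (G g).1 n := by
  have := Fintype.ofFinite J
  let B' := (basisMonomials k).smulTower v
  let e : ℕ × J → M := fun b => (G (DualOver.coord v b.2)).1 b.1
  have he : Tendsto e cofinite (𝓝 0) := by
    intro U hU
    have h1 : ∀ j, ∀ᶠ i in cofinite, (G (DualOver.coord v j)).1 i ∈ U := fun j => by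
      rw [Nat.cofinite_eq_atTop]
      exact (G (DualOver.coord v j)).2.1 hU
    rw [mem_map, mem_cofinite]
    refine Set.Finite.subset (Set.finite_iUnion fun j => (h1 j).image fun i => (i, j)) ?_
    rintro ⟨i, j⟩ hij
    exact Set.mem_iUnion.2 ⟨j, i, hij, rfl⟩
  have hs : IsSpecialFamily B' e := by
    refine ⟨he, fun a b => ?_⟩
    have h := hasSum_coeff_smul v G (a • DualOver.coord v b.2) b.1
    rw [map_smul] at h
    convert h using 3 with b'
    · exact Module.Basis.smulTower_repr _ _ _ _
    · rfl
  obtain ⟨y, hy, hl⟩ := exists_isSpecialFamily B B' he fun a l => hs.dualPairing_comp a l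
  refine ⟨y, hy, fun g n l hgl => ?_⟩
  rw [hl, ← (hasSum_coeff_smul v G g n).tsum_eq]
  exact tsum_congr fun b => by rw [← hgl]

variable [IsDedekindDomain A] [Module.Finite k[X] A] [Module.IsTorsionFree k[X] A]

/-- If the torsion points lift to towers, then all `A`-linear maps `(A/𝔭ᴺ)^* → M` come from special
functions, because `Hom_{k[X]}(A, k[X])` is projective over `A`. -/
theorem exists_isSpecialFamily_of_dual_quotient (B : Module.Basis ι k A) {𝔭 : Ideal A}
    [𝔭.IsMaximal] (hπ : algebraMap k[X] A X ∈ 𝔭) (hπ' : algebraMap k[X] A X ∉ 𝔭 ^ 2)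
    {N : ℕ} (hN : 0 < N)
    (hdiv : ∀ m : M, algebraMap k[X] A X ^ N • m = 0 →
      ∃ x : torsionTowers M (algebraMap k[X] A X), x.1 (N - 1) = m)
    (ψ : Module.Dual k (A ⧸ 𝔭 ^ N) →+ M)
    (hψ : ∀ (a : A) l, ψ (l ∘ₗ LinearMap.mulLeft k (Ideal.Quotient.mk _ a)) = a • ψ l) :
    ∃ e, IsSpecialFamily B e ∧ ∀ l : Module.Dual k (A ⧸ 𝔭 ^ N),
      dualPairing B e (l ∘ₗ (Ideal.Quotient.mkₐ k (𝔭 ^ N)).toLinearMap) = ψ l := by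
  have hfree : Module.Free k[X] A := Module.free_of_finite_type_torsion_free'
  have hproj : Module.Projective A (DualOver k[X] A) := DualOver.projective
  obtain ⟨c₀, hc₀, hdvd⟩ := exists_notMem_forall_pow_dvd_mul hπ hπ' N
  obtain ⟨d, hd⟩ := (isUnit_mk_pow_of_notMem hc₀ N).exists_right_inv
  obtain ⟨d, rfl⟩ := Ideal.Quotient.mk_surjective d
  rw [← map_mul] at hd
  -- `L` sends `g` to the form `x ↦ [X^(N-1)] g(c x)` on `A/𝔭ᴺ`, where `c = c₀ d ≡ 1` modulo `𝔭ᴺ`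
  -- and `c 𝔭ᴺ ⊆ X^N A`, so that the form vanishes on `𝔭ᴺ`
  obtain ⟨L, hL⟩ : ∃ L : DualOver k[X] A → Module.Dual k (A ⧸ 𝔭 ^ N),
      ∀ g x, L g (Ideal.Quotient.mk _ x) = (g (c₀ * d * x)).coeff (N - 1) := by
    refine ⟨fun g => dualQuotientLift (lcoeff k (N - 1) ∘ₗ
      (g : A →ₗ[k[X]] k[X]).restrictScalars k ∘ₗ LinearMap.mulLeft k (c₀ * d)) fun x hx => ?_,
      fun g x => rfl⟩
    obtain ⟨y, hy⟩ := hdvd x hx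
    change (g (c₀ * d * x)).coeff (N - 1) = 0
    rw [mul_right_comm, hy, mul_assoc, ← map_pow, ← Algebra.smul_def, map_smul, smul_eq_mul,
      coeff_X_pow_mul', if_neg (by omega)]
  have hLadd : ∀ g g', L (g + g') = L g + L g' := fun g g' => LinearMap.ext fun x => by
    obtain ⟨x, rfl⟩ := Ideal.Quotient.mk_surjective x
    rw [hL, LinearMap.add_apply, hL, hL, ← coeff_add]
    rfl
  have hLsmul : ∀ (a : A) g, L (a • g) = L g ∘ₗ LinearMap.mulLeft k (Ideal.Quotient.mk _ a) :=
    fun a g => LinearMap.ext fun x => by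
      obtain ⟨x, rfl⟩ := Ideal.Quotient.mk_surjective x
      rw [hL, LinearMap.comp_apply, LinearMap.mulLeft_apply, ← map_mul, hL, DualOver.smul_apply,
        mul_left_comm]
  have htors : ∀ l, algebraMap k[X] A X ^ N • ψ l = 0 := fun l => by
    have h0 : l ∘ₗ LinearMap.mulLeft k (Ideal.Quotient.mk (𝔭 ^ N) (algebraMap k[X] A X ^ N)) = 0 := by
      rw [Ideal.Quotient.eq_zero_iff_mem.2 (Ideal.pow_mem_pow hπ N), LinearMap.mulLeft_zero_eq_zero,
        LinearMap.comp_zero]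
    rw [← hψ, h0, map_zero]
  let Ψ : DualOver k[X] A →ₗ[A] Submodule.torsionBy A M (algebraMap k[X] A X ^ N) :=
    { toFun := fun g => ⟨ψ (L g), htors _⟩
      map_add' := fun g g' => Subtype.ext ((congrArg ψ (hLadd g g')).trans (map_add ψ _ _))
      map_smul' := fun a g => Subtype.ext ((congrArg ψ (hLsmul a g)).trans (hψ a _)) }
  let ev : torsionTowers M (algebraMap k[X] A X) →ₗ[A]
      Submodule.torsionBy A M (algebraMap k[X] A X ^ N) :=
    { toFun := fun x => ⟨x.1 (N - 1), (torsionTowers_pow_smul x N (N - 1)).trans (if_neg (by omega))⟩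
      map_add' := fun x y => rfl
      map_smul' := fun a x => rfl }
  obtain ⟨G, hG⟩ := Module.projective_lifting_property ev Ψ fun m => by
    obtain ⟨x, hx⟩ := hdiv m.1 m.2
    exact ⟨x, Subtype.ext hx⟩
  obtain ⟨e, he, hpair⟩ := exists_isSpecialFamily_of_dualOver B (Module.Free.chooseBasis k[X] A) G
  refine ⟨e, he, fun l => ?_⟩
  obtain ⟨g, hg⟩ := exists_coeff_eq hN (l ∘ₗ (Ideal.Quotient.mkₐ k (𝔭 ^ N)).toLinearMap) fun x => by
    change l (Ideal.Quotient.mk _ _) = 0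
    rw [Algebra.smul_def, map_pow, Ideal.Quotient.eq_zero_iff_mem.2
      (Ideal.mul_mem_right _ _ (Ideal.pow_mem_pow hπ N)), map_zero]
  rw [hpair (g : DualOver k[X] A) (N - 1) _ hg]
  have h1 := congrArg Subtype.val (LinearMap.congr_fun hG (g : DualOver k[X] A))
  refine h1.trans (congrArg ψ (LinearMap.ext fun x => ?_))
  obtain ⟨x, rfl⟩ := Ideal.Quotient.mk_surjective x
  refine (hL _ _).trans ((hg _).trans ?_)
  change l (Ideal.Quotient.mk _ _) = _
  rw [map_mul, hd, one_mul]

end ExtensionOfForms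

/-! ### Bases of torsion modules -/

section TorsionBasis

open Filter

variable {k A M ι : Type*} [Field k] [Finite k] [CommRing A] [Algebra k A] [AddCommGroup M]
  [Module k M] [Module A M] [IsScalarTower k A M] [UniformSpace M] [IsUniformAddGroup M]
  [CompleteSpace M] [NonarchimedeanAddGroup M] [T2Space M] [ContinuousConstSMul k M]
  [ContinuousConstSMul A M] {B : Module.Basis ι k A}

/-- The value of a special function at a linear form on `A/𝔞`, as an `𝔞`-torsion point. -/
noncomputable def evalForm {sf : Submodule A (ι → M)} (hsf : ∀ e ∈ sf, IsSpecialFamily B e)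
    (𝔞 : Ideal A) (l : Module.Dual k (A ⧸ 𝔞)) :
    sf →ₗ[A] Submodule.torsionBySet A M (𝔞 : Set A) where
  toFun e := ⟨dualPairing B e (l ∘ₗ (Ideal.Quotient.mkₐ k 𝔞).toLinearMap), by
    rw [Submodule.mem_torsionBySet_iff]
    rintro ⟨a, ha⟩
    rw [← (hsf e e.2).dualPairing_comp]
    convert dualPairing_zero B (e : ι → M)
    ext x
    change l (Ideal.Quotient.mk 𝔞 (a * x)) = 0
    rw [Ideal.Quotient.eq_zero_iff_mem.2 (Ideal.mul_mem_right _ _ ha), map_zero]⟩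
  map_add' e e' := by
    refine Subtype.ext ?_
    change dualPairing B (e.1 + e'.1) _ = dualPairing B e.1 _ + dualPairing B e'.1 _
    rw [dualPairing, dualPairing, dualPairing, ← Summable.tsum_add]
    · exact tsum_congr fun b => smul_add _ _ _
    · exact summable_smul_of_tendsto (hsf _ e.2).1 _
    · exact summable_smul_of_tendsto (hsf _ e'.2).1 _
  map_smul' a e := by
    refine Subtype.ext ?_
    change dualPairing B (a • e.1) _ = a • dualPairing B e.1 _
    rw [dualPairing, dualPairing, ← (summable_smul_of_tendsto (hsf _ e.2).1 _).tsum_const_smul]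
    exact tsum_congr fun b => (smul_algebra_smul_comm _ _ _).symm

theorem coe_evalForm {sf : Submodule A (ι → M)} (hsf : ∀ e ∈ sf, IsSpecialFamily B e)
    (𝔞 : Ideal A) (l : Module.Dual k (A ⧸ 𝔞)) (e : sf) :
    (evalForm hsf 𝔞 l e : M) = dualPairing B e (l ∘ₗ (Ideal.Quotient.mkₐ k 𝔞).toLinearMap) := rfl

theorem evalForm_comp_mulLeft {sf : Submodule A (ι → M)} (hsf : ∀ e ∈ sf, IsSpecialFamily B e)
    (𝔞 : Ideal A) (l : Module.Dual k (A ⧸ 𝔞)) (a : A) (e : sf) :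
    evalForm hsf 𝔞 (l ∘ₗ LinearMap.mulLeft k (Ideal.Quotient.mk 𝔞 a)) e = a • evalForm hsf 𝔞 l e := by
  refine Subtype.ext ?_
  rw [Submodule.coe_smul, coe_evalForm, coe_evalForm, ← (hsf e e.2).dualPairing_comp]
  congr 1

/-- The `A_𝔭`-linear extension of the evaluation at a form on `A/𝔭ᴺ`. -/
theorem exists_linearMap_tensor {T S : Type*} [AddCommGroup T] [Module A T] [AddCommGroup S]
    [Module A S] {𝔭 : Ideal A} (N : ℕ) [Module (A ⧸ 𝔭 ^ N) T] [IsScalarTower A (A ⧸ 𝔭 ^ N) T]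
    (v : S →ₗ[A] T) : ∃ Θ : AdicCompletion 𝔭 A ⊗[A] S →ₗ[A] T,
      ∀ α s, Θ (α ⊗ₜ s) = AdicCompletion.evalₐ 𝔭 N α • v s := by
  refine ⟨TensorProduct.lift (LinearMap.mk₂ A (fun α s => AdicCompletion.evalₐ 𝔭 N α • v s)
    (fun α β s => ?_) (fun c α s => ?_) (fun α s s' => ?_) (fun c α s => ?_)), fun α s => rfl⟩
  · rw [map_add, add_smul]
  · rw [map_smul, smul_assoc]
  · rw [map_add, smul_add]
  · rw [map_smul, ← algebraMap_smul (A ⧸ 𝔭 ^ N) c (v s), smul_smul, mul_comm, ← smul_smul,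
      algebraMap_smul]

/-- Let `λ` generate the dual of `A/𝔭ᴺ`, and suppose that all `A`-linear maps `(A/𝔭ᴺ)^* → M` come from
special functions. Then the values at `λ` of special functions that form a basis over `A_𝔭` are a
basis of the `𝔭ᴺ`-torsion. -/
theorem exists_basis_torsion [IsDedekindDomain A] {sf : Submodule A (ι → M)}
    (hsf : ∀ e, e ∈ sf ↔ IsSpecialFamily B e) {𝔭 : Ideal A} [𝔭.IsPrime] {π : A} (hπ : π ∈ 𝔭)
    (hπ' : π ∉ 𝔭 ^ 2) (N : ℕ)
    (hext : ∀ ψ : Module.Dual k (A ⧸ 𝔭 ^ N) →+ M,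
      (∀ (a : A) l, ψ (l ∘ₗ LinearMap.mulLeft k (Ideal.Quotient.mk _ a)) = a • ψ l) →
      ∃ e, IsSpecialFamily B e ∧ ∀ l : Module.Dual k (A ⧸ 𝔭 ^ N),
        dualPairing B e (l ∘ₗ (Ideal.Quotient.mkₐ k (𝔭 ^ N)).toLinearMap) = ψ l)
    {r : ℕ} (h : Fin r → sf)
    (b : Module.Basis (Fin r) (AdicCompletion 𝔭 A) (AdicCompletion 𝔭 A ⊗[A] sf))
    (hb : ∀ i, b i = 1 ⊗ₜ h i) (l₀ : Module.Dual k (A ⧸ 𝔭 ^ N))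
    (hgen : ∀ l : Module.Dual k (A ⧸ 𝔭 ^ N), ∃ a : A,
      l = l₀ ∘ₗ LinearMap.mulLeft k (Ideal.Quotient.mk _ a)) :
    ∃ b' : Module.Basis (Fin r) (A ⧸ 𝔭 ^ N) (Submodule.torsionBySet A M ((𝔭 ^ N : Ideal A) : Set A)),
      ∀ i, (b' i : M) = dualPairing B (h i) (l₀ ∘ₗ (Ideal.Quotient.mkₐ k (𝔭 ^ N)).toLinearMap) := by
  have hsf' : ∀ e ∈ sf, IsSpecialFamily B e := fun e he => (hsf e).1 he
  have hmax : 𝔭.IsMaximal := isMaximal_of_notMem_sq hπ hπ'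
  have hrepr : ∀ e : sf, (1 : AdicCompletion 𝔭 A) ⊗ₜ[A] e =
      ∑ i, (b.repr (1 ⊗ₜ e) i) ⊗ₜ[A] h i := fun e => by
    conv_lhs => rw [← b.sum_repr (1 ⊗ₜ e)]
    refine Finset.sum_congr rfl fun i _ => ?_
    rw [hb, TensorProduct.smul_tmul', smul_eq_mul, mul_one]
  -- a combination that vanishes at `l₀` vanishes on the dual of `A/𝔭ᴺ`, hence is divisible by `π^N`
  have hli : LinearIndependent (A ⧸ 𝔭 ^ N) fun i => evalForm hsf' (𝔭 ^ N) l₀ (h i) := by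
    rw [Fintype.linearIndependent_iff]
    intro g hg
    choose a ha using fun i => Ideal.Quotient.mk_surjective (g i)
    obtain rfl : (fun i => Ideal.Quotient.mk (𝔭 ^ N) (a i)) = g := funext ha
    let f : sf := ∑ i, a i • h i
    have hf : evalForm hsf' (𝔭 ^ N) l₀ f = 0 := by
      rw [map_sum, ← hg]
      exact Finset.sum_congr rfl fun i _ => map_smul _ _ _
    have hf0 : ∀ l : Module.Dual k A, (∀ x ∈ 𝔭 ^ N, l x = 0) → dualPairing B (f : ι → M) l = 0 := by
      intro l hl
      obtain ⟨c, hc⟩ := hgen (dualQuotientLift l hl)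
      have h1 := evalForm_comp_mulLeft hsf' (𝔭 ^ N) l₀ c f
      rw [← hc, hf, smul_zero] at h1
      exact congrArg Subtype.val h1
    obtain ⟨s, hs, e', he', hse⟩ := (hsf' f f.2).exists_smul_eq_pow_smul hπ hπ' N hf0
    have hse' : s • f = π ^ N • (⟨e', (hsf e').2 he'⟩ : sf) := Subtype.ext hse
    have h2 := congrArg (fun z : sf => (1 : AdicCompletion 𝔭 A) ⊗ₜ[A] z) hse'
    intro i
    have h3 : algebraMap A (AdicCompletion 𝔭 A) (s * a i) = algebraMap A _ (π ^ N) *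
        b.repr (1 ⊗ₜ (⟨e', (hsf e').2 he'⟩ : sf)) i := by
      have h4 := congrArg (fun z => b.repr z i) h2
      have h5 : ∀ (c : A) (z : sf), (1 : AdicCompletion 𝔭 A) ⊗ₜ[A] (c • z) =
          algebraMap A (AdicCompletion 𝔭 A) c • (1 ⊗ₜ[A] z) := fun c z => by
        rw [algebraMap_smul, TensorProduct.tmul_smul]
      have h6 : (1 : AdicCompletion 𝔭 A) ⊗ₜ[A] f =
          ∑ i, algebraMap A (AdicCompletion 𝔭 A) (a i) • b i := by
        rw [TensorProduct.tmul_sum]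
        exact Finset.sum_congr rfl fun i _ => by rw [h5, hb]
      rw [h5, h5, map_smul, map_smul, Finsupp.smul_apply, Finsupp.smul_apply, h6, b.repr_sum_self,
        smul_eq_mul, smul_eq_mul, ← map_mul] at h4
      exact h4
    have h7 := congrArg (AdicCompletion.evalₐ 𝔭 N) h3
    rw [map_mul (AdicCompletion.evalₐ 𝔭 N), AdicCompletion.evalₐ_algebraMap,
      AdicCompletion.evalₐ_algebraMap, Ideal.Quotient.eq_zero_iff_mem.2 (Ideal.pow_mem_pow hπ N),
      zero_mul, map_mul] at h7
    exact (isUnit_mk_pow_of_notMem hs N).mul_right_eq_zero.1 h7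
  -- `m` is the value at `l₀` of the `A`-linear map `ψ` with `l₀ ∘ a ↦ a m`
  have hspan : ⊤ ≤ Submodule.span (A ⧸ 𝔭 ^ N)
      (Set.range fun i => evalForm hsf' (𝔭 ^ N) l₀ (h i)) := by
    rintro ⟨m, hm⟩ -
    rw [Submodule.mem_torsionBySet_iff] at hm
    choose a ha using hgen
    have hfaith : ∀ c c' : A, l₀ ∘ₗ LinearMap.mulLeft k (Ideal.Quotient.mk (𝔭 ^ N) c) =
        l₀ ∘ₗ LinearMap.mulLeft k (Ideal.Quotient.mk (𝔭 ^ N) c') → c • m = c' • m := by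
      intro c c' hcc
      have h1 : Ideal.Quotient.mk (𝔭 ^ N) (c - c') = 0 := by
        rw [← Module.forall_dual_apply_eq_zero_iff k]
        intro l
        have h2 := LinearMap.congr_fun hcc (Ideal.Quotient.mk (𝔭 ^ N) (a l))
        rw [ha l]
        change l₀ (Ideal.Quotient.mk _ (a l) * Ideal.Quotient.mk _ (c - c')) = 0
        rw [map_sub, mul_sub, map_sub, mul_comm, mul_comm _ (Ideal.Quotient.mk _ c'), sub_eq_zero]
        exact h2
      rw [← sub_eq_zero, ← sub_smul]
      exact hm ⟨_, Ideal.Quotient.eq_zero_iff_mem.1 h1⟩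
    obtain ⟨ψ, hψ⟩ : ∃ ψ : Module.Dual k (A ⧸ 𝔭 ^ N) →+ M, ∀ l, ψ l = a l • m := by
      refine ⟨AddMonoidHom.mk' (fun l => a l • m) fun l l' => ?_, fun l => rfl⟩
      rw [← add_smul]
      refine hfaith _ _ ((ha _).symm.trans
        ((congrArg₂ (· + ·) (ha l) (ha l')).trans (LinearMap.ext fun x => ?_)))
      change l₀ (Ideal.Quotient.mk _ (a l) * x) + l₀ (Ideal.Quotient.mk _ (a l') * x) =
        l₀ (Ideal.Quotient.mk _ (a l + a l') * x)
      rw [map_add (Ideal.Quotient.mk _), add_mul, map_add]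
    have hψlin : ∀ (c : A) l, ψ (l ∘ₗ LinearMap.mulLeft k (Ideal.Quotient.mk _ c)) = c • ψ l := by
      intro c l
      rw [hψ, hψ, smul_smul]
      refine hfaith _ _ ((ha _).symm.trans
        ((congrArg (· ∘ₗ LinearMap.mulLeft k (Ideal.Quotient.mk _ c)) (ha l)).trans
          (LinearMap.ext fun x => ?_)))
      change l₀ (Ideal.Quotient.mk _ (a l) * (Ideal.Quotient.mk _ c * x)) =
        l₀ (Ideal.Quotient.mk _ (c * a l) * x)
      rw [map_mul (Ideal.Quotient.mk _), mul_left_comm, mul_assoc]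
    obtain ⟨e, he, hel⟩ := hext ψ hψlin
    have hm1 : evalForm hsf' (𝔭 ^ N) l₀ ⟨e, (hsf e).2 he⟩ =
        ⟨m, (Submodule.mem_torsionBySet_iff _ _).2 hm⟩ := by
      refine Subtype.ext ?_
      rw [coe_evalForm, hel, hψ]
      refine (hfaith (a l₀) 1 ?_).trans (one_smul A m)
      rw [← ha, map_one, LinearMap.mulLeft_one, LinearMap.comp_id]
    obtain ⟨Θ, hΘ⟩ := exists_linearMap_tensor (𝔭 := 𝔭) N (evalForm hsf' (𝔭 ^ N) l₀)
    have h1 := congrArg Θ (hrepr ⟨e, (hsf e).2 he⟩)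
    rw [hΘ, map_one, one_smul, hm1, map_sum] at h1
    rw [h1]
    refine Submodule.sum_mem _ fun i _ => ?_
    rw [hΘ]
    exact Submodule.smul_mem _ _ (Submodule.subset_span ⟨i, rfl⟩)
  exact ⟨Module.Basis.mk hli hspan, fun i => by rw [Module.Basis.mk_apply, coe_evalForm]⟩

end TorsionBasis

/-! ### Special functions in the `𝔭`-adic completion -/

section Slices

open Filter

variable {k W V M : Type*} [Field k] [AddCommGroup W] [Module k W] [AddCommGroup V] [Module k V]
  [AddCommGroup M] [Module k M]

/-- The map `λ ⊗ id : W ⊗ M → M`. -/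
noncomputable def slice (l : Module.Dual k W) : W ⊗[k] M →ₗ[k] M :=
  (TensorProduct.lid k M).toLinearMap ∘ₗ LinearMap.rTensor M l

theorem slice_tmul (l : Module.Dual k W) (w : W) (m : M) : slice l (w ⊗ₜ[k] m) = l w • m := by
  simp [slice]

theorem slice_rTensor (l : Module.Dual k V) (f : W →ₗ[k] V) (z : W ⊗[k] M) :
    slice l (LinearMap.rTensor M f z) = slice (l ∘ₗ f) z := by
  rw [slice, slice, LinearMap.rTensor_comp]; rfl

theorem slice_lTensor {M' : Type*} [AddCommGroup M'] [Module k M'] (l : Module.Dual k W)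
    (f : M →ₗ[k] M') (z : W ⊗[k] M) : slice l (LinearMap.lTensor W f z) = f (slice l z) := by
  induction z with
  | zero => simp
  | add x y hx hy => simp only [map_add, hx, hy]
  | tmul w m => rw [LinearMap.lTensor_tmul, slice_tmul, slice_tmul, map_smul]

theorem slice_sub (l l' : Module.Dual k W) (z : W ⊗[k] M) :
    slice (l - l') z = slice l z - slice l' z := by
  rw [slice, slice, slice, LinearMap.rTensor_sub]
  simp

theorem slice_smul {A : Type*} [CommRing A] [Algebra k A] {I : Ideal A} (l : Module.Dual k (A ⧸ I))
    (a : A) (z : (A ⧸ I) ⊗[k] M) :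
    slice l (a • z) = slice (l ∘ₗ LinearMap.mulLeft k (Ideal.Quotient.mk I a)) z := by
  induction z with
  | zero => rw [smul_zero, map_zero, map_zero]
  | add x y hx hy => rw [smul_add, map_add, map_add, hx, hy]
  | tmul w m => rw [TensorProduct.smul_tmul', slice_tmul, slice_tmul]; rfl

theorem sum_tmul_slice {J : Type*} [Fintype J] (v : Module.Basis J k W) (z : W ⊗[k] M) :
    z = ∑ j, v j ⊗ₜ[k] slice (v.coord j) z := by
  induction z with
  | zero => simp
  | add x y hx hy =>
    conv_lhs => rw [hx, hy]
    simp only [map_add, TensorProduct.tmul_add, Finset.sum_add_distrib]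
  | tmul w m =>
    simp only [slice_tmul, ← TensorProduct.smul_tmul]
    rw [← TensorProduct.sum_tmul]
    congr 1
    exact (v.sum_repr w).symm

theorem slice_zero (z : W ⊗[k] M) : slice (0 : Module.Dual k W) z = 0 := by
  rw [slice, LinearMap.rTensor_zero, LinearMap.comp_zero, LinearMap.zero_apply]

variable [Module.Finite k W]

theorem slice_ext {z z' : W ⊗[k] M} (h : ∀ l : Module.Dual k W, slice l z = slice l z') : z = z' := by
  rw [sum_tmul_slice (Module.finBasis k W) z, sum_tmul_slice (Module.finBasis k W) z']
  simp only [h]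

theorem mem_range_lTensor_of_slice {T : Submodule k M} {z : W ⊗[k] M}
    (h : ∀ l : Module.Dual k W, slice l z ∈ T) : z ∈ LinearMap.range (LinearMap.lTensor W T.subtype) := by
  rw [sum_tmul_slice (Module.finBasis k W) z]
  refine Submodule.sum_mem _ fun j _ => ?_
  exact ⟨Module.finBasis k W j ⊗ₜ ⟨_, h _⟩, rfl⟩

end Slices

namespace AndersonModule

open Filter

variable {Fq A L C : Type*} [Field Fq] [CommRing A] [Algebra Fq A] [Field L]
    [Algebra A L] [NormedField C] [Algebra L C] [Algebra Fq C] {d : ℕ}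
    (E : AndersonModule Fq A L C d)

noncomputable instance : UniformSpace E.Points := inferInstanceAs (UniformSpace (Fin d → C))
instance : IsUniformAddGroup E.Points := inferInstanceAs (IsUniformAddGroup (Fin d → C))
instance : T2Space E.Points := inferInstanceAs (T2Space (Fin d → C))
instance [CompleteSpace C] : CompleteSpace E.Points := inferInstanceAs (CompleteSpace (Fin d → C))
instance : ContinuousConstSMul A E.Points := ⟨E.continuous_φ⟩
instance : ContinuousConstSMul Fq E.Points := ⟨fun c => by
  simp only [← algebraMap_smul A c]
  exact continuous_const_smul _⟩
instance [IsUltrametricDist C] : NonarchimedeanAddGroup E.Points :=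
  inferInstanceAs (NonarchimedeanAddGroup (Fin d → C))

variable {E} {ι : Type*} {B : Module.Basis ι Fq A} {𝔭 : Ideal A}

theorem mem_specialFunctions_iff {e : ι → E.Points} :
    e ∈ E.specialFunctions B ↔ IsSpecialFamily B e := Iff.rfl

section HatH

variable {n : ℕ} {z : E.PadicSeq 𝔭}

/-- For `z ∈ Ĥ_𝔭` the functionals `λ ↦ (λ ⊗ id)(z mod 𝔭ⁿ⁺¹)` are `A`-linear. -/
theorem slice_comp_mulLeft (hz : z ∈ E.hatH 𝔭) (n : ℕ)
    (l : Module.Dual Fq (A ⧸ 𝔭 ^ (n + 1))) (a : A) :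
    slice (l ∘ₗ LinearMap.mulLeft Fq (Ideal.Quotient.mk _ a)) (z n) = a • slice l (z n) := by
  rw [← slice_smul, ← hz.2, slice_lTensor]; rfl

theorem mem_tensorTorsion_of_slice {W : Type*} [AddCommGroup W] [Module Fq W] [Module.Finite Fq W]
    {𝔞 : Ideal A} {z : W ⊗[Fq] E.Points} (h : ∀ (l : Module.Dual Fq W), ∀ a ∈ 𝔞, a • slice l z = 0) :
    z ∈ E.tensorTorsion W 𝔞 := by
  refine mem_range_lTensor_of_slice (T := (E.torsion 𝔞).restrictScalars Fq) fun l => ?_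
  rw [Submodule.restrictScalars_mem, Submodule.mem_torsionBySet_iff]
  exact fun a => h l a a.2

theorem slice_evalAt_hyperOp (D : Hyperderivation Fq (AdicCompletion 𝔭 A)) (n : ℕ)
    (l : Module.Dual Fq (A ⧸ 𝔭)) :
    slice l (E.evalAt (E.hyperOp D n z)) = slice (l ∘ₗ D.residueOp n) (z (0 + n)) := by
  rw [evalAt, hyperOp, slice_rTensor, slice_rTensor]; rfl

theorem slice_evalAt_leftMul (u : AdicCompletion 𝔭 A) (l : Module.Dual Fq (A ⧸ 𝔭)) :
    slice l (E.evalAt (E.leftMul u z)) =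
      slice (l ∘ₗ LinearMap.mulLeft Fq (adicResidue 𝔭 u)) (E.evalAt z) := by
  rw [evalAt, leftMul, evalAt, slice_rTensor, slice_rTensor, slice_rTensor]
  refine congrArg (fun f => slice f (z 0)) (LinearMap.ext fun x => congrArg l ?_)
  exact map_mul (Ideal.Quotient.factor (Ideal.pow_le_self (Nat.succ_ne_zero 0))) _ _

theorem traceMap_eq_slice (z : (A ⧸ 𝔭) ⊗[Fq] E.Points) :
    E.traceMap 𝔭 z = slice (Algebra.trace Fq (A ⧸ 𝔭)) z := rfl

/-- The values of `∂⁽ⁿ⁾` on `A/𝔭` only depend on classes modulo `𝔭ⁿ⁺¹`, so that `𝔭ⁿ⁺¹` kills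
`∂⁽ⁿ⁾(z)(𝔭)` for `z ∈ Ĥ_𝔭`. -/
theorem evalAt_hyperOp_mem [Module.Finite Fq (A ⧸ 𝔭)] (hz : z ∈ E.hatH 𝔭)
    (D : Hyperderivation Fq (AdicCompletion 𝔭 A)) (n : ℕ) :
    E.evalAt (E.hyperOp D n z) ∈ E.tensorTorsion (A ⧸ 𝔭) (𝔭 ^ (n + 1)) := by
  refine mem_tensorTorsion_of_slice fun l a ha => ?_
  have h0 : Ideal.Quotient.mk (𝔭 ^ (0 + n + 1)) a = 0 := by
    rw [Ideal.Quotient.eq_zero_iff_mem, zero_add]; exact ha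
  rw [slice_evalAt_hyperOp, ← slice_comp_mulLeft hz, h0, LinearMap.mulLeft_zero_eq_zero,
    LinearMap.comp_zero, slice_zero]

/-- Two hyperderivatives differ by `𝔭ⁿ`-torsion if the operators have the same reduction on `𝔭ⁿ` up to
a factor. -/
theorem evalAt_hyperOp_sub_mem [Module.Finite Fq (A ⧸ 𝔭)] (hz : z ∈ E.hatH 𝔭)
    (D D' : Hyperderivation Fq (AdicCompletion 𝔭 A)) (n : ℕ) (u : AdicCompletion 𝔭 A)
    (h : ∀ y ∈ 𝔭 ^ n, D.residueOp n (Ideal.Quotient.mk _ y) =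
      adicResidue 𝔭 u * D'.residueOp n (Ideal.Quotient.mk _ y)) :
    E.evalAt (E.hyperOp D n z) - E.evalAt (E.leftMul u (E.hyperOp D' n z)) ∈
      E.tensorTorsion (A ⧸ 𝔭) (𝔭 ^ n) := by
  refine mem_tensorTorsion_of_slice fun l a ha => ?_
  have h0 : (l ∘ₗ D.residueOp n - (l ∘ₗ LinearMap.mulLeft Fq (adicResidue 𝔭 u)) ∘ₗ D'.residueOp n) ∘ₗ
      LinearMap.mulLeft Fq (Ideal.Quotient.mk (𝔭 ^ (0 + n + 1)) a) = 0 := by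
    refine LinearMap.ext fun x => ?_
    obtain ⟨x, rfl⟩ := Ideal.Quotient.mk_surjective x
    have h1 := h (a * x) (Ideal.mul_mem_right _ _ ha)
    rw [map_mul (Ideal.Quotient.mk _)] at h1
    exact sub_eq_zero.2 (congrArg l h1)
  rw [map_sub, slice_evalAt_leftMul, slice_evalAt_hyperOp, slice_evalAt_hyperOp, ← slice_sub,
    ← slice_comp_mulLeft hz, h0, slice_zero]

end HatH

section ToPadic

variable [Finite Fq] [IsUltrametricDist C] [CompleteSpace C]

/-- The functional of the image of a series in `E_𝔭` is the restriction of the functional of the series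
to the forms on `A/𝔭ⁿ⁺¹`. The defining sum converges in `A/𝔭ⁿ⁺¹ ⊗ E` for the initial topology of
the maps `λ ⊗ id`, which is Hausdorff as these maps separate points. -/
theorem slice_toPadic {e : ι → E.Points} (he : Tendsto e cofinite (𝓝 0)) (n : ℕ)
    [Module.Finite Fq (A ⧸ 𝔭 ^ (n + 1))] (l : Module.Dual Fq (A ⧸ 𝔭 ^ (n + 1))) :
    slice l (E.toPadic 𝔭 B e n) =
      dualPairing B e (l ∘ₗ (Ideal.Quotient.mkₐ Fq (𝔭 ^ (n + 1))).toLinearMap) := by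
  let W := A ⧸ 𝔭 ^ (n + 1)
  let τ : TopologicalSpace (W ⊗[Fq] E.Points) := E.sliceTopology W
  have hcont : Continuous fun (z : W ⊗[Fq] E.Points) (l : Module.Dual Fq W) => slice l z :=
    continuous_pi fun l => continuous_iff_le_induced.2 (iInf_le _ l)
  have hT2 : T2Space (W ⊗[Fq] E.Points) := T2Space.of_injective_continuous
    (fun z z' h => slice_ext fun l => congrFun h l) hcont
  let v := Module.finBasis Fq W
  let z : W ⊗[Fq] E.Points := ∑ j, v j ⊗ₜ[Fq]
    dualPairing B e (v.coord j ∘ₗ (Ideal.Quotient.mkₐ Fq (𝔭 ^ (n + 1))).toLinearMap)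
  have hz : ∀ l : Module.Dual Fq W, slice l z =
      dualPairing B e (l ∘ₗ (Ideal.Quotient.mkₐ Fq (𝔭 ^ (n + 1))).toLinearMap) := by
    intro l
    let Λ : Module.Dual Fq A →ₗ[Fq] E.Points :=
      { toFun := dualPairing B e
        map_add' := dualPairing_add B he
        map_smul' := dualPairing_smul B he }
    let Λ' := Λ ∘ₗ (Ideal.Quotient.mkₐ Fq (𝔭 ^ (n + 1))).toLinearMap.dualMap
    change slice l z = Λ' l
    conv_rhs => rw [← v.sum_dual_apply_smul_coord l, map_sum]
    rw [map_sum]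
    refine Finset.sum_congr rfl fun j _ => ?_
    rw [slice_tmul, map_smul]
    rfl
  have hsum : HasSum (fun b => (Ideal.Quotient.mk (𝔭 ^ (n + 1)) (B b)) ⊗ₜ[Fq] e b) z := by
    have hn : 𝓝 z = ⨅ l : Module.Dual Fq W, comap (fun z => slice l z) (𝓝 (slice l z)) :=
      nhds_iInf.trans (iInf_congr fun l => nhds_induced _ _)
    rw [HasSum, hn, tendsto_iInf]
    intro l
    rw [tendsto_comap_iff, hz]
    refine (hasSum_dualPairing B he _).congr fun s => ?_
    change _ = slice l (∑ b ∈ s, _)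
    rw [map_sum]
    exact Finset.sum_congr rfl fun b _ => (slice_tmul _ _ _).symm
  have h1 : E.toPadic 𝔭 B e n = z := hsum.tsum_eq
  rw [h1, hz]

theorem toPadic_mem_hatH {e : ι → E.Points} (he : e ∈ E.specialFunctions B)
    [∀ n, Module.Finite Fq (A ⧸ 𝔭 ^ (n + 1))] : E.toPadic 𝔭 B e ∈ E.hatH 𝔭 := by
  refine ⟨fun n => slice_ext fun l => ?_, fun a n => slice_ext fun l => ?_⟩
  · rw [slice_rTensor, slice_toPadic he.1, slice_toPadic he.1]
    rfl
  · rw [slice_lTensor, slice_smul, slice_toPadic he.1, slice_toPadic he.1]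
    exact ((mem_specialFunctions_iff.1 he).dualPairing_comp a _).symm

end ToPadic

end AndersonModule

/-! ### Torsion towers from the exponential map -/

section Exponential

open Filter

/-- A sequence tends to `0` if it does so along each residue class. -/
theorem tendsto_atTop_of_residues {X : Type*} {f : ℕ → X} {l : Filter X} {Q : ℕ} (hQ : 0 < Q)
    (h : ∀ r < Q, Tendsto (fun q => f (Q * q + r)) atTop l) : Tendsto f atTop l := by
  rw [← Nat.cofinite_eq_atTop]
  intro U hU
  rw [mem_map, mem_cofinite]
  have h1 : ∀ r ∈ Set.Iio Q, {q | f (Q * q + r) ∉ U}.Finite := fun r hr => by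
    have := h r hr hU
    rw [← Nat.cofinite_eq_atTop, mem_map, mem_cofinite] at this
    exact this
  refine Set.Finite.subset ((Set.finite_Iio Q).biUnion fun r hr => (h1 r hr).image
    fun q => Q * q + r) fun i hi => ?_
  rw [Set.mem_iUnion₂]
  refine ⟨i % Q, Nat.mod_lt _ hQ, i / Q, ?_, Nat.div_add_mod i Q⟩
  change f _ ∉ U
  rwa [Nat.div_add_mod]

/-- A matrix that differs from a scalar `θ ≠ 0` by a nilpotent has an inverse `N`, and in positive
characteristic some power of `N` is a power of `θ⁻¹`. -/
theorem exists_inv_pow_eq_smul {C : Type*} [Field C] (p : ℕ) [hp : Fact p.Prime] [CharP C p] {d : ℕ}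
    (M : Matrix (Fin d) (Fin d) C) {θ : C} (hθ : θ ≠ 0)
    (hM : IsNilpotent (M - Matrix.scalar (Fin d) θ)) :
    ∃ N : Matrix (Fin d) (Fin d) C, M * N = 1 ∧ ∃ Q, 0 < Q ∧ N ^ Q = (θ⁻¹) ^ Q • 1 := by
  obtain ⟨m, hm⟩ := hM
  have hcomm : Commute M (Matrix.scalar (Fin d) θ) :=
    (Matrix.scalar_commute θ (fun r => Commute.all θ r) M).symm
  rcases isEmpty_or_nonempty (Fin d) with hd | hd
  · exact ⟨1, Subsingleton.elim _ _, 1, one_pos, Subsingleton.elim _ _⟩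
  have : CharP (Matrix (Fin d) (Fin d) C) p := Matrix.charP p
  have hQ : M ^ p ^ m = θ ^ p ^ m • 1 := by
    have h1 : (M - Matrix.scalar (Fin d) θ) ^ p ^ m = 0 :=
      pow_eq_zero_of_le (Nat.lt_pow_self hp.out.one_lt).le hm
    rw [sub_pow_char_pow_of_commute _ _ hcomm, sub_eq_zero, ← map_pow] at h1
    rw [h1, Matrix.scalar_apply, ← Matrix.smul_one_eq_diagonal]
  have hpos : 0 < p ^ m := pow_pos hp.out.pos m
  have hinv : M * ((θ⁻¹) ^ p ^ m • M ^ (p ^ m - 1)) = 1 := by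
    rw [mul_smul_comm, ← pow_succ', Nat.sub_add_cancel hpos, hQ, smul_smul, ← mul_pow,
      inv_mul_cancel₀ hθ, one_pow, one_smul]
  refine ⟨_, hinv, p ^ m, hpos, ?_⟩
  have hc : Commute M ((θ⁻¹) ^ p ^ m • M ^ (p ^ m - 1)) :=
    ((Commute.refl M).pow_right _).smul_right _
  have h2 := hc.mul_pow (p ^ m)
  rw [hinv, one_pow, hQ, smul_mul_assoc, one_mul] at h2
  conv_rhs => rw [h2, smul_smul, ← mul_pow, inv_mul_cancel₀ hθ, one_pow, one_smul]

namespace AndersonModule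

variable {Fq A L C : Type*} [Field Fq] [CommRing A] [Algebra Fq A] [Field L]
    [Algebra A L] [NormedField C] [Algebra L C] [Algebra Fq C] {d : ℕ}
    {E : AndersonModule Fq A L C d} [IsUltrametricDist C]

/-- The exponential map is continuous at `0` along lines. -/
theorem IsExponential.tendsto_smul [Finite Fq] {e : (Fin d → C) → Fin d → C}
    (he : E.IsExponential e) {α : ℕ → C} (hα : Tendsto α atTop (𝓝 0)) (v : Fin d → C) :
    Tendsto (fun i => e (α i • v)) atTop (𝓝 0) := by
  obtain ⟨⟨c, -, hc⟩, -⟩ := he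
  obtain ⟨R, hR⟩ : ∃ R : ℝ, ∀ i, ‖(c i).mulVec fun j => v j ^ Nat.card Fq ^ i‖ ≤ R := by
    obtain ⟨R, hR⟩ := (hc v).summable.tendsto_atTop_zero.norm.bddAbove_range
    exact ⟨R, fun i => hR ⟨i, rfl⟩⟩
  have hq : 0 < Nat.card Fq := Nat.card_pos
  have hR0 : 0 ≤ R := (norm_nonneg _).trans (hR 0)
  have hbound : ∀ a : C, ‖a‖ ≤ 1 → ‖e (a • v)‖ ≤ ‖a‖ * R := by
    intro a ha
    rw [← (hc (a • v)).tsum_eq]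
    refine IsUltrametricDist.norm_tsum_le_of_forall_le_of_nonneg (by positivity) fun i => ?_
    have h1 : ((c i).mulVec fun j => (a • v) j ^ Nat.card Fq ^ i) =
        a ^ Nat.card Fq ^ i • (c i).mulVec fun j => v j ^ Nat.card Fq ^ i := by
      rw [← Matrix.mulVec_smul]
      congr 1
      ext j
      simp [mul_pow]
    rw [h1, norm_smul, norm_pow]
    refine mul_le_mul ?_ (hR i) (norm_nonneg _) (norm_nonneg _)
    exact pow_le_of_le_one (norm_nonneg _) ha (pow_pos hq i).ne'
  have h1 : ∀ᶠ i in atTop, ‖α i‖ ≤ 1 := by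
    have := hα.norm
    rw [norm_zero] at this
    exact this.eventually_le_const one_pos
  refine squeeze_zero_norm' (h1.mono fun i hi => hbound _ hi) ?_
  have := hα.norm.mul_const R
  rwa [norm_zero, zero_mul] at this

/-- On a uniformizable module all torsion points are part of a null tower: for `m = e(ℓ)` these are
the points `φ_π^{N-1}(e(dφ_π^{-i} ℓ))`. -/
theorem IsUniformizable.exists_torsionTower [Finite Fq] (hE : E.IsUniformizable) (p : ℕ)
    [Fact p.Prime] [CharP C p] {π : A} (hπ : 1 < ‖algebraMap L C (algebraMap A L π)‖) {N : ℕ}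
    (hN : 0 < N) (m : E.Points) (hm : π ^ N • m = 0) :
    ∃ x : torsionTowers E.Points π, x.1 (N - 1) = m := by
  obtain ⟨e, he, hsurj⟩ := hE
  obtain ⟨v, rfl⟩ := hsurj m
  have hθ : algebraMap L C (algebraMap A L π) ≠ 0 := norm_pos_iff.1 (one_pos.trans hπ)
  obtain ⟨J, hJ, Q, hQ, hJQ⟩ := exists_inv_pow_eq_smul p ((E.coeff π 0).map (algebraMap L C)) hθ (by
    have h1 := (E.nilpotent π).map (algebraMap L C).mapMatrix
    have h2 : (algebraMap L C).mapMatrix (Matrix.scalar (Fin d) (algebraMap A L π)) =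
        Matrix.scalar (Fin d) (algebraMap L C (algebraMap A L π)) := by
      ext i j
      by_cases hij : i = j <;> simp [hij]
    rw [map_sub, h2] at h1
    exact h1)
  let u : ℕ → E.Points := fun i => e ((J ^ i).mulVec v)
  have hu : ∀ i, π • u (i + 1) = u i := by
    intro i
    refine (he.2 π _).trans (congrArg e ?_)
    rw [lieAction, Matrix.mulVec_mulVec, pow_succ', ← mul_assoc, hJ, one_mul]
  have hu' : ∀ j i, π ^ j • u (j + i) = u i := by
    intro j
    induction j with
    | zero => intro i; rw [pow_zero, one_smul, zero_add]
    | succ j ih => intro i; rw [pow_succ, mul_smul, add_right_comm, hu, ih]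
  have hu0 : u 0 = e v := by
    change e _ = _
    rw [pow_zero, Matrix.one_mulVec]
  have htend : Tendsto u atTop (𝓝 0) := by
    refine tendsto_atTop_of_residues hQ fun r _ => ?_
    have h1 : Tendsto (fun q => (((algebraMap L C (algebraMap A L π))⁻¹) ^ Q) ^ q) atTop (𝓝 0) := by
      refine tendsto_pow_atTop_nhds_zero_of_norm_lt_one ?_
      rw [norm_pow, norm_inv]
      exact pow_lt_one₀ (by positivity) (inv_lt_one_of_one_lt₀ hπ) hQ.ne'
    have h2 := he.tendsto_smul h1 ((J ^ r).mulVec v)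
    refine h2.congr fun q => congrArg e ?_
    rw [pow_add, pow_mul, hJQ, smul_pow, one_pow, smul_mul_assoc, one_mul, Matrix.smul_mulVec]
  have h0 : (π ^ (N - 1)) • (0 : E.Points) = 0 := smul_zero _
  refine ⟨⟨fun i => π ^ (N - 1) • u i, ?_, ?_, fun i => ?_⟩, ?_⟩
  · have h1 := htend.const_smul (π ^ (N - 1))
    rwa [h0] at h1
  · rw [smul_smul, ← pow_succ', Nat.sub_add_cancel hN, hu0]
    exact hm
  · rw [smul_comm, hu]
  · have h1 := hu' (N - 1) 0
    rw [add_zero, hu0] at h1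
    exact h1

end AndersonModule

end Exponential

/-! ### The theorem -/

/-- Integers satisfy `n ^ p = n` in characteristic `p`, so that they have norm at most `1`. -/
theorem isUltrametricDist_of_charP (C : Type*) [NormedField C] (p : ℕ) [hp : Fact p.Prime]
    [CharP C p] :
    IsUltrametricDist C := by
  refine IsUltrametricDist.isUltrametricDist_of_forall_norm_natCast_le_one fun n => ?_
  have h1 : (n : C) ^ p = n := by
    have := map_natCast (frobenius C p) n
    rwa [frobenius_def] at this
  by_contra! h
  have h2 : ‖(n : C)‖ < ‖(n : C)‖ ^ p := by
    conv_lhs => rw [← pow_one ‖(n : C)‖]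
    exact pow_lt_pow_right₀ h hp.out.one_lt
  rw [← norm_pow, h1] at h2
  exact lt_irrefl _ h2

section Assembly

open Polynomial

variable {k A : Type*} [Field k] [CommRing A] [Algebra k A]

/-- The extension of `A`-linear maps `(A/𝔭ᴺ)^* → M` to special functions, for a ring `A` that is finite
over `k[π]` and a module whose torsion points lift to towers. -/
theorem exists_isSpecialFamily_of_finite_aeval [Finite k] [IsDedekindDomain A] {M ι : Type*}
    [AddCommGroup M] [Module k M] [Module A M] [IsScalarTower k A M] [UniformSpace M] [IsUniformAddGroup M]
    [CompleteSpace M] [NonarchimedeanAddGroup M] [T2Space M] [ContinuousConstSMul k M]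
    [ContinuousConstSMul A M] (B : Module.Basis ι k A) {π : A}
    (hfin : (aeval π : k[X] →ₐ[k] A).toRingHom.Finite)
    (hinj : Function.Injective (aeval π : k[X] →ₐ[k] A)) {𝔭 : Ideal A} [𝔭.IsMaximal]
    (hπ : π ∈ 𝔭) (hπ' : π ∉ 𝔭 ^ 2) {N : ℕ} (hN : 0 < N)
    (hdiv : ∀ m : M, π ^ N • m = 0 → ∃ x : torsionTowers M π, x.1 (N - 1) = m)
    (ψ : Module.Dual k (A ⧸ 𝔭 ^ N) →+ M)
    (hψ : ∀ (a : A) l, ψ (l ∘ₗ LinearMap.mulLeft k (Ideal.Quotient.mk _ a)) = a • ψ l) :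
    ∃ e, IsSpecialFamily B e ∧ ∀ l : Module.Dual k (A ⧸ 𝔭 ^ N),
      dualPairing B e (l ∘ₗ (Ideal.Quotient.mkₐ k (𝔭 ^ N)).toLinearMap) = ψ l := by
  let : Algebra k[X] A := (aeval π : k[X] →ₐ[k] A).toRingHom.toAlgebra
  have hX : algebraMap k[X] A X = π := aeval_X (R := k) π
  have : IsScalarTower k k[X] A :=
    IsScalarTower.of_algebraMap_eq fun c => (aeval π : k[X] →ₐ[k] A).commutes c |>.symm
  have : Module.Finite k[X] A := hfin
  have : FaithfulSMul k[X] A := (faithfulSMul_iff_algebraMap_injective _ _).2 hinj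
  have : Module.IsTorsionFree k[X] A := inferInstance
  rw [← hX] at hπ hπ' hdiv
  exact exists_isSpecialFamily_of_dual_quotient B hπ hπ' hN hdiv ψ hψ

variable {𝔭 : Ideal A} [𝔭.IsMaximal] {π s c : A} {Dπ Dt : Hyperderivation k (AdicCompletion 𝔭 A)}

/-- If `∂_π(s + cᵖ) = ∂_π(s)` is a unit, then `s ∉ 𝔭²`, as `∂_π` maps `𝔭²` into `𝔭`. -/
theorem notMem_sq_of_isUnit {p : ℕ} [Fact p.Prime] [CharP k p]
    (hu : IsUnit (Dπ.op 1 (algebraMap A _ (s + c ^ p)))) : s ∉ 𝔭 ^ 2 := by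
  intro hs
  rw [Dπ.op_one_add_pow] at hu
  have h1 := Dπ.op_mem_pow (𝔭.map (algebraMap A (AdicCompletion 𝔭 A))) 2 1 (algebraMap A _ s) (by
    rw [← Ideal.map_pow]; exact Ideal.mem_map_of_mem _ hs)
  have h2 := adicResidue_eq_of_sub_mem (x := Dπ.op 1 (algebraMap A _ s)) (y := 0) (by
    rw [sub_zero]; simpa using h1)
  rw [map_zero] at h2
  exact (hu.map (adicResidue 𝔭)).ne_zero h2

end Assembly

namespace AndersonModule

variable {Fq A L C : Type*} [Field Fq] [CommRing A] [IsDedekindDomain A] [Algebra Fq A]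
  [Field L] [Algebra A L] [NormedField C] [Algebra L C] [Algebra Fq C] {d : ℕ}
  {E : AndersonModule Fq A L C d} {𝔭 : Ideal A} [𝔭.IsMaximal] {π s c : A}
  {Dπ Dt : Hyperderivation Fq (AdicCompletion 𝔭 A)} {p : ℕ} [Fact p.Prime]

/-- The comparison of `∂_t⁽ⁿ⁾(z)(𝔭)` and `(∂_π(t)⁻ⁿ ∂_π⁽ⁿ⁾(z))(𝔭)` modulo `𝔭ⁿ`-torsion: on `𝔭ⁿ` the reductions
of the operators differ by the factor `∂_t(π)ⁿ`, and `∂_t(π)` is the inverse of `∂_π(t)`. -/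
theorem evalAt_hyperOp_congr [Module.Finite Fq (A ⧸ 𝔭)] [CharP Fq p] (hπ : π ∈ 𝔭) (hπ' : π ∉ 𝔭 ^ 2)
    (hDπ : Dπ.IsWithRespectTo (algebraMap A _ π)) (hs : s ∈ 𝔭)
    (hDt : Dt.IsWithRespectTo (algebraMap A _ (s + c ^ p))) {u : (AdicCompletion 𝔭 A)ˣ}
    (hu : (u : AdicCompletion 𝔭 A) = Dπ.op 1 (algebraMap A _ (s + c ^ p))) {z : E.PadicSeq 𝔭}
    (hz : z ∈ E.hatH 𝔭) (n : ℕ) :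
    E.evalAt (E.hyperOp Dt n z) - E.evalAt (E.leftMul (↑(u⁻¹ ^ n)) (E.hyperOp Dπ n z)) ∈
      E.tensorTorsion (A ⧸ 𝔭) (𝔭 ^ n) := by
  refine evalAt_hyperOp_sub_mem hz Dt Dπ n _ fun y hy => ?_
  have h1 := adicResidue_mul_eq_one hπ hπ' hDπ hs hDt
  have h2 : adicResidue 𝔭 ((u⁻¹ : (AdicCompletion 𝔭 A)ˣ) : AdicCompletion 𝔭 A) =
      adicResidue 𝔭 (Dt.op 1 (algebraMap A _ π)) := by
    rw [← hu] at h1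
    rw [← mul_one (adicResidue 𝔭 _), ← h1, ← mul_assoc, ← map_mul, Units.inv_mul, map_one, one_mul]
  rw [residueOp_eq_of_mem_pow hπ hπ' hDπ n hy, Units.val_pow_eq_pow_val, map_pow, h2]

/-- The traces of the `n`-th hyperderivatives of a basis of special functions are their values at the
form `tr ∘ ∂⁽ⁿ⁾ mod 𝔭`, which generates the dual of `A/𝔭ⁿ⁺¹`. -/
theorem exists_basis_torsion_of_isUniformizable [Finite Fq] [IsUltrametricDist C] [CompleteSpace C]
    [CharP C p] [∀ n, Module.Finite Fq (A ⧸ 𝔭 ^ n)] [Module.Finite Fq (A ⧸ 𝔭)] (hE : E.IsUniformizable)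
    {ι : Type*} {B : Module.Basis ι Fq A} (hπ : π ∈ 𝔭) (hπ' : π ∉ 𝔭 ^ 2)
    (hnorm : 1 < ‖algebraMap L C (algebraMap A L π)‖)
    (hfin : (Polynomial.aeval π : Polynomial Fq →ₐ[Fq] A).toRingHom.Finite)
    (hinj : Function.Injective (Polynomial.aeval π : Polynomial Fq →ₐ[Fq] A))
    (hD : adicResidue 𝔭 (Dt.op 1 (algebraMap A _ π)) ≠ 0)
    {r : ℕ} (h : Fin r → E.specialFunctions B)
    (b : Module.Basis (Fin r) (AdicCompletion 𝔭 A) (AdicCompletion 𝔭 A ⊗[A] E.specialFunctions B))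
    (hb : ∀ i, b i = 1 ⊗ₜ h i) (n : ℕ) :
    ∃ b : Module.Basis (Fin r) (A ⧸ 𝔭 ^ (n + 1)) (E.torsion (𝔭 ^ (n + 1))),
      ∀ i, (b i : E.Points) = E.traceMap 𝔭 (E.evalAt (E.hyperOp Dt n (E.toPadic 𝔭 B (h i)))) := by
  -- `residueOp n` is defined on `A ⧸ 𝔭 ^ (0 + n + 1)`, as `evalAt` takes the component of index `0`
  have key : ∃ b : Module.Basis (Fin r) (A ⧸ 𝔭 ^ (0 + n + 1)) (E.torsion (𝔭 ^ (0 + n + 1))),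
      ∀ i, (b i : E.Points) = E.traceMap 𝔭 (E.evalAt (E.hyperOp Dt n (E.toPadic 𝔭 B (h i)))) := by
    obtain ⟨b', hb'⟩ := exists_basis_torsion (fun e => mem_specialFunctions_iff) hπ hπ' (0 + n + 1)
      (exists_isSpecialFamily_of_finite_aeval B hfin hinj hπ hπ' (Nat.succ_pos _)
        (hE.exists_torsionTower p hnorm (Nat.succ_pos _))) h b hb
      (Algebra.trace Fq (A ⧸ 𝔭) ∘ₗ Dt.residueOp n)
      (exists_dual_eq_trace_residueOp Dt hπ hπ' hD n)
    refine ⟨b', fun i => (hb' i).trans ?_⟩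
    rw [traceMap_eq_slice, slice_evalAt_hyperOp, slice_toPadic (h i).2.1]
  rwa [Nat.zero_add] at key

/-- The statements on the hyperderivation with respect to an element `t` for which `∂_π(t)` is a unit,
for a coefficient ring `A` that is a Dedekind domain finite over `Fq[π]`. -/
theorem hyperderivatives_of_isUnit {K : Type*} [Field K] [Algebra A K] [IsFractionRing A K] [CharP K p]
    [CharP A p] [CharP Fq p] [Finite Fq] [IsUltrametricDist C] [CompleteSpace C] [CharP C p]
    [∀ n, Module.Finite Fq (A ⧸ 𝔭 ^ n)] [Module.Finite Fq (A ⧸ 𝔭)] (hE : E.IsUniformizable)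
    (hspan : ∀ x : K, (∀ z, z ^ p ≠ x) → FrobeniusSpans p x)
    {ι : Type*} {B : Module.Basis ι Fq A} (hπ : π ∈ 𝔭) (hπ' : π ∉ 𝔭 ^ 2)
    (hnorm : 1 < ‖algebraMap L C (algebraMap A L π)‖)
    (hfin : (Polynomial.aeval π : Polynomial Fq →ₐ[Fq] A).toRingHom.Finite)
    (hinj : Function.Injective (Polynomial.aeval π : Polynomial Fq →ₐ[Fq] A))
    {r : ℕ} (h : Fin r → E.specialFunctions B)
    (hbasis : ∃ b : Module.Basis (Fin r) (AdicCompletion 𝔭 A)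
      (AdicCompletion 𝔭 A ⊗[A] E.specialFunctions B), ∀ i, b i = 1 ⊗ₜ h i)
    (hDπ : Dπ.IsWithRespectTo (algebraMap A _ π)) (t : A) {u : (AdicCompletion 𝔭 A)ˣ}
    (hu : (u : AdicCompletion 𝔭 A) = Dπ.op 1 (algebraMap A _ t)) :
    (∃! D : Hyperderivation Fq (Localization.AtPrime 𝔭), D.IsWithRespectTo (algebraMap A _ t)) ∧
    (∃! D : Hyperderivation Fq (AdicCompletion 𝔭 A), D.IsWithRespectTo (algebraMap A _ t)) ∧
    ∀ Dt : Hyperderivation Fq (AdicCompletion 𝔭 A), Dt.IsWithRespectTo (algebraMap A _ t) →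
    (∀ D : Hyperderivation Fq (Localization.AtPrime 𝔭), D.IsWithRespectTo (algebraMap A _ t) →
      ∃ j : Localization.AtPrime 𝔭 →ₐ[A] AdicCompletion 𝔭 A, ∀ n x, j (D.op n x) = Dt.op n (j x)) ∧
    (∀ z ∈ E.hatH 𝔭, ∀ n : ℕ,
      E.evalAt (E.hyperOp Dt n z) ∈ E.tensorTorsion (A ⧸ 𝔭) (𝔭 ^ (n + 1)) ∧
      E.evalAt (E.hyperOp Dt n z) - E.evalAt (E.leftMul (↑(u⁻¹ ^ n)) (E.hyperOp Dπ n z)) ∈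
        E.tensorTorsion (A ⧸ 𝔭) (𝔭 ^ n)) ∧
    ∀ n : ℕ, ∃ b : Module.Basis (Fin r) (A ⧸ 𝔭 ^ (n + 1)) (E.torsion (𝔭 ^ (n + 1))),
      ∀ i, (b i : E.Points) = E.traceMap 𝔭 (E.evalAt (E.hyperOp Dt n (E.toPadic 𝔭 B (h i)))) := by
  -- the residue field is perfect, so `t` is a `p`-th power plus an element `s` of `𝔭`
  obtain ⟨c, hc⟩ := exists_pow_sub_mem (k := Fq) (p := p) (I := 𝔭) t
  obtain ⟨s, rfl⟩ : ∃ s, t = s + c ^ p := ⟨t - c ^ p, by ring⟩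
  rw [add_sub_cancel_right] at hc
  have hs' : s ∉ 𝔭 ^ 2 := notMem_sq_of_isUnit (hu ▸ u.isUnit)
  obtain ⟨hex, hcomp⟩ := existsUnique_hyperderivation_adicCompletion Fq hspan hc hs' c
  refine ⟨existsUnique_hyperderivation_localization Fq hspan hc hs' c, hex, fun Dt hDt =>
    ⟨hcomp Dt hDt, fun z hz n => ⟨evalAt_hyperOp_mem hz Dt n,
      evalAt_hyperOp_congr hπ hπ' hDπ hc hDt hu hz n⟩, ?_⟩⟩
  have hD : adicResidue 𝔭 (Dt.op 1 (algebraMap _ _ π)) ≠ 0 :=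
    have : Nontrivial (A ⧸ 𝔭) := (Ideal.Quotient.nontrivial_iff).2 (Ideal.IsPrime.ne_top')
    right_ne_zero_of_mul_eq_one (adicResidue_mul_eq_one hπ hπ' hDπ hc hDt)
  obtain ⟨b, hb⟩ := hbasis
  exact exists_basis_torsion_of_isUniformizable (p := p) hE hπ hπ' hnorm hfin hinj hD h b hb

end AndersonModule

theorem norm_algebraMap_completion {K : Type*} [Field K] (w : AbsoluteValue (AlgebraicClosure K) ℝ)
    (L : IntermediateField K w.Completion) {k : Type*} [Field k] [Algebra k K] {A : Subalgebra k K}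
    (x : A) : ‖algebraMap L w.Completion (algebraMap A L x)‖ =
      w (algebraMap K (AlgebraicClosure K) x) := by
  have h1 : algebraMap L w.Completion (algebraMap A L x) =
      ((algebraMap K (WithAbs w) x : WithAbs w) : w.Completion) := rfl
  rw [h1, UniformSpace.Completion.norm_coe]
  rfl

set_option maxHeartbeats 1000000 in
theorem theoremD
    {Fq K : Type*} [Field Fq] [Finite Fq] [Field K] [Algebra Fq K]
    (hK : IsCurveFunctionField Fq K)
    -- the place `∞`, the ring `A`, and a place `w` above `∞` of an algebraic closure of `K`
    (P : ValuationSubring K) (hP : P ≠ ⊤)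
    (w : AbsoluteValue (AlgebraicClosure K) ℝ)
    (hw : ∀ x : K, w (algebraMap K (AlgebraicClosure K) x) ≤ 1 ↔ x ∈ P)
    (L : IntermediateField K w.Completion) {d : ℕ}
    (E : AndersonModule Fq (regularOutside Fq P) L w.Completion d)
    (hE : E.IsUniformizable)
    {ι : Type*} (B : Module.Basis ι Fq (regularOutside Fq P))
    (𝔭 : Ideal (regularOutside Fq P)) [𝔭.IsPrime]
    (π : regularOutside Fq P) (hπ : π ∈ 𝔭) (hπ' : π ∉ 𝔭 ^ 2)
    {r : ℕ} (h : Fin r → E.specialFunctions B)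
    (hbasis : ∃ b : Module.Basis (Fin r) (AdicCompletion 𝔭 (regularOutside Fq P))
        (AdicCompletion 𝔭 (regularOutside Fq P) ⊗[regularOutside Fq P] E.specialFunctions B),
      ∀ i, b i = 1 ⊗ₜ h i) :
    -- the hyperderivation with respect to `π` exists and is unique
    (∃! D : Hyperderivation Fq (AdicCompletion 𝔭 (regularOutside Fq P)),
      D.IsWithRespectTo (algebraMap _ _ π)) ∧
    -- special functions are elements of `Ĥ_𝔭`
    (∀ f : E.specialFunctions B, E.toPadic 𝔭 B f ∈ E.hatH 𝔭) ∧
    ∀ Dπ : Hyperderivation Fq (AdicCompletion 𝔭 (regularOutside Fq P)),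
      Dπ.IsWithRespectTo (algebraMap _ _ π) →
    ∀ (t : regularOutside Fq P) (u : (AdicCompletion 𝔭 (regularOutside Fq P))ˣ),
      t ∉ (algebraMap Fq (regularOutside Fq P)).range →
      (u : AdicCompletion 𝔭 (regularOutside Fq P)) = Dπ.op 1 (algebraMap _ _ t) →
    -- the hyperderivation with respect to `t` extends uniquely to `A_(𝔭)` and to `A_𝔭`
    (∃! D : Hyperderivation Fq (Localization.AtPrime 𝔭),
      D.IsWithRespectTo (algebraMap _ _ t)) ∧
    (∃! D : Hyperderivation Fq (AdicCompletion 𝔭 (regularOutside Fq P)),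
      D.IsWithRespectTo (algebraMap _ _ t)) ∧
    ∀ Dt : Hyperderivation Fq (AdicCompletion 𝔭 (regularOutside Fq P)),
      Dt.IsWithRespectTo (algebraMap _ _ t) →
    -- the extension to `A_𝔭` restricts to the one on `A_(𝔭)`
    (∀ D : Hyperderivation Fq (Localization.AtPrime 𝔭), D.IsWithRespectTo (algebraMap _ _ t) →
      ∃ j : Localization.AtPrime 𝔭 →ₐ[regularOutside Fq P]
          AdicCompletion 𝔭 (regularOutside Fq P),
        ∀ n x, j (D.op n x) = Dt.op n (j x)) ∧
    -- values at `𝔭` of hyperderivatives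
    (∀ z ∈ E.hatH 𝔭, ∀ n : ℕ,
      E.evalAt (E.hyperOp Dt n z) ∈ E.tensorTorsion (regularOutside Fq P ⧸ 𝔭) (𝔭 ^ (n + 1)) ∧
      E.evalAt (E.hyperOp Dt n z) - E.evalAt (E.leftMul (↑(u⁻¹ ^ n)) (E.hyperOp Dπ n z)) ∈
        E.tensorTorsion (regularOutside Fq P ⧸ 𝔭) (𝔭 ^ n)) ∧
    -- their traces form a basis of the torsion
    ∀ n : ℕ, ∃ b : Module.Basis (Fin r) (regularOutside Fq P ⧸ 𝔭 ^ (n + 1))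
        (E.torsion (𝔭 ^ (n + 1))),
      ∀ i, (b i : E.Points) = E.traceMap 𝔭 (E.evalAt (E.hyperOp Dt n (E.toPadic 𝔭 B (h i)))) := by
  obtain ⟨p, hcharF⟩ := CharP.exists Fq
  have hp : Fact p.Prime := ⟨CharP.char_is_prime Fq p⟩
  have hcharK : CharP K p := charP_of_injective_algebraMap (algebraMap Fq K).injective p
  have hcharC : CharP w.Completion p :=
    charP_of_injective_algebraMap (algebraMap K w.Completion).injective p
  have hult : IsUltrametricDist w.Completion := isUltrametricDist_of_charP _ p
  have hprime : 𝔭.IsPrime := inferInstance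
  -- a `p`-th power in `𝔭` lies in `𝔭²`
  have hroot : ∀ y : regularOutside Fq P, y ^ p ≠ π := by
    rintro y rfl
    exact hπ' (Ideal.pow_le_pow_right hp.out.two_le
      (Ideal.pow_mem_pow (hprime.mem_of_pow_mem _ hπ) p))
  have hA := hK.regularOutside_structure P π hroot
  have hded := hA.1
  have hfrac := hA.2.1
  have hfin := hA.2.2.1
  have hinj := hA.2.2.2.1
  have hπP := hA.2.2.2.2.1
  have hspan := hA.2.2.2.2.2
  have hmax : 𝔭.IsMaximal := isMaximal_of_notMem_sq hπ hπ'
  have hfinq : ∀ n, Module.Finite Fq (regularOutside Fq P ⧸ 𝔭 ^ n) := fun n =>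
    finite_quotient_of_pow_mem hfin (Ideal.pow_mem_pow hπ n)
  have hfin1 : Module.Finite Fq (regularOutside Fq P ⧸ 𝔭) :=
    finite_quotient_of_pow_mem (n := 1) hfin (by rwa [pow_one])
  have hcharA : CharP (regularOutside Fq P) p :=
    charP_of_injective_algebraMap (algebraMap Fq (regularOutside Fq P)).injective p
  refine ⟨?_, fun f => AndersonModule.toPadic_mem_hatH f.2, ?_⟩
  · have h1 := (existsUnique_hyperderivation_adicCompletion Fq hspan hπ hπ' 0).1
    rwa [zero_pow hp.out.ne_zero, add_zero] at h1
  intro Dπ hDπ t u _ hu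
  have hnorm : 1 < ‖algebraMap L w.Completion (algebraMap (regularOutside Fq P) L π)‖ := by
    rw [norm_algebraMap_completion, ← not_le, hw]
    exact hπP
  have hmain := AndersonModule.hyperderivatives_of_isUnit hE hspan hπ hπ' hnorm hfin hinj h hbasis
    hDπ t hu
  exact hmain
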